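/- **Lemma C.1.** Let $V:\mathbb R^2\to\mathbb R$ be a real-valued potential with $V\in L^q(\mathbb R^2)$ for some $q\in(1,\infty]$, and let $0<\alpha<\beta<1$. Let $H=-\Delta+V$ be the Schrödinger operator in the complex space $L^1(\mathbb R^2)$ with domain $\{u\in L^1:\Delta u\in L^1,\ Vu\in L^1\}$ ($\Delta$ in the sense of distributions), and let $\langle H\rangle^\alpha=(1+H^2)^{\alpha/2}$, where $\langle x\rangle=\sqrt{1+x^2}$. Here the fractional powers of a positive operator $A$ in a Banach space (i.e. $(-\infty,0]$ lies in the resolvent set and $\|(A+t)^{-1}\|\le M/(1+t)$ for all $t\ge 0$) are, for $0<p<1$, $A^{-p}=\frac{\sin \pi p}{\pi}\int_0^\infty t^{-p}(A+t)^{-1}\,dt$ and $A^p=(A^{-p})^{-1}$ with domain the range of $A^{-p}$. Let $(-\Delta+1)^{-\beta}$ be the Fourier multiplier with symbol $(1+|\xi|^2)^{-\beta}$. Then $1+H^2$ is a positive operator in $L^1(\mathbb R^2)$ and $(1+H^2)^{-\alpha/2}$ is injective, so that $\langle H\rangle^\alpha$ is well defined; and there is a constant $C$, depending on $V,\alpha,\beta$,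 such that for every $f\in L^1(\mathbb R^2)$ the function $(-\Delta+1)^{-\beta}f$ belongs to $L^1(\mathbb R^2)$ and to the domain of $\langle H\rangle^\alpha$, and $$\|\langle H\rangle^\alpha(-\Delta+1)^{-\beta}f\|_{L^1}\le C\,\|f\|_{L^1}.$$ -/

import Mathlib

open MeasureTheory Set
open scoped ENNReal SchwartzMap Laplacian

noncomputable section

namespace SchrodingerL1

/-! ### Unbounded operators on a complex Banach space and their fractional powers -/

section Abstract

variable {X : Type*} [NormedAddCommGroup X] [NormedSpace ℂ X]

/-- The graph of the square of an operator `A`: the pairs `(u, A (A u))`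
with `u ∈ D(A)` and `A u ∈ D(A)`. -/
def sqGraph (A : X →ₗ.[ℂ] X) : Submodule ℂ (X × X) where
  carrier := {p | ∃ v, (p.1, v) ∈ A.graph ∧ (v, p.2) ∈ A.graph}
  zero_mem' := ⟨0, A.graph.zero_mem, A.graph.zero_mem⟩
  add_mem' := by
    rintro p p' ⟨v, h₁, h₂⟩ ⟨v', h₁', h₂'⟩
    exact ⟨v + v', A.graph.add_mem h₁ h₁', A.graph.add_mem h₂ h₂'⟩
  smul_mem' := by
    rintro c p ⟨v, h₁, h₂⟩
    exact ⟨c • v, A.graph.smul_mem c h₁, A.graph.smul_mem c h₂⟩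

/-- The square `A²` on its natural domain. -/
def sq (A : X →ₗ.[ℂ] X) : X →ₗ.[ℂ] X := (sqGraph A).toLinearPMap

theorem mem_sq_graph (A : X →ₗ.[ℂ] X) (u w : X) :
    (u, w) ∈ (sq A).graph ↔ ∃ v, (u, v) ∈ A.graph ∧ (v, w) ∈ A.graph := by
  rw [sq, Submodule.toLinearPMap_graph_eq]
  · rfl
  · rintro ⟨x, y⟩ ⟨v, h₁, h₂⟩ hx
    have hv : v = 0 := A.graph_fst_eq_zero_snd h₁ hx
    exact A.graph_fst_eq_zero_snd h₂ hv

/-- The operator `c + A` (that is, `u ↦ c u + A u`) with domain `D(A)`. -/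
def shift (c : ℂ) (A : X →ₗ.[ℂ] X) : X →ₗ.[ℂ] X :=
  (c • (LinearMap.id : X →ₗ[ℂ] X)) +ᵥ A

/-- `R` is the bounded, everywhere defined inverse of the operator `A`:
`R x = u` exactly when `u ∈ D(A)` and `A u = x`. -/
def IsBoundedInverse (A : X →ₗ.[ℂ] X) (R : X →L[ℂ] X) : Prop :=
  ∀ u x, (u, x) ∈ A.graph ↔ R x = u

open Classical in
/-- The bounded inverse `A⁻¹` (with value `0` if there is none). -/
def boundedInverse (A : X →ₗ.[ℂ] X) : X →L[ℂ] X :=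
  if h : ∃ R, IsBoundedInverse A R then h.choose else 0

/-- `A` is a positive operator in the Banach space `X`: the half-line `(-∞, 0]` lies in the
resolvent set of `A`, and `‖(A + t)⁻¹‖ ≤ M / (1 + t)` for all `t ≥ 0`. -/
def IsPositiveOperator (A : X →ₗ.[ℂ] X) : Prop :=
  ∃ M : ℝ, ∀ t : ℝ, 0 ≤ t →
    ∃ R : X →L[ℂ] X, IsBoundedInverse (shift (t : ℂ) A) R ∧ ‖R‖ ≤ M / (1 + t)

/-- The negative fractional power of a positive operator, for `0 < p < 1`:
`A ^ (-p) = (sin (π p) / π) ∫₀^∞ t ^ (-p) (A + t)⁻¹ dt`. -/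
def negPow (A : X →ₗ.[ℂ] X) (p : ℝ) : X →L[ℂ] X :=
  ((Real.sin (Real.pi * p) / Real.pi : ℝ) : ℂ) •
    ∫ t in Ioi (0 : ℝ), ((t ^ (-p) : ℝ) : ℂ) • boundedInverse (shift (t : ℂ) A)

/-- The fractional power `A ^ p` of a positive operator, for `0 < p < 1`: the inverse of the
injective bounded operator `A ^ (-p)`, whose domain is the range of `A ^ (-p)`. -/
def fracPow (A : X →ₗ.[ℂ] X) (p : ℝ) : X →ₗ.[ℂ] X :=
  ((negPow A p : X →ₗ[ℂ] X).toPMap ⊤).inverse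

end Abstract

/-! ### The Schrödinger operator in `L¹(ℝ²)` -/

/-- The plane `ℝ²` with its Euclidean norm. -/
abbrev Plane : Type := EuclideanSpace ℝ (Fin 2)

/-- The space `L¹(ℝ²)` of complex-valued functions. -/
abbrev L1 : Type := Lp ℂ 1 (volume : Measure Plane)

/-- The graph of the Laplacian in `L¹`: the pairs `(u, w)` of `L¹` functions with `Δ u = w`
in the sense of (tempered) distributions. -/
def laplacianGraph : Submodule ℂ (L1 × L1) where
  carrier := {p | Δ (Lp.toTemperedDistributionCLM ℂ volume 1 p.1) =
    Lp.toTemperedDistributionCLM ℂ volume 1 p.2}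
  zero_mem' := by
    simp only [mem_ofPred_eq, Prod.fst_zero, Prod.snd_zero, map_zero]
    rw [← TemperedDistribution.laplacianCLM_apply, map_zero]
  add_mem' := by
    rintro p p' h h'
    simp only [mem_ofPred_eq, Prod.fst_add, Prod.snd_add, map_add,
      ← TemperedDistribution.laplacianCLM_apply] at h h' ⊢
    rw [h, h']
  smul_mem' := by
    rintro c p h
    simp only [mem_ofPred_eq, Prod.smul_fst, Prod.smul_snd, map_smul,
      ← TemperedDistribution.laplacianCLM_apply] at h ⊢
    rw [h]

/-- The Laplacian in `L¹`, with domain `{u ∈ L¹ : Δ u ∈ L¹}`. -/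
def laplacianL1 : L1 →ₗ.[ℂ] L1 := laplacianGraph.toLinearPMap

theorem mem_laplacianL1_graph (u w : L1) :
    (u, w) ∈ laplacianL1.graph ↔
      Δ (Lp.toTemperedDistributionCLM ℂ volume 1 u) =
        Lp.toTemperedDistributionCLM ℂ volume 1 w := by
  rw [laplacianL1, Submodule.toLinearPMap_graph_eq]
  · rfl
  · rintro ⟨x, y⟩ h hx
    obtain rfl : x = 0 := hx
    change Δ (Lp.toTemperedDistributionCLM ℂ volume 1 (0 : L1)) =
      Lp.toTemperedDistributionCLM ℂ volume 1 y at h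
    rw [map_zero, ← TemperedDistribution.laplacianCLM_apply, map_zero] at h
    have hk := Lp.ker_toTemperedDistributionCLM_eq_bot (F := ℂ) (E := Plane)
      (μ := volume) (p := 1)
    rw [LinearMap.ker_eq_bot'] at hk
    exact hk y h.symm

/-- The graph of multiplication by `V` in `L¹`. -/
def mulGraph (V : Plane → ℝ) : Submodule ℂ (L1 × L1) where
  carrier := {p | ⇑p.2 =ᵐ[volume] fun x => (V x : ℂ) * p.1 x}
  zero_mem' := by
    change ⇑(0 : L1) =ᵐ[volume] fun x => (V x : ℂ) * (0 : L1) x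
    filter_upwards with x
    simp
  add_mem' := by
    rintro p p' h h'
    change ⇑(p.2 + p'.2) =ᵐ[volume] fun x => (V x : ℂ) * (p.1 + p'.1) x
    filter_upwards [h, h', Lp.coeFn_add p.1 p'.1, Lp.coeFn_add p.2 p'.2] with x h₁ h₂ h₃ h₄
    rw [h₃, h₄, Pi.add_apply, Pi.add_apply, h₁, h₂, mul_add]
  smul_mem' := by
    rintro c p h
    change ⇑(c • p.2) =ᵐ[volume] fun x => (V x : ℂ) * (c • p.1) x
    filter_upwards [h, Lp.coeFn_smul c p.1, Lp.coeFn_smul c p.2] with x h₁ h₂ h₃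
    simp only [h₁, h₂, h₃, Pi.smul_apply, smul_eq_mul]
    ring

/-- Multiplication by `V` in `L¹`, with domain `{u ∈ L¹ : V u ∈ L¹}`. -/
def mulL1 (V : Plane → ℝ) : L1 →ₗ.[ℂ] L1 := (mulGraph V).toLinearPMap

theorem mem_mulL1_graph (V : Plane → ℝ) (u w : L1) :
    (u, w) ∈ (mulL1 V).graph ↔ ⇑w =ᵐ[volume] fun x => (V x : ℂ) * u x := by
  rw [mulL1, Submodule.toLinearPMap_graph_eq]
  · rfl
  · rintro ⟨x, y⟩ h hx
    obtain rfl : x = 0 := hx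
    change ⇑y =ᵐ[volume] fun z => (V z : ℂ) * (0 : L1) z at h
    refine (Lp.eq_zero_iff_ae_eq_zero).2 ?_
    filter_upwards [h] with z h₁
    simp [h₁]

/-- The Schrödinger operator `H = -Δ + V` in `L¹(ℝ²)`,
with domain `{u ∈ L¹ : Δ u ∈ L¹ and V u ∈ L¹}`. -/
def schrodinger (V : Plane → ℝ) : L1 →ₗ.[ℂ] L1 := -laplacianL1 + mulL1 V

/-- The operator `1 + H²`. -/
def oneAddSq (V : Plane → ℝ) : L1 →ₗ.[ℂ] L1 := shift 1 (sq (schrodinger V))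

/-- The operator `⟨H⟩ ^ α = (1 + H²) ^ (α / 2)`, where `⟨x⟩ = √(1 + x²)`. -/
def japanesePow (V : Plane → ℝ) (α : ℝ) : L1 →ₗ.[ℂ] L1 := fracPow (oneAddSq V) (α / 2)

/-- The symbol of `(-Δ + 1) ^ (-β)`; since the Fourier transform is normalized with the kernel
`e ^ (-2 π i x ξ)`, this is `(1 + |2 π ξ|²) ^ (-β)`. -/
def besselSymbol (β : ℝ) (ξ : Plane) : ℂ := (((1 + ‖(2 * Real.pi) • ξ‖ ^ 2) ^ (-β) : ℝ) : ℂ)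

theorem besselSymbol_hasTemperateGrowth (β : ℝ) :
    (besselSymbol β).HasTemperateGrowth := by
  have h := (Function.hasTemperateGrowth_one_add_norm_sq_rpow Plane (-β)).comp
    ((2 * Real.pi) • ContinuousLinearMap.id ℝ Plane).hasTemperateGrowth
  exact Complex.ofRealCLM.hasTemperateGrowth.comp h

/-- `u = (-Δ + 1) ^ (-β) f` for `u, f ∈ L¹`, in the sense of Fourier multipliers. -/
def IsBesselPotential (β : ℝ) (f u : L1) : Prop :=
  Lp.toTemperedDistributionCLM ℂ volume 1 u =
    TemperedDistribution.fourierMultiplierCLM ℂ (besselSymbol β)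
      (Lp.toTemperedDistributionCLM ℂ volume 1 f)

end SchrodingerL1

end

noncomputable section

namespace SchrodingerL1

/-! ### Resolvents of unbounded operators -/

section Resolvent

variable {X : Type*} [NormedAddCommGroup X] [NormedSpace ℂ X]

/-! Positivity of `1 + H²`. With `s = √(1 + t)` one has `t + 1 + H² = (H + i s)(H - i s)`, so it
suffices to invert `H ± i s` on `L¹` for all `s ≥ 1` with norm `O(1 / s)`. For large `s` a Neumann
series does it: integrating the heat kernel along a rotated ray of complex times gives a
Gaussian-dominated kernel for `(-Δ ± i s)⁻¹`, and since `V ∈ L^q` with `q > 1`, Hölder in space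
makes `V (-Δ ± i s)⁻¹` of size `O(s ^ (-1 / q'))`. On the remaining range `1 ≤ s ≤ S` there is no
smallness; there an a priori bound `‖u‖ ≤ B ‖(H ± i s) u‖` allows the resolvent to be continued down
from `S` in steps of fixed length (`exists_resolvent_imaginary`).

The a priori bound (`exists_norm_le_of_mem_graph`) comes from self-adjointness, which is an `L²`
fact, carried over to `L¹` by a Combes–Thomas argument. The equation is rewritten through the
convolution `G = (-Δ + l)⁻¹`, `l` large, so that only integral operators occur. It is paired with
`w² (conj v)`, where `w = exp (-ε |x - y|)`. As `V` and the kernel of `G` are real and the kernel is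
even, the imaginary part leaves `|Im ζ| ∫ w² |u|²` against a commutator of size `O(ε)`, which is
absorbed for small `ε`. The resulting weighted `L²` bounds are uniform in the centre `y`;
integrating their square roots over `y` gives `L¹` bounds, because `G` maps `L¹` into `L²` locally
uniformly.

Fractional powers. For a vector `v` with `‖A (A + t)⁻¹ v‖ = O(t ^ (-p - δ))`, Balakrishnan's
integral `∫ t ^ (p - 1) A (A + t)⁻¹ v dt` converges, and `A ^ (-p)` maps it to a positive multiple
of `v`: after the substitution `t = s r` the inner integral is a Frullani integral. This gives both
the injectivity of `A ^ (-p)` and a criterion for membership in `D(A ^ p)` with a norm bound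
(`IsPositiveOperator.exists_fracPow`). The domain of `A` need not be dense.

The estimate. `(1 - Δ) ^ (-β)` is a multiple of `∫ τ ^ (-β) (1 - Δ + τ)⁻¹ dτ`. Applied to `(1 - Δ +
τ)⁻¹ f`, the operator `A (A + t)⁻¹` with `A = 1 + H²` is `O(1 / (1 + τ))` because it is bounded, and
`O((1 + t) ^ (-1 / 2))` because the vector lies in `D(H)` with bounded graph norm. Interpolating
with a parameter `θ` strictly between `α` and `β` keeps the `τ` integral convergent and leaves decay
`t ^ (-θ / 2)`, faster than the `t ^ (-α / 2)` that `A ^ (α / 2)` costs. -/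

theorem mem_shift_graph {c : ℂ} {A : X →ₗ.[ℂ] X} {u x : X} :
    (u, x) ∈ (shift c A).graph ↔ ∃ y, (u, y) ∈ A.graph ∧ c • u + y = x := by
  simp only [LinearPMap.mem_graph_iff]
  constructor
  · rintro ⟨v, hv, hx⟩
    refine ⟨A ⟨v, v.2⟩, ⟨⟨v, v.2⟩, hv, rfl⟩, ?_⟩
    rw [← hx, ← hv]
    rfl
  · rintro ⟨y, ⟨v, hv, hy⟩, hx⟩
    refine ⟨⟨v, v.2⟩, hv, ?_⟩
    rw [← hx, ← hv, ← hy]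
    rfl

theorem mem_add_graph {A B : X →ₗ.[ℂ] X} {u x : X} :
    (u, x) ∈ (A + B).graph ↔
      ∃ y z, (u, y) ∈ A.graph ∧ (u, z) ∈ B.graph ∧ y + z = x := by
  simp only [LinearPMap.mem_graph_iff]
  constructor
  · rintro ⟨v, hv, hx⟩
    exact ⟨A ⟨v, v.2.1⟩, B ⟨v, v.2.2⟩, ⟨_, hv, rfl⟩, ⟨_, hv, rfl⟩, hx⟩
  · rintro ⟨y, z, ⟨⟨v, hvA⟩, hv, hy⟩, ⟨⟨v', hvB⟩, hv', hz⟩, hx⟩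
    obtain rfl : v = u := hv
    obtain rfl : v' = v := hv'
    refine ⟨⟨v', hvA, hvB⟩, rfl, ?_⟩
    rw [← hx, ← hy, ← hz]
    rfl

theorem mem_neg_graph {A : X →ₗ.[ℂ] X} {u x : X} :
    (u, x) ∈ (-A).graph ↔ (u, -x) ∈ A.graph := by
  simp only [LinearPMap.mem_graph_iff]
  constructor
  · rintro ⟨v, hv, hx⟩
    refine ⟨⟨v, v.2⟩, hv, ?_⟩
    rw [← hx]
    exact (neg_neg _).symm
  · rintro ⟨v, hv, hx⟩
    refine ⟨⟨v, v.2⟩, hv, ?_⟩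
    exact neg_eq_iff_eq_neg.2 hx

theorem IsBoundedInverse.unique {A : X →ₗ.[ℂ] X} {R S : X →L[ℂ] X}
    (hR : IsBoundedInverse A R) (hS : IsBoundedInverse A S) : R = S := by
  ext x
  exact (hR _ _).1 ((hS (S x) x).2 rfl)

theorem IsBoundedInverse.boundedInverse_eq {A : X →ₗ.[ℂ] X} {R : X →L[ℂ] X}
    (hR : IsBoundedInverse A R) : boundedInverse A = R := by
  have h : ∃ R, IsBoundedInverse A R := ⟨R, hR⟩
  rw [boundedInverse, dif_pos h]
  exact h.choose_spec.unique hR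

theorem IsBoundedInverse.injective {A : X →ₗ.[ℂ] X} {R : X →L[ℂ] X}
    (hR : IsBoundedInverse A R) : Function.Injective R := by
  refine (injective_iff_map_eq_zero R).2 fun x hx => ?_
  exact A.graph_fst_eq_zero_snd ((hR 0 x).2 hx) rfl

/-- The resolvent identity. -/
theorem IsBoundedInverse.sub_eq {A : X →ₗ.[ℂ] X} {c d : ℂ} {R S : X →L[ℂ] X}
    (hR : IsBoundedInverse (shift c A) R) (hS : IsBoundedInverse (shift d A) S) :
    R - S = (d - c) • (R * S) := by
  ext x
  obtain ⟨y, hy, hx⟩ := mem_shift_graph.1 ((hS (S x) x).2 rfl)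
  have h := (hR _ _).1 (mem_shift_graph.2 ⟨y, hy, rfl⟩)
  have hx' : x = (c • S x + y) + (d - c) • S x := by
    rw [sub_smul]
    nth_rewrite 1 [← hx]
    abel
  change R x - S x = (d - c) • R (S x)
  nth_rewrite 1 [hx']
  rw [map_add, h, map_smul]
  abel

theorem units_inv_apply_apply (U : (X →L[ℂ] X)ˣ) (x : X) :
    ((U⁻¹ : (X →L[ℂ] X)ˣ) : X →L[ℂ] X) ((U : X →L[ℂ] X) x) = x :=
  congrArg (fun T : X →L[ℂ] X => T x) U.inv_mul

theorem units_apply_inv_apply (U : (X →L[ℂ] X)ˣ) (x : X) :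
    (U : X →L[ℂ] X) (((U⁻¹ : (X →L[ℂ] X)ˣ) : X →L[ℂ] X) x) = x :=
  congrArg (fun T : X →L[ℂ] X => T x) U.mul_inv

/-- If `‖K‖ ≤ 1 / 2` then `1 + K` is invertible and its inverse has norm at most `2`. -/
theorem exists_unit_one_add [CompleteSpace X] {K : X →L[ℂ] X} (hK : ‖K‖ ≤ 1 / 2) :
    ∃ U : (X →L[ℂ] X)ˣ, (U : X →L[ℂ] X) = 1 + K ∧ ‖((U⁻¹ : (X →L[ℂ] X)ˣ) : X →L[ℂ] X)‖ ≤ 2 := by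
  have h1 : ‖-K‖ < 1 := by rw [norm_neg]; linarith
  refine ⟨Units.oneSub (-K) h1, by simp, ?_⟩
  set U := Units.oneSub (-K) h1
  refine ContinuousLinearMap.opNorm_le_bound _ (by norm_num) fun x => ?_
  set h := ((U⁻¹ : (X →L[ℂ] X)ˣ) : X →L[ℂ] X) x with hh
  have hx : x = h + K h := by
    have : (U : X →L[ℂ] X) h = x := units_apply_inv_apply U x
    rw [← this]
    simp [U]
  have h2 : ‖K h‖ ≤ 1 / 2 * ‖h‖ :=
    (K.le_opNorm h).trans (mul_le_mul_of_nonneg_right hK (norm_nonneg _))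
  have h3 : ‖h‖ ≤ ‖x‖ + ‖K h‖ := by
    have : h = x - K h := by rw [hx]; simp
    calc ‖h‖ = ‖x - K h‖ := by rw [← this]
      _ ≤ _ := norm_sub_le _ _
  linarith

/-- Points close to a point of the resolvent set are in the resolvent set. -/
theorem IsBoundedInverse.exists_shift_near [CompleteSpace X] {A : X →ₗ.[ℂ] X} {c d : ℂ}
    {R : X →L[ℂ] X} (hR : IsBoundedInverse (shift c A) R) (h : ‖d - c‖ * ‖R‖ ≤ 1 / 2) :
    ∃ S, IsBoundedInverse (shift d A) S := by
  obtain ⟨U, hU, -⟩ := exists_unit_one_add (K := (d - c) • R) (by rwa [norm_smul])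
  refine ⟨((U⁻¹ : (X →L[ℂ] X)ˣ) : X →L[ℂ] X) * R, fun u x => ?_⟩
  -- `(d + A) u = x` is equivalent to `u = R (x - (d - c) u)`, that is, to `(1 + (d - c) R) u = R
  -- x`, which the Neumann series solves.
  have h1 : (u, x) ∈ (shift d A).graph ↔ R (x - (d - c) • u) = u := by
    rw [← hR u]
    simp only [mem_shift_graph]
    refine exists_congr fun y => and_congr_right fun _ => ?_
    rw [eq_sub_iff_add_eq, sub_smul]
    constructor <;> intro h <;> rw [← h] <;> abel
  have h2 : R (x - (d - c) • u) = u ↔ (U : X →L[ℂ] X) u = R x := by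
    rw [hU, map_sub, map_smul]
    change _ ↔ u + (d - c) • R u = R x
    rw [sub_eq_iff_eq_add, eq_comm]
  rw [h1, h2, mul_apply_eq_comp]
  constructor
  · intro h
    rw [← h, units_inv_apply_apply]
  · rintro rfl
    exact units_apply_inv_apply U _

/-- The resolvent of a relatively small perturbation. -/
theorem IsBoundedInverse.add {A B : X →ₗ.[ℂ] X} {z : ℂ} {G K : X →L[ℂ] X}
    (hG : IsBoundedInverse (shift z A) G) (hK : ∀ h, (G h, K h) ∈ B.graph)
    {U : (X →L[ℂ] X)ˣ} (hU : (U : X →L[ℂ] X) = 1 + K) :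
    IsBoundedInverse (shift z (A + B)) (G * ((U⁻¹ : (X →L[ℂ] X)ˣ) : X →L[ℂ] X)) := by
  intro u x
  rw [mem_shift_graph, mul_apply_eq_comp]
  constructor
  · rintro ⟨_, hym, rfl⟩
    obtain ⟨y, m, hy, hm, rfl⟩ := mem_add_graph.1 hym
    have h1 : G (z • u + y) = u := (hG _ _).1 (mem_shift_graph.2 ⟨y, hy, rfl⟩)
    have h2 : K (z • u + y) = m := LinearPMap.mem_graph_snd_inj B (hK _) hm h1
    -- This is `(z + A + B) G = 1 + K`, evaluated at `(z + A) u`.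
    have h3 : z • u + (y + m) = (U : X →L[ℂ] X) (z • u + y) := by
      rw [hU]
      change _ = z • u + y + K (z • u + y)
      rw [h2, add_assoc]
    rw [h3, units_inv_apply_apply]
    exact h1
  · rintro rfl
    set h := ((U⁻¹ : (X →L[ℂ] X)ˣ) : X →L[ℂ] X) x with hh
    obtain ⟨y, hy, hy'⟩ := mem_shift_graph.1 ((hG (G h) h).2 rfl)
    refine ⟨y + K h, mem_add_graph.2 ⟨y, K h, hy, hK h, rfl⟩, ?_⟩
    rw [← add_assoc, hy']
    have : (U : X →L[ℂ] X) h = x := units_apply_inv_apply U x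
    rw [← this, hU]
    rfl

/-- The factorization `t + 1 + A² = (A + c) (A - c)` for `-c² = t + 1`. -/
theorem IsBoundedInverse.shift_one_add_sq {A : X →ₗ.[ℂ] X} {c t : ℂ} {R S : X →L[ℂ] X}
    (hR : IsBoundedInverse (shift c A) R) (hS : IsBoundedInverse (shift (-c) A) S)
    (hc : -(c * c) = t + 1) :
    IsBoundedInverse (shift t (shift 1 (sq A))) (S * R) := by
  intro u x
  rw [mul_apply_eq_comp]
  constructor
  · intro h
    obtain ⟨y, hy, rfl⟩ := mem_shift_graph.1 h
    obtain ⟨w, hw, rfl⟩ := mem_shift_graph.1 hy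
    obtain ⟨v, hv, hw⟩ := (mem_sq_graph _ _ _).1 hw
    have h1 := (hS _ _).1 (mem_shift_graph.2 ⟨v, hv, rfl⟩)
    have h2 : ((-c) • u + v, (-c) • v + w) ∈ A.graph :=
      A.graph.add_mem (A.graph.smul_mem (-c) hv) hw
    have h3 := (hR _ _).1 (mem_shift_graph.2 ⟨_, h2, rfl⟩)
    have h4 : c • (-c • u + v) + (-c • v + w) = t • u + ((1 : ℂ) • u + w) := by
      have : t = -(c * c) - 1 := by rw [hc]; ring
      rw [this]
      module
    rw [← h4, h3, h1]
  · rintro rfl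
    obtain ⟨y, hy, hx⟩ := mem_shift_graph.1 ((hR (R x) x).2 rfl)
    obtain ⟨v, hv, hk⟩ := mem_shift_graph.1 ((hS (S (R x)) (R x)).2 rfl)
    -- The vector `v = A S R x = R x + c S R x` is a sum of two elements of `D(A)`; this puts `S R
    -- x` into the domain of `A²`.
    have h2 : (v, y + c • v) ∈ A.graph := by
      have h := A.graph.add_mem hy (A.graph.smul_mem c hv)
      have e : R x + c • S (R x) = v := by nth_rewrite 1 [← hk]; module
      rwa [Prod.smul_mk, Prod.mk_add_mk, e] at h
    refine mem_shift_graph.2 ⟨_, mem_shift_graph.2 ⟨_, (mem_sq_graph _ _ _).2 ⟨v, hv, h2⟩, rfl⟩, ?_⟩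
    have : t = -(c * c) - 1 := by rw [hc]; ring
    have hv' : v = R x + c • S (R x) := by nth_rewrite 1 [← hk]; module
    nth_rewrite 3 [← hx]
    rw [this, hv']
    module

end Resolvent

end SchrodingerL1

end

noncomputable section

namespace SchrodingerL1

/-! ### Fractional powers -/

section FractionalPowers

open Filter Topology

theorem integrableOn_rpow_mul_one_add_rpow {a b : ℝ} (ha : -1 < a) (hb : b ≤ 0)
    (hab : a + b < -1) :
    IntegrableOn (fun t : ℝ => t ^ a * (1 + t) ^ b) (Ioi 0) := by
  have hmeas : ∀ s : Set ℝ, AEStronglyMeasurable (fun t : ℝ => t ^ a * (1 + t) ^ b)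
      (volume.restrict s) := fun s => by
    exact Measurable.aestronglyMeasurable (by fun_prop)
  rw [← Ioc_union_Ioi_eq_Ioi zero_le_one]
  refine IntegrableOn.union ?_ ?_
  · have h := (intervalIntegral.intervalIntegrable_rpow' (a := 0) (b := 1) ha).1
    refine Integrable.mono' h (hmeas _) ?_
    filter_upwards [ae_restrict_mem measurableSet_Ioc] with t ht
    have h1 : (1 + t) ^ b ≤ 1 := Real.rpow_le_one_of_one_le_of_nonpos (by linarith [ht.1]) hb
    have h2 : 0 ≤ t ^ a := Real.rpow_nonneg ht.1.le _
    have h3 : 0 ≤ (1 + t) ^ b := Real.rpow_nonneg (by linarith [ht.1]) _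
    rw [Real.norm_of_nonneg (by positivity)]
    nlinarith
  · have h := integrableOn_Ioi_rpow_of_lt hab zero_lt_one
    refine Integrable.mono' h (hmeas _) ?_
    filter_upwards [ae_restrict_mem measurableSet_Ioi] with t ht
    have ht0 : 0 < t := zero_lt_one.trans ht
    have h3 : 0 ≤ (1 + t) ^ b := Real.rpow_nonneg (by linarith) _
    rw [Real.norm_of_nonneg (by positivity), Real.rpow_add ht0]
    gcongr ?_ * ?_
    exact Real.rpow_le_rpow_of_nonpos ht0 (by linarith) hb

variable {X : Type*} [NormedAddCommGroup X] [NormedSpace ℂ X]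

/-- The constant in the composition formula for fractional powers. -/
def fracConst (p : ℝ) : ℝ := ∫ r in Ioi (0 : ℝ), r ^ (p - 1) * (Real.log r / (r - 1))

theorem log_div_sub_one_pos {r : ℝ} (hr : 0 < r) (hr1 : r ≠ 1) : 0 < Real.log r / (r - 1) := by
  rcases lt_or_gt_of_ne hr1 with h | h
  · exact div_pos_of_neg_of_neg (Real.log_neg hr h) (by linarith)
  · exact div_pos (Real.log_pos h) (by linarith)

/-- Only the positivity of the constant is used, never its value. At `r = 1` the integrand is `0` by
the convention for division, which affects a null set only. -/
theorem fracConst_pos {p : ℝ}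
    (h : IntegrableOn (fun r : ℝ => r ^ (p - 1) * (Real.log r / (r - 1))) (Ioi 0)) :
    0 < fracConst p := by
  have h0 : ∀ r : ℝ, 0 < r → 0 ≤ r ^ (p - 1) * (Real.log r / (r - 1)) := by
    intro r hr
    rcases eq_or_ne r 1 with rfl | hr1
    · simp
    · exact mul_nonneg (Real.rpow_nonneg hr.le _) (log_div_sub_one_pos hr hr1).le
  rw [fracConst, setIntegral_pos_iff_support_of_nonneg_ae _ h]
  · have hsub : Ioi (1 : ℝ) ⊆
        Function.support (fun r : ℝ => r ^ (p - 1) * (Real.log r / (r - 1))) ∩ Ioi 0 := by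
      intro r hr
      have hr0 : (0 : ℝ) < r := zero_lt_one.trans hr
      exact ⟨(mul_pos (Real.rpow_pos_of_pos hr0 _) (log_div_sub_one_pos hr0 hr.ne')).ne', hr0⟩
    refine lt_of_lt_of_le ?_ (measure_mono hsub)
    simp
  · filter_upwards [ae_restrict_mem measurableSet_Ioi] with r hr using h0 r hr

/-- A family of bounded operators that behaves like `t ↦ (A + t)⁻¹` for a positive `A`. -/
structure IsResolventFamily (R : ℝ → X →L[ℂ] X) (M : ℝ) : Prop where
  sub_eq : ∀ s t, 0 ≤ s → 0 ≤ t → R s - R t = (t - s) • (R s * R t)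
  norm_le : ∀ t, 0 ≤ t → ‖R t‖ ≤ M / (1 + t)

namespace IsResolventFamily

variable {R : ℝ → X →L[ℂ] X} {M : ℝ}

theorem nonneg (hR : IsResolventFamily R M) : 0 ≤ M := by
  have := (norm_nonneg _).trans (hR.norm_le 0 le_rfl)
  simpa using this

theorem norm_le_const (hR : IsResolventFamily R M) {t : ℝ} (ht : 0 ≤ t) : ‖R t‖ ≤ M :=
  (hR.norm_le t ht).trans (div_le_self hR.nonneg (by linarith))

theorem continuousOn (hR : IsResolventFamily R M) : ContinuousOn R (Ioi 0) := by
  have : LipschitzOnWith (Real.toNNReal (M * M)) R (Ioi 0) := by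
    refine LipschitzOnWith.of_dist_le_mul fun s hs t ht => ?_
    have hs : 0 < s := hs
    have ht : 0 < t := ht
    rw [dist_eq_norm, hR.sub_eq s t hs.le ht.le, norm_smul, dist_comm, Real.dist_eq,
      Real.coe_toNNReal _ (mul_nonneg hR.nonneg hR.nonneg), mul_comm, Real.norm_eq_abs]
    gcongr
    exact (norm_mul_le _ _).trans (mul_le_mul (hR.norm_le_const hs.le) (hR.norm_le_const ht.le)
      (norm_nonneg _) hR.nonneg)
  exact this.continuousOn

theorem integrableOn_rpow_smul (hR : IsResolventFamily R M) {p : ℝ} (hp : 0 < p) (hp1 : p < 1) :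
    IntegrableOn (fun t : ℝ => t ^ (-p) • R t) (Ioi 0) := by
  have h := (integrableOn_rpow_mul_one_add_rpow (a := -p) (b := -1) (by linarith) (by norm_num)
    (by linarith)).const_mul M
  refine Integrable.mono' h ?_ ?_
  · refine ContinuousOn.aestronglyMeasurable ?_ measurableSet_Ioi
    exact (continuousOn_id.rpow_const fun t ht => Or.inl (ne_of_gt ht)).smul hR.continuousOn
  · filter_upwards [ae_restrict_mem measurableSet_Ioi] with t ht
    have ht : 0 < t := ht
    rw [norm_smul, Real.norm_of_nonneg (Real.rpow_nonneg ht.le _), Real.rpow_neg_one]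
    have := hR.norm_le t ht.le
    have h2 : 0 ≤ t ^ (-p) := Real.rpow_nonneg ht.le _
    calc t ^ (-p) * ‖R t‖ ≤ t ^ (-p) * (M / (1 + t)) := by gcongr
      _ = _ := by rw [div_eq_mul_inv]; ring

/-- The bounded operator `A (A + t)⁻¹ = 1 - t (A + t)⁻¹` applied to `v`. -/
def defect (R : ℝ → X →L[ℂ] X) (v : X) (t : ℝ) : X := v - t • R t v

/-- The resolvent identity turns the product of `R s` with `1 - t R t` into a difference quotient of
`t ↦ t R t v`. This is the form that a Frullani integral requires. -/
theorem apply_defect (hR : IsResolventFamily R M) (v : X) {s t : ℝ} (hs : 0 ≤ s) (ht : 0 ≤ t)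
    (hst : t ≠ s) : R s (defect R v t) = (t - s)⁻¹ • (t • R t v - s • R s v) := by
  have h := congrArg (fun T : X →L[ℂ] X => T v) (hR.sub_eq s t hs ht)
  change R s v - R t v = (t - s) • R s (R t v) at h
  have h0 : t - s ≠ 0 := sub_ne_zero.2 hst
  rw [eq_inv_smul_iff₀ h0, defect, map_sub, (R s).map_smul_of_tower, smul_sub, smul_comm, ← h]
  module

theorem continuousOn_defect (hR : IsResolventFamily R M) (v : X) :
    ContinuousOn (defect R v) (Ioi 0) :=
  continuousOn_const.sub (continuousOn_id.smul (hR.continuousOn.clm_apply continuousOn_const))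

theorem integrableOn_rpow_smul_defect (hR : IsResolventFamily R M) {p δ C : ℝ} (hp : 0 < p)
    (hδ : 0 < δ) {v : X} (hv : ∀ t, 0 < t → ‖defect R v t‖ ≤ C * (1 + t) ^ (-(p + δ))) :
    IntegrableOn (fun t : ℝ => t ^ (p - 1) • defect R v t) (Ioi 0) := by
  have h := (integrableOn_rpow_mul_one_add_rpow (a := p - 1) (b := -(p + δ)) (by linarith)
    (by linarith) (by linarith)).const_mul C
  refine Integrable.mono' h ?_ ?_
  · refine ContinuousOn.aestronglyMeasurable ?_ measurableSet_Ioi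
    exact (continuousOn_id.rpow_const fun t ht => Or.inl (ne_of_gt ht)).smul
      (hR.continuousOn_defect v)
  · filter_upwards [ae_restrict_mem measurableSet_Ioi] with t ht
    have ht : 0 < t := ht
    rw [norm_smul, Real.norm_of_nonneg (Real.rpow_nonneg ht.le _)]
    have h2 : 0 ≤ t ^ (p - 1) := Real.rpow_nonneg ht.le _
    calc t ^ (p - 1) * ‖defect R v t‖ ≤ t ^ (p - 1) * (C * (1 + t) ^ (-(p + δ))) := by
          gcongr; exact hv t ht
      _ = _ := by ring

/-- By `apply_defect` the integrand is `(φ (r s) - φ (s)) / (s (r - 1))` with `φ t = t R t v`.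
Frullani's formula then needs only the limits of `φ`: it tends to `0` at `0` since `R` is bounded,
and to `v` at infinity by the decay hypothesis. -/
theorem integral_apply_defect_comp_mul [CompleteSpace X] (hR : IsResolventFamily R M) {η C : ℝ}
    (hη : 0 < η) {v : X}
    (hv : ∀ t, 0 < t → ‖defect R v t‖ ≤ C * (1 + t) ^ (-η)) {r : ℝ} (hr : 0 < r)
    (hr1 : r ≠ 1) (h_int : IntegrableOn (fun s => R s (defect R v (s * r))) (Ioi 0)) :
    ∫ s in Ioi (0 : ℝ), R s (defect R v (s * r)) = (Real.log r / (r - 1)) • v := by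
  set φ : ℝ → X := fun t => t • R t v with hφ
  have hcont : ContinuousOn φ (Ioi 0) :=
    continuousOn_id.smul (hR.continuousOn.clm_apply continuousOn_const)
  have hloc : LocallyIntegrableOn φ (Ioi 0) := hcont.locallyIntegrableOn measurableSet_Ioi
  have h0 : Tendsto φ (𝓝[>] 0) (𝓝 0) := by
    refine squeeze_zero_norm' (a := fun t : ℝ => t * (M * ‖v‖)) ?_ ?_
    · filter_upwards [self_mem_nhdsWithin] with t ht
      have ht : 0 < t := ht
      rw [hφ, norm_smul, Real.norm_of_nonneg ht.le]
      gcongr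
      exact ((R t).le_opNorm v).trans (by gcongr; exact hR.norm_le_const ht.le)
    · have : Tendsto (fun t : ℝ => t * (M * ‖v‖)) (𝓝 0) (𝓝 (0 * (M * ‖v‖))) :=
        (continuous_id.mul continuous_const).tendsto 0
      rw [zero_mul] at this
      exact this.mono_left nhdsWithin_le_nhds
  have h1 : Tendsto φ atTop (𝓝 v) := by
    rw [tendsto_iff_norm_sub_tendsto_zero]
    have hlim : Tendsto (fun t : ℝ => C * (1 + t) ^ (-η)) atTop (𝓝 (C * 0)) :=
      ((tendsto_rpow_neg_atTop hη).comp (tendsto_atTop_add_const_left _ 1 tendsto_id)).const_mul C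
    rw [mul_zero] at hlim
    refine squeeze_zero' (Eventually.of_forall fun _ => norm_nonneg _) ?_ hlim
    filter_upwards [eventually_gt_atTop 0] with t ht
    rw [← norm_sub_rev]
    exact hv t ht
  have heq : ∀ s ∈ Ioi (0 : ℝ), R s (defect R v (s * r)) =
      (r - 1)⁻¹ • (s⁻¹ • (φ (r * s) - φ (1 * s))) := by
    intro s hs
    have hs : 0 < s := hs
    rw [hR.apply_defect v hs.le (by positivity)
      (fun h => hr1 (by simpa [hs.ne'] using h)), smul_smul, one_mul, mul_comm s r]
    congr 1
    rw [← mul_inv]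
    congr 1
    ring
  have hr' : r - 1 ≠ 0 := sub_ne_zero.2 hr1
  have h_int' : IntegrableOn (fun s => s⁻¹ • (φ (r * s) - φ (1 * s))) (Ioi 0) := by
    have h : IntegrableOn _ (Ioi (0 : ℝ)) := (h_int.congr_fun heq measurableSet_Ioi).smul (r - 1)
    refine h.congr_fun (fun s _ => ?_) measurableSet_Ioi
    exact smul_inv_smul₀ hr' _
  rw [setIntegral_congr_fun measurableSet_Ioi heq, integral_smul,
    Frullani.integral_Ioi_eq hloc hr one_pos h0 h1 h_int', smul_smul]
  simp only [one_div, Real.log_inv, zero_sub, smul_neg, neg_smul, neg_neg, mul_neg]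
  rw [div_eq_inv_mul]

/-- Justifies Fubini in the composition formula. After rescaling `t = s r`, the integral of the norm
over `r` is at most `‖s ^ (-p) R s‖` times the norm integral of Balakrishnan's integrand, and the
former is integrable in `s`. -/
theorem integrable_prod_defect (hR : IsResolventFamily R M) {p δ C : ℝ} (hp : 0 < p) (hp1 : p < 1)
    (hδ : 0 < δ) {v : X} (hv : ∀ t, 0 < t → ‖defect R v t‖ ≤ C * (1 + t) ^ (-(p + δ))) :
    Integrable (fun z : ℝ × ℝ => z.2 ^ (p - 1) • R z.1 (defect R v (z.1 * z.2)))
      ((volume.restrict (Ioi 0)).prod (volume.restrict (Ioi 0))) := by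
  have hL := hR.integrableOn_rpow_smul_defect hp hδ hv
  have hmeas : AEStronglyMeasurable
      (fun z : ℝ × ℝ => z.2 ^ (p - 1) • R z.1 (defect R v (z.1 * z.2)))
      ((volume.restrict (Ioi 0)).prod (volume.restrict (Ioi 0))) := by
    rw [Measure.prod_restrict]
    refine ContinuousOn.aestronglyMeasurable ?_ (measurableSet_Ioi.prod measurableSet_Ioi)
    have hpow : ContinuousOn (fun z : ℝ × ℝ => z.2 ^ (p - 1)) (Ioi 0 ×ˢ Ioi 0) :=
      continuousOn_snd.rpow_const fun z hz => Or.inl (ne_of_gt (mem_prod.1 hz).2)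
    refine hpow.smul ?_
    · refine ContinuousOn.clm_apply (hR.continuousOn.comp continuousOn_fst fun z hz => hz.1) ?_
      exact (hR.continuousOn_defect v).comp (continuousOn_fst.mul continuousOn_snd)
        fun z hz => mem_Ioi.2 (mul_pos (mem_Ioi.1 hz.1) (mem_Ioi.1 hz.2))
  have hscale : ∀ s : ℝ, 0 < s → ∀ r : ℝ, 0 < r →
      r ^ (p - 1) • R s (defect R v (s * r)) =
        s ^ (1 - p) • R s ((s * r) ^ (p - 1) • defect R v (s * r)) := by
    intro s hs r hr
    rw [(R s).map_smul_of_tower, smul_smul, Real.mul_rpow hs.le hr.le, ← mul_assoc,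
      ← Real.rpow_add hs]
    simp
  rw [integrable_prod_iff hmeas]
  constructor
  · filter_upwards [ae_restrict_mem measurableSet_Ioi] with s hs
    have hs : 0 < s := hs
    have h1 : IntegrableOn (fun r => (s * r) ^ (p - 1) • defect R v (s * r)) (Ioi 0) := by
      have := (integrableOn_Ioi_comp_mul_left_iff
        (fun t => t ^ (p - 1) • defect R v t) 0 hs).2 (by simpa using hL)
      exact this
    have h2 : IntegrableOn
        (fun r => s ^ (1 - p) • R s ((s * r) ^ (p - 1) • defect R v (s * r))) (Ioi 0) :=
      ((R s).integrable_comp h1).smul (s ^ (1 - p))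
    exact h2.congr_fun (fun r hr => (hscale s hs r hr).symm) measurableSet_Ioi
  · set I := ∫ t in Ioi (0 : ℝ), ‖t ^ (p - 1) • defect R v t‖
    have hbd := (hR.integrableOn_rpow_smul hp hp1).norm.mul_const I
    refine Integrable.mono' hbd hmeas.norm.integral_prod_right' ?_
    filter_upwards [ae_restrict_mem measurableSet_Ioi] with s hs
    have hs : 0 < s := hs
    rw [Real.norm_of_nonneg (integral_nonneg fun _ => norm_nonneg _)]
    have h1 : IntegrableOn (fun r => ‖(s * r) ^ (p - 1) • defect R v (s * r)‖) (Ioi 0) := by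
      have := (integrableOn_Ioi_comp_mul_left_iff
        (fun t => ‖t ^ (p - 1) • defect R v t‖) 0 hs).2 (by rw [mul_zero]; exact hL.norm)
      exact this
    calc ∫ r in Ioi (0 : ℝ), ‖r ^ (p - 1) • R s (defect R v (s * r))‖
        ≤ ∫ r in Ioi (0 : ℝ), s ^ (1 - p) * ‖R s‖ *
            ‖(s * r) ^ (p - 1) • defect R v (s * r)‖ := by
          refine integral_mono_of_nonneg (Eventually.of_forall fun _ => norm_nonneg _)
            (h1.const_mul _) ?_
          filter_upwards [ae_restrict_mem measurableSet_Ioi] with r hr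
          rw [hscale s hs r hr, norm_smul, Real.norm_of_nonneg (Real.rpow_nonneg hs.le _),
            mul_assoc]
          gcongr
          exact (R s).le_opNorm _
      _ = s ^ (1 - p) * ‖R s‖ * (s⁻¹ * I) := by
          rw [integral_const_mul]
          have := integral_comp_mul_left_Ioi (fun t => ‖t ^ (p - 1) • defect R v t‖) 0 hs
          rw [mul_zero, smul_eq_mul] at this
          rw [this]
      _ = ‖s ^ (-p) • R s‖ * I := by
          rw [norm_smul, Real.norm_of_nonneg (Real.rpow_nonneg hs.le _)]
          have : s ^ (1 - p) * s⁻¹ = s ^ (-p) := by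
            rw [← Real.rpow_neg_one s, ← Real.rpow_add hs]
            ring_nf
          rw [← this]
          ring

variable [CompleteSpace X]

/-- The composition formula: `A ^ (-p)` is inverted by the Balakrishnan integral. -/
theorem integral_rpow_smul_apply_integral (hR : IsResolventFamily R M) {p δ C : ℝ} (hp : 0 < p)
    (hp1 : p < 1) (hδ : 0 < δ) {v : X} (hv0 : v ≠ 0)
    (hv : ∀ t, 0 < t → ‖defect R v t‖ ≤ C * (1 + t) ^ (-(p + δ))) :
    (∫ s in Ioi (0 : ℝ), s ^ (-p) • R s) (∫ t in Ioi (0 : ℝ), t ^ (p - 1) • defect R v t) =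
      fracConst p • v ∧ 0 < fracConst p := by
  have hL := hR.integrableOn_rpow_smul_defect hp hδ hv
  have hprod := hR.integrable_prod_defect hp hp1 hδ hv
  have hinner : ∀ᵐ r ∂(volume.restrict (Ioi (0 : ℝ))),
      ∫ s in Ioi (0 : ℝ), r ^ (p - 1) • R s (defect R v (s * r)) =
        (r ^ (p - 1) * (Real.log r / (r - 1))) • v := by
    have hne : ∀ᵐ r ∂(volume.restrict (Ioi (0 : ℝ))), r ≠ 1 :=
      ae_restrict_of_ae (Measure.ae_ne volume 1)
    filter_upwards [ae_restrict_mem measurableSet_Ioi, hne, hprod.prod_left_ae] with r hr hr1 hi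
    have hr : 0 < r := hr
    have h_int : IntegrableOn (fun s => R s (defect R v (s * r))) (Ioi 0) := by
      have := hi.smul (r ^ (p - 1))⁻¹
      refine this.congr (Eventually.of_forall fun s => ?_)
      simp only [Pi.smul_apply]
      rw [inv_smul_smul₀ (Real.rpow_pos_of_pos hr _).ne']
    rw [integral_smul, hR.integral_apply_defect_comp_mul (by linarith) hv hr hr1 h_int, smul_smul]
  -- The scalar kernel is integrable because its product with the nonzero vector `v` is a partial
  -- integral of an integrable function; no estimate of the logarithm is needed.
  have h_int : IntegrableOn (fun r : ℝ => r ^ (p - 1) * (Real.log r / (r - 1))) (Ioi 0) := by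
    have h := (hprod.integral_prod_right).congr hinner
    exact (integrable_smul_const hv0).1 h
  refine ⟨?_, fracConst_pos h_int⟩
  rw [ContinuousLinearMap.integral_apply (hR.integrableOn_rpow_smul hp hp1)]
  calc ∫ s in Ioi (0 : ℝ), (s ^ (-p) • R s) (∫ t in Ioi (0 : ℝ), t ^ (p - 1) • defect R v t)
      = ∫ s in Ioi (0 : ℝ), ∫ r in Ioi (0 : ℝ), r ^ (p - 1) • R s (defect R v (s * r)) := by
        refine setIntegral_congr_fun measurableSet_Ioi fun s hs => ?_
        have hs : 0 < s := hs
        -- Substitution `t = s r`: the Jacobian `s`, the factor `s ^ (-p)` and the factor `s ^ (p -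
        -- 1)` cancel.
        have h2 := integral_comp_mul_left_Ioi
          (fun t => s • (s ^ (-p) • R s) (t ^ (p - 1) • defect R v t)) 0 hs
        rw [mul_zero, integral_smul s (fun t => (s ^ (-p) • R s) (t ^ (p - 1) • defect R v t)),
          inv_smul_smul₀ hs.ne'] at h2
        rw [← ContinuousLinearMap.integral_comp_comm _ hL, ← h2]
        refine setIntegral_congr_fun measurableSet_Ioi fun r hr => ?_
        have hr : 0 < r := hr
        change s • s ^ (-p) • R s ((s * r) ^ (p - 1) • defect R v (s * r)) = _
        rw [(R s).map_smul_of_tower, smul_smul, smul_smul, Real.mul_rpow hs.le hr.le]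
        congr 1
        have : s * s ^ (-p) * s ^ (p - 1) = 1 := by
          nth_rewrite 1 [← Real.rpow_one s]
          rw [← Real.rpow_add hs, ← Real.rpow_add hs]
          ring_nf
          simp
        rw [← mul_assoc, this, one_mul]
    _ = ∫ r in Ioi (0 : ℝ), ∫ s in Ioi (0 : ℝ), r ^ (p - 1) • R s (defect R v (s * r)) :=
        integral_integral_swap hprod
    _ = ∫ r in Ioi (0 : ℝ), (r ^ (p - 1) * (Real.log r / (r - 1))) • v := integral_congr_ae hinner
    _ = fracConst p • v := by rw [integral_smul_const, fracConst]

end IsResolventFamily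

variable {A : X →ₗ.[ℂ] X}

theorem IsPositiveOperator.isBoundedInverse (hA : IsPositiveOperator A) {t : ℝ} (ht : 0 ≤ t) :
    IsBoundedInverse (shift (t : ℂ) A) (boundedInverse (shift (t : ℂ) A)) := by
  obtain ⟨M, hM⟩ := hA
  obtain ⟨R, hR, -⟩ := hM t ht
  rwa [hR.boundedInverse_eq]

theorem IsPositiveOperator.isResolventFamily (hA : IsPositiveOperator A) :
    ∃ M, IsResolventFamily (fun t : ℝ => boundedInverse (shift (t : ℂ) A)) M := by
  have hA' := hA
  obtain ⟨M, hM⟩ := hA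
  refine ⟨M, fun s t hs ht => ?_, fun t ht => ?_⟩
  · rw [(hA'.isBoundedInverse hs).sub_eq (hA'.isBoundedInverse ht), ← Complex.ofReal_sub,
      Complex.coe_smul]
  · obtain ⟨R, hR, hR'⟩ := hM t ht
    rwa [hR.boundedInverse_eq]

theorem negPow_eq (A : X →ₗ.[ℂ] X) (p : ℝ) :
    negPow A p = (Real.sin (Real.pi * p) / Real.pi) •
      ∫ t in Ioi (0 : ℝ), t ^ (-p) • boundedInverse (shift (t : ℂ) A) := by
  simp only [negPow, Complex.coe_smul]

theorem sin_pi_mul_div_pi_pos {p : ℝ} (hp : 0 < p) (hp1 : p < 1) :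
    0 < Real.sin (Real.pi * p) / Real.pi := by
  refine div_pos (Real.sin_pos_of_pos_of_lt_pi (by positivity) ?_) Real.pi_pos
  nlinarith [Real.pi_pos]

variable [CompleteSpace X]

/-- If `A ^ (-p) u = 0`, take `v = A⁻¹ u`. Then `A (A + t)⁻¹ v = (A + t)⁻¹ u` decays like `1 / (1 +
t)`, so the composition formula applies with `δ = 1 - p`. Since resolvents commute, `A ^ (-p)` can
be moved onto `u` under the integral, so a positive multiple of `v` is zero and hence `u = 0`. -/
theorem IsPositiveOperator.negPow_injective (hA : IsPositiveOperator A) {p : ℝ} (hp : 0 < p)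
    (hp1 : p < 1) : Function.Injective (negPow A p) := by
  obtain ⟨M, hR⟩ := hA.isResolventFamily
  set R : ℝ → X →L[ℂ] X := fun t : ℝ => boundedInverse (shift (t : ℂ) A) with hRdef
  refine (injective_iff_map_eq_zero _).2 fun u hu => ?_
  by_contra hu0
  have hinj : Function.Injective (R 0) := (hA.isBoundedInverse le_rfl).injective
  have hv0 : R 0 u ≠ 0 := fun h => hu0 (hinj (h.trans (map_zero _).symm))
  have hB : (∫ t in Ioi (0 : ℝ), t ^ (-p) • R t) u = 0 := by
    rw [negPow_eq] at hu
    have hu' : (Real.sin (Real.pi * p) / Real.pi) •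
      (∫ t in Ioi (0 : ℝ), t ^ (-p) • R t) u = 0 := hu
    exact (smul_eq_zero.1 hu').resolve_left (sin_pi_mul_div_pi_pos hp hp1).ne'
  have hdef : ∀ t, 0 < t → IsResolventFamily.defect R (R 0 u) t = R t u := by
    intro t ht
    have h := congrArg (fun T : X →L[ℂ] X => T u) (hR.sub_eq t 0 ht.le le_rfl)
    change R t u - R 0 u = (0 - t) • R t (R 0 u) at h
    rw [IsResolventFamily.defect, sub_eq_iff_eq_add, ← sub_eq_iff_eq_add', ← neg_sub, h]
    module
  have hbound : ∀ t, 0 < t →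
      ‖IsResolventFamily.defect R (R 0 u) t‖ ≤ (M * ‖u‖) * (1 + t) ^ (-(p + (1 - p))) := by
    intro t ht
    rw [hdef t ht]
    have : (1 + t) ^ (-(p + (1 - p))) = (1 + t)⁻¹ := by
      rw [← Real.rpow_neg_one]
      ring_nf
    rw [this]
    calc ‖R t u‖ ≤ M / (1 + t) * ‖u‖ := ((R t).le_opNorm u).trans (by
          gcongr; exact hR.norm_le t ht.le)
      _ = _ := by ring
  obtain ⟨h1, h2⟩ := hR.integral_rpow_smul_apply_integral hp hp1 (sub_pos.2 hp1) hv0 hbound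
  have hcomm : ∀ s t, 0 < s → 0 < t → R s (R t u) = R t (R s u) := by
    intro s t hs ht
    rcases eq_or_ne s t with rfl | hst
    · rfl
    have e1 := congrArg (fun T : X →L[ℂ] X => T u) (hR.sub_eq s t hs.le ht.le)
    have e2 := congrArg (fun T : X →L[ℂ] X => T u) (hR.sub_eq t s ht.le hs.le)
    change R s u - R t u = (t - s) • R s (R t u) at e1
    change R t u - R s u = (s - t) • R t (R s u) at e2
    have e3 : (t - s) • R s (R t u) = (t - s) • R t (R s u) := by
      rw [← e1, ← neg_sub (R t u), e2]
      module
    exact (smul_right_injective X (sub_ne_zero.2 hst.symm)) e3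
  have hzero : (∫ s in Ioi (0 : ℝ), s ^ (-p) • R s)
      (∫ t in Ioi (0 : ℝ), t ^ (p - 1) • IsResolventFamily.defect R (R 0 u) t) = 0 := by
    have h_int := hR.integrableOn_rpow_smul hp hp1
    rw [← ContinuousLinearMap.integral_comp_comm _
      (hR.integrableOn_rpow_smul_defect hp (sub_pos.2 hp1) hbound)]
    refine setIntegral_eq_zero_of_forall_eq_zero fun t ht => ?_
    have ht : 0 < t := ht
    rw [hdef t ht, ContinuousLinearMap.map_smul_of_tower]
    have : (∫ s in Ioi (0 : ℝ), s ^ (-p) • R s) (R t u) =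
        R t ((∫ s in Ioi (0 : ℝ), s ^ (-p) • R s) u) := by
      rw [ContinuousLinearMap.integral_apply h_int, ContinuousLinearMap.integral_apply h_int,
        ← ContinuousLinearMap.integral_comp_comm]
      · refine setIntegral_congr_fun measurableSet_Ioi fun s hs => ?_
        change s ^ (-p) • R s (R t u) = R t (s ^ (-p) • R s u)
        rw [(R t).map_smul_of_tower, hcomm s t hs ht]
      · exact (ContinuousLinearMap.apply ℂ X u).integrable_comp h_int
    rw [this, hB, map_zero, smul_zero]
  rw [hzero] at h1
  exact (smul_ne_zero h2.ne' hv0) h1.symm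

/-- A vector `v` for which `A (A + t)⁻¹ v` decays faster than `t ^ (-p)` is in the domain
of `A ^ p`. -/
theorem IsPositiveOperator.exists_fracPow (hA : IsPositiveOperator A) {p δ : ℝ} (hp : 0 < p)
    (hp1 : p < 1) (hδ : 0 < δ) : ∃ K : ℝ, ∀ (C : ℝ) (v : X), 0 ≤ C →
      (∀ t : ℝ, 0 < t → ‖v - t • boundedInverse (shift (t : ℂ) A) v‖ ≤ C * (1 + t) ^ (-(p + δ))) →
      ∃ u : (fracPow A p).domain, (u : X) = v ∧ ‖fracPow A p u‖ ≤ K * C := by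
  obtain ⟨M, hR⟩ := hA.isResolventFamily
  set R : ℝ → X →L[ℂ] X := fun t : ℝ => boundedInverse (shift (t : ℂ) A) with hRdef
  have hinj := hA.negPow_injective hp hp1
  set σ := Real.sin (Real.pi * p) / Real.pi with hσ
  have hσ0 : 0 < σ := sin_pi_mul_div_pi_pos hp hp1
  set I := ∫ t in Ioi (0 : ℝ), t ^ (p - 1) * (1 + t) ^ (-(p + δ)) with hI
  have hI0 : 0 ≤ I := setIntegral_nonneg measurableSet_Ioi fun t ht => by
    have ht : 0 < t := ht
    positivity
  refine ⟨|(σ * fracConst p)⁻¹| * I, fun C v hC hv => ?_⟩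
  have hex : ∃ g, negPow A p g = v ∧ ‖g‖ ≤ |(σ * fracConst p)⁻¹| * I * C := by
    by_cases hv0 : v = 0
    · exact ⟨0, by rw [map_zero, hv0], by rw [norm_zero]; positivity⟩
    obtain ⟨h1, h2⟩ := hR.integral_rpow_smul_apply_integral hp hp1 hδ hv0 hv
    -- The candidate for `A ^ p v` is Balakrishnan's integral, normalized by the two constants of
    -- the composition formula.
    refine ⟨(σ * fracConst p)⁻¹ • ∫ t in Ioi (0 : ℝ),
      t ^ (p - 1) • IsResolventFamily.defect R v t, ?_, ?_⟩
    · rw [ContinuousLinearMap.map_smul_of_tower, negPow_eq]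
      change (σ * fracConst p)⁻¹ • σ • (∫ s in Ioi (0 : ℝ), s ^ (-p) • R s)
        (∫ t in Ioi (0 : ℝ), t ^ (p - 1) • IsResolventFamily.defect R v t) = v
      rw [h1, smul_smul, smul_smul, inv_mul_eq_div, div_mul_eq_mul_div,
        div_self (mul_pos hσ0 h2).ne', one_smul]
    · rw [norm_smul, Real.norm_eq_abs, mul_assoc]
      gcongr
      calc ‖∫ t in Ioi (0 : ℝ), t ^ (p - 1) • IsResolventFamily.defect R v t‖
          ≤ ∫ t in Ioi (0 : ℝ), C * (t ^ (p - 1) * (1 + t) ^ (-(p + δ))) := by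
            refine norm_integral_le_of_norm_le
              ((integrableOn_rpow_mul_one_add_rpow (by linarith) (by linarith)
                (by linarith)).const_mul C) ?_
            filter_upwards [ae_restrict_mem measurableSet_Ioi] with t ht
            have ht : 0 < t := ht
            rw [norm_smul, Real.norm_of_nonneg (Real.rpow_nonneg ht.le _)]
            have h3 : 0 ≤ t ^ (p - 1) := Real.rpow_nonneg ht.le _
            calc _ ≤ t ^ (p - 1) * (C * (1 + t) ^ (-(p + δ))) := by gcongr; exact hv t ht
              _ = _ := by ring
        _ = I * C := by rw [integral_const_mul, mul_comm]
  obtain ⟨g, hg, hgn⟩ := hex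
  have hker : LinearMap.ker ((negPow A p : X →ₗ[ℂ] X).toPMap ⊤).toFun = ⊥ := by
    rw [LinearMap.ker_eq_bot]
    rintro ⟨x, hx⟩ ⟨y, hy⟩ hxy
    exact Subtype.ext (hinj hxy)
  have hmem : (v, g) ∈ (fracPow A p).graph := by
    have h := LinearPMap.mem_inverse_graph hker ⟨g, trivial⟩
    rw [← hg]
    exact h
  obtain ⟨u, hu, hug⟩ := (LinearPMap.mem_graph_iff _).1 hmem
  exact ⟨u, hu, by rw [hug]; exact hgn⟩

end FractionalPowers

end SchrodingerL1

end

noncomputable section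

namespace SchrodingerL1

/-! ### The Fourier transform on `L¹` -/

section Fourier

open FourierTransform

/-- The value at `ξ` of the Fourier transform of an integrable function. -/
def fourierAt (ξ : Plane) : L1 →L[ℂ] ℂ :=
  (BoundedContinuousFunction.evalCLM ℂ ξ).comp (Real.Lp.fourierTransformCLM Plane ℂ)

theorem fourierAt_apply (ξ : Plane) (u : L1) : fourierAt ξ u = 𝓕 (u : Plane → ℂ) ξ := rfl

theorem fourierAt_toLp (ξ : Plane) {f : Plane → ℂ} (hf : MemLp f 1) :
    fourierAt ξ hf.toLp = 𝓕 f ξ :=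
  Real.fourier_congr_ae hf.coeFn_toLp ξ

theorem continuous_fourierAt (u : L1) : Continuous fun ξ => fourierAt ξ u :=
  (Real.Lp.fourierTransformCLM Plane ℂ u).continuous

theorem integral_fourier_mul_eq (ψ : 𝓢(Plane, ℂ)) (u : L1) :
    ∫ x, (𝓕 ψ) x • u x = ∫ ξ, ψ ξ • fourierAt ξ u := by
  have := VectorFourier.integral_fourierIntegral_smul_eq_flip (L := innerₗ Plane)
    Real.continuous_fourierChar continuous_inner (ψ.integrable (μ := volume))
    (L1.integrable_coeFn u)
  simpa using! this

/-- Fourier multipliers on `L¹` through the pointwise Fourier transform. -/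
theorem toTemperedDistribution_eq_fourierMultiplier_iff {g : Plane → ℂ}
    (hg : g.HasTemperateGrowth) (u w : L1) :
    Lp.toTemperedDistributionCLM ℂ volume 1 w =
      TemperedDistribution.fourierMultiplierCLM ℂ g (Lp.toTemperedDistributionCLM ℂ volume 1 u) ↔
    ∀ ξ, fourierAt ξ w = g ξ * fourierAt ξ u := by
  have hcont : Continuous g := hg.1.continuous
  have key : ∀ ψ : 𝓢(Plane, ℂ),
      Lp.toTemperedDistributionCLM ℂ volume 1 w (𝓕 ψ) = ∫ ξ, ψ ξ • fourierAt ξ w := fun ψ => by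
    rw [Lp.toTemperedDistributionCLM_apply, Lp.toTemperedDistribution_apply,
      integral_fourier_mul_eq]
  have key' : ∀ ψ : 𝓢(Plane, ℂ),
      TemperedDistribution.fourierMultiplierCLM ℂ g
        (Lp.toTemperedDistributionCLM ℂ volume 1 u) (𝓕 ψ) =
        ∫ ξ, ψ ξ • (g ξ * fourierAt ξ u) := fun ψ => by
    rw [TemperedDistribution.fourierMultiplierCLM_apply_apply, FourierTransform.fourierInv_fourier_eq,
      Lp.toTemperedDistributionCLM_apply, Lp.toTemperedDistribution_apply,
      integral_fourier_mul_eq]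
    refine integral_congr_ae (Filter.Eventually.of_forall fun ξ => ?_)
    simp only [SchwartzMap.smulLeftCLM_apply_apply hg, smul_eq_mul]
    ring
  constructor
  · intro h
    have hc : Continuous fun ξ => g ξ * fourierAt ξ u := hcont.mul (continuous_fourierAt u)
    have hae : ∀ᵐ ξ, fourierAt ξ w = g ξ * fourierAt ξ u := by
      refine ae_eq_of_integral_contDiff_smul_eq (continuous_fourierAt w).locallyIntegrable
        hc.locallyIntegrable fun φ hφ hφs => ?_
      have hφ₁ : HasCompactSupport (Complex.ofRealCLM ∘ φ) := hφs.comp_left rfl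
      have hφ₂ : ContDiff ℝ ((⊤ : ℕ∞) : WithTop ℕ∞) (Complex.ofRealCLM ∘ φ) := Complex.ofRealCLM.contDiff.comp hφ
      have h1 := key (hφ₁.toSchwartzMap hφ₂)
      rw [h, key'] at h1
      simpa using h1.symm
    -- Both sides are continuous in `ξ`, so equality almost everywhere becomes equality at every
    -- point.
    have := (Continuous.ae_eq_iff_eq volume (continuous_fourierAt w) hc).1 hae
    exact fun ξ => congrFun this ξ
  · intro h
    ext φ
    obtain ⟨ψ, rfl⟩ : ∃ ψ : 𝓢(Plane, ℂ), 𝓕 ψ = φ :=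
      ⟨𝓕⁻ φ, FourierTransform.fourier_fourierInv_eq φ⟩
    rw [key, key']
    simp only [h]

/-- The case of the constant symbol `1`, combined with the injectivity of the embedding of `L¹` into
tempered distributions. -/
theorem fourierAt_injective {u w : L1} (h : ∀ ξ, fourierAt ξ u = fourierAt ξ w) : u = w := by
  have h1 := (toTemperedDistribution_eq_fourierMultiplier_iff
    (Function.HasTemperateGrowth.const (1 : ℂ)) w u).2 (fun ξ => by rw [h, one_mul])
  rw [TemperedDistribution.fourierMultiplierCLM_const, one_smul] at h1
  have hk := Lp.ker_toTemperedDistributionCLM_eq_bot (F := ℂ) (E := Plane)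
    (μ := volume) (p := 1)
  exact LinearMap.ker_eq_bot.1 hk h1

/-- The symbol `|2 π ξ|²` of `-Δ`. -/
def laplaceSymbol (ξ : Plane) : ℝ := (2 * Real.pi) ^ 2 * ‖ξ‖ ^ 2

theorem laplaceSymbol_nonneg (ξ : Plane) : 0 ≤ laplaceSymbol ξ := by
  unfold laplaceSymbol
  positivity

theorem mem_laplacianL1_graph_iff_fourierAt (u w : L1) :
    (u, w) ∈ laplacianL1.graph ↔ ∀ ξ, fourierAt ξ w = -laplaceSymbol ξ * fourierAt ξ u := by
  have hg : (fun x : Plane => Complex.ofReal (‖x‖ ^ 2)).HasTemperateGrowth := by fun_prop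
  have hg' : ((-(2 * Real.pi) ^ 2 : ℂ) •
      fun x : Plane => Complex.ofReal (‖x‖ ^ 2)).HasTemperateGrowth :=
    (Function.HasTemperateGrowth.const (-(2 * Real.pi) ^ 2 : ℂ)).mul hg
  rw [mem_laplacianL1_graph, TemperedDistribution.laplacian_eq_fourierMultiplierCLM, eq_comm]
  have : (-(2 * Real.pi) ^ 2 : ℝ) • TemperedDistribution.fourierMultiplierCLM ℂ
      (fun x : Plane => Complex.ofReal (‖x‖ ^ 2)) (Lp.toTemperedDistributionCLM ℂ volume 1 u) =
      TemperedDistribution.fourierMultiplierCLM ℂ ((-(2 * Real.pi) ^ 2 : ℂ) •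
        fun x : Plane => Complex.ofReal (‖x‖ ^ 2)) (Lp.toTemperedDistributionCLM ℂ volume 1 u) := by
    rw [TemperedDistribution.fourierMultiplierCLM_smul hg, ← Complex.coe_smul]
    push_cast
    rfl
  rw [this, toTemperedDistribution_eq_fourierMultiplier_iff hg']
  refine forall_congr' fun ξ => ?_
  simp [laplaceSymbol, mul_assoc]

theorem besselSymbol_eq (β : ℝ) (ξ : Plane) :
    besselSymbol β ξ = (((1 + laplaceSymbol ξ) ^ (-β) : ℝ) : ℂ) := by
  rw [besselSymbol, laplaceSymbol, norm_smul, Real.norm_of_nonneg (by positivity), mul_pow]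

theorem isBesselPotential_iff_fourierAt (β : ℝ) (f u : L1) :
    IsBesselPotential β f u ↔
      ∀ ξ, fourierAt ξ u = (((1 + laplaceSymbol ξ) ^ (-β) : ℝ) : ℂ) * fourierAt ξ f := by
  rw [IsBesselPotential,
    toTemperedDistribution_eq_fourierMultiplier_iff (besselSymbol_hasTemperateGrowth β)]
  simp only [besselSymbol_eq]

/-- An operator with symbol `(z + |2 π ξ|²)⁻¹` is the resolvent of the Laplacian. -/
theorem isBoundedInverse_laplacianL1 {z : ℂ} {G : L1 →L[ℂ] L1}
    (hz : ∀ ξ, z + laplaceSymbol ξ ≠ 0)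
    (hG : ∀ f ξ, fourierAt ξ (G f) = (z + laplaceSymbol ξ)⁻¹ * fourierAt ξ f) :
    IsBoundedInverse (shift z (-laplacianL1)) G := by
  intro u x
  have h1 : (u, x) ∈ (shift z (-laplacianL1)).graph ↔
      ∀ ξ, fourierAt ξ x = (z + laplaceSymbol ξ) * fourierAt ξ u := by
    rw [mem_shift_graph]
    constructor
    · rintro ⟨y, hy, rfl⟩ ξ
      have := (mem_laplacianL1_graph_iff_fourierAt _ _).1 (mem_neg_graph.1 hy) ξ
      rw [map_neg] at this
      rw [map_add, map_smul, smul_eq_mul, ← neg_neg (fourierAt ξ y), this]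
      ring
    · intro h
      refine ⟨x - z • u, mem_neg_graph.2 ((mem_laplacianL1_graph_iff_fourierAt _ _).2 fun ξ => ?_),
        by abel⟩
      rw [map_neg, map_sub, map_smul, h, smul_eq_mul]
      ring
  rw [h1]
  constructor
  · intro h
    refine fourierAt_injective fun ξ => ?_
    rw [hG, h, inv_mul_cancel_left₀ (hz ξ)]
  · rintro rfl ξ
    rw [hG, mul_inv_cancel_left₀ (hz ξ)]

end Fourier

end SchrodingerL1

end

noncomputable section

namespace SchrodingerL1

/-! ### Convolution and multiplication operators on `L¹` -/

section Convolution

open FourierTransform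
open scoped Convolution

theorem enorm_L1_eq (f : L1) : ‖f‖ₑ = ∫⁻ x, ‖f x‖ₑ := by
  rw [Lp.enorm_def, eLpNorm_one_eq_lintegral_enorm]

theorem complex_enorm_ofReal (x : ℝ) : ‖(x : ℂ)‖ₑ = ‖x‖ₑ := by
  rw [← ofReal_norm, Complex.norm_real, ofReal_norm]

theorem measurable_L1 (f : L1) : Measurable (f : Plane → ℂ) :=
  (Lp.stronglyMeasurable f).measurable

theorem norm_le_mul_norm_of_enorm {C : ℝ} (hC : 0 ≤ C) {f g : L1}
    (h : ‖f‖ₑ ≤ ENNReal.ofReal C * ‖g‖ₑ) : ‖f‖ ≤ C * ‖g‖ := by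
  rw [← ofReal_norm, ← ofReal_norm, ← ENNReal.ofReal_mul hC] at h
  exact (ENNReal.ofReal_le_ofReal_iff (by positivity)).1 h

theorem memLp_convolution {k : Plane → ℂ} (hk : Integrable k) (f : L1) :
    MemLp ((f : Plane → ℂ) ⋆[ContinuousLinearMap.mul ℂ ℂ] k) 1 :=
  memLp_one_iff_integrable.2 ((L1.integrable_coeFn f).integrable_convolution _ hk)

/-- Weighted bound for convolutions with nonnegative functions. -/
theorem lintegral_mul_lintegral_sub_le {W k F : Plane → ℝ≥0∞} (hW : Measurable W)
    (hk : Measurable k) (hF : Measurable F) {c : ℝ≥0∞}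
    (h : ∀ y, ∫⁻ x, W x * k (x - y) ≤ c) :
    ∫⁻ x, W x * ∫⁻ y, k (x - y) * F y ≤ c * ∫⁻ y, F y := by
  calc ∫⁻ x, W x * ∫⁻ y, k (x - y) * F y = ∫⁻ x, ∫⁻ y, W x * (k (x - y) * F y) := by
        refine lintegral_congr fun x => ?_
        rw [lintegral_const_mul _ (by fun_prop)]
    _ = ∫⁻ y, ∫⁻ x, W x * (k (x - y) * F y) := by
        refine lintegral_lintegral_swap (Measurable.aemeasurable ?_)
        simp only [Function.uncurry_def]
        fun_prop
    _ = ∫⁻ y, (∫⁻ x, W x * k (x - y)) * F y := by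
        refine lintegral_congr fun y => ?_
        rw [← lintegral_mul_const _ (by fun_prop)]
        exact lintegral_congr fun x => by ring
    _ ≤ ∫⁻ y, c * F y := by gcongr with y; exact h y
    _ = c * ∫⁻ y, F y := lintegral_const_mul _ hF

theorem enorm_convolution_le (f : L1) (k : Plane → ℂ) (x : Plane) :
    ‖((f : Plane → ℂ) ⋆[ContinuousLinearMap.mul ℂ ℂ] k) x‖ₑ ≤ ∫⁻ y, ‖k (x - y)‖ₑ * ‖f y‖ₑ := by
  refine (enorm_integral_le_lintegral_enorm _).trans_eq (lintegral_congr fun y => ?_)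
  rw [ContinuousLinearMap.mul_apply', enorm_mul, mul_comm]

theorem lintegral_enorm_convolution_le {k : Plane → ℂ} (hk : Measurable k) (f : L1) :
    ∫⁻ x, ‖((f : Plane → ℂ) ⋆[ContinuousLinearMap.mul ℂ ℂ] k) x‖ₑ ≤
      (∫⁻ x, ‖k x‖ₑ) * ∫⁻ y, ‖f y‖ₑ := by
  have h := lintegral_mul_lintegral_sub_le (W := fun _ => 1) (k := fun x => ‖k x‖ₑ)
    (F := fun y => ‖f y‖ₑ) (c := ∫⁻ x, ‖k x‖ₑ) measurable_const hk.enorm (measurable_L1 f).enorm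
    (fun y => by simp [lintegral_sub_right_eq_self (fun x => ‖k x‖ₑ) y])
  simp only [one_mul] at h
  exact (lintegral_mono fun x => enorm_convolution_le f k x).trans h

/-- Convolution with an integrable kernel as a bounded operator on `L¹`. -/
def convL1 (k : Plane → ℂ) (hk : Integrable k) (hkm : Measurable k) : L1 →L[ℂ] L1 :=
  LinearMap.mkContinuous
    { toFun := fun f => (memLp_convolution hk f).toLp
      -- Linearity is checked on the Fourier side, where convolution is a pointwise product.
      map_add' := fun f g => fourierAt_injective fun ξ => by
        simp only [map_add, fourierAt_toLp,
          Real.fourier_mul_convolution_eq (L1.integrable_coeFn _) hk, ← fourierAt_apply]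
        ring
      map_smul' := fun c f => fourierAt_injective fun ξ => by
        simp only [map_smul, fourierAt_toLp,
          Real.fourier_mul_convolution_eq (L1.integrable_coeFn _) hk, ← fourierAt_apply,
          smul_eq_mul, RingHom.id_apply]
        ring }
    (∫⁻ x, ‖k x‖ₑ).toReal fun f => by
      refine norm_le_mul_norm_of_enorm ENNReal.toReal_nonneg ?_
      rw [ENNReal.ofReal_toReal hk.2.ne, enorm_L1_eq, enorm_L1_eq]
      refine le_trans (le_of_eq ?_) (lintegral_enorm_convolution_le hkm f)
      refine lintegral_congr_ae ?_
      filter_upwards [(memLp_convolution hk f).coeFn_toLp] with x hx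
      exact congrArg enorm hx

variable {k : Plane → ℂ} (hk : Integrable k) (hkm : Measurable k)

theorem convL1_ae (f : L1) : ∀ᵐ x, convL1 k hk hkm f x = ∫ y, k (x - y) * f y := by
  filter_upwards [(memLp_convolution hk f).coeFn_toLp] with x hx
  refine hx.trans ?_
  rw [convolution_mul]
  exact integral_congr_ae (Filter.Eventually.of_forall fun y => mul_comm _ _)

theorem convL1_enorm_ae_le (f : L1) :
    ∀ᵐ x, ‖convL1 k hk hkm f x‖ₑ ≤ ∫⁻ y, ‖k (x - y)‖ₑ * ‖f y‖ₑ := by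
  filter_upwards [(memLp_convolution hk f).coeFn_toLp] with x hx
  exact (congrArg enorm hx).le.trans (enorm_convolution_le f k x)

theorem fourierAt_convL1 (f : L1) (ξ : Plane) :
    fourierAt ξ (convL1 k hk hkm f) = 𝓕 k ξ * fourierAt ξ f := by
  change fourierAt ξ (memLp_convolution hk f).toLp = _
  rw [fourierAt_toLp, Real.fourier_mul_convolution_eq (L1.integrable_coeFn _) hk, mul_comm,
    fourierAt_apply]

theorem norm_convL1_le {C : ℝ} (hC : 0 ≤ C) (h : ∫⁻ x, ‖k x‖ₑ ≤ ENNReal.ofReal C) :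
    ‖convL1 k hk hkm‖ ≤ C :=
  (LinearMap.mkContinuous_norm_le _ ENNReal.toReal_nonneg _).trans
    (ENNReal.toReal_le_of_le_ofReal hC h)

/-- If `V T` is bounded on `L¹` then it is given by a bounded operator. -/
theorem exists_mul_comp {V : Plane → ℝ} (hV : Measurable V) (T : L1 →L[ℂ] L1) {κ : ℝ} (hκ : 0 ≤ κ)
    (hT : ∀ f : L1, ∫⁻ x, ‖V x‖ₑ * ‖T f x‖ₑ ≤ ENNReal.ofReal κ * ‖f‖ₑ) :
    ∃ K : L1 →L[ℂ] L1, (∀ f, (T f, K f) ∈ (mulL1 V).graph) ∧ ‖K‖ ≤ κ := by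
  have hmem : ∀ f, MemLp (fun x => (V x : ℂ) * T f x) 1 := fun f => by
    refine ⟨((Complex.measurable_ofReal.comp hV).mul (measurable_L1 _)).aestronglyMeasurable, ?_⟩
    rw [eLpNorm_one_eq_lintegral_enorm]
    refine lt_of_le_of_lt (le_trans (le_of_eq (lintegral_congr fun x => ?_)) (hT f))
      (ENNReal.mul_lt_top ENNReal.ofReal_lt_top (enorm_lt_top (x := f)))
    rw [enorm_mul, complex_enorm_ofReal]
  have hgraph : ∀ f, (T f, (hmem f).toLp) ∈ (mulL1 V).graph := fun f =>
    (mem_mulL1_graph _ _ _).2 (hmem f).coeFn_toLp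
  let L : L1 →ₗ[ℂ] L1 :=
    { toFun := fun f => (hmem f).toLp
      map_add' := fun f g => by
        -- Additivity follows from the single-valuedness of the graph of multiplication by `V`.
        refine LinearPMap.mem_graph_snd_inj (mulL1 V) (hgraph (f + g))
          ((mulL1 V).graph.add_mem (hgraph f) (hgraph g)) ?_
        simp
      map_smul' := fun c f => by
        refine LinearPMap.mem_graph_snd_inj (mulL1 V) (hgraph (c • f))
          ((mulL1 V).graph.smul_mem c (hgraph f)) ?_
        simp }
  refine ⟨L.mkContinuous κ fun f => norm_le_mul_norm_of_enorm hκ ?_, hgraph,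
    LinearMap.mkContinuous_norm_le _ hκ _⟩
  refine le_trans (le_of_eq ?_) (hT f)
  rw [enorm_L1_eq]
  refine lintegral_congr_ae ?_
  filter_upwards [(hmem f).coeFn_toLp] with x hx
  refine (congrArg enorm hx).trans ?_
  rw [enorm_mul, complex_enorm_ofReal]

/-- Bound for `V` times a convolution operator. -/
theorem lintegral_mul_convL1_le {V : Plane → ℝ} (hV : Measurable V) {κ : ℝ≥0∞}
    (h : ∀ y, ∫⁻ x, ‖V x‖ₑ * ‖k (x - y)‖ₑ ≤ κ) (f : L1) :
    ∫⁻ x, ‖V x‖ₑ * ‖convL1 k hk hkm f x‖ₑ ≤ κ * ‖f‖ₑ := by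
  rw [enorm_L1_eq]
  refine le_trans (lintegral_mono_ae ?_) (lintegral_mul_lintegral_sub_le (W := fun x => ‖V x‖ₑ)
    (k := fun x => ‖k x‖ₑ) (F := fun x => ‖f x‖ₑ) hV.enorm hkm.enorm (measurable_L1 f).enorm h)
  filter_upwards [convL1_enorm_ae_le hk hkm f] with x hx
  gcongr

end Convolution

end SchrodingerL1

end

noncomputable section

namespace SchrodingerL1

/-! ### Resolvent kernels of the Laplacian -/

section Kernel

open FourierTransform

theorem sq_lintegral_mul_le {α : Type*} [MeasurableSpace α] {μ : Measure α} {f g : α → ℝ≥0∞}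
    (hf : AEMeasurable f μ) (hg : AEMeasurable g μ) :
    (∫⁻ x, f x * g x ∂μ) ^ 2 ≤ (∫⁻ x, f x ^ 2 ∂μ) * ∫⁻ x, g x ^ 2 ∂μ := by
  have h := ENNReal.lintegral_mul_le_Lp_mul_Lq μ Real.HolderConjugate.two_two hf hg
  simp only [Pi.mul_apply, ENNReal.rpow_two] at h
  have h2 : ∀ a : ℝ≥0∞, (a ^ (1 / 2 : ℝ)) ^ 2 = a := fun a => by
    rw [← ENNReal.rpow_two, ← ENNReal.rpow_mul]
    norm_num
  calc (∫⁻ x, f x * g x ∂μ) ^ 2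
      ≤ ((∫⁻ x, f x ^ 2 ∂μ) ^ (1 / 2 : ℝ) * (∫⁻ x, g x ^ 2 ∂μ) ^ (1 / 2 : ℝ)) ^ 2 := by gcongr
    _ = _ := by rw [mul_pow, h2, h2]

theorem lintegral_gaussian {b : ℝ} (hb : 0 < b) :
    ∫⁻ x : Plane, ENNReal.ofReal (Real.exp (-b * ‖x‖ ^ 2)) = ENNReal.ofReal (Real.pi / b) := by
  have h : ∫ v : Plane, Real.exp (-b * ‖v‖ ^ 2) = Real.pi / b := by
    rw [GaussianFourier.integral_rexp_neg_mul_sq_norm hb]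
    simp
  have h_int : Integrable fun v : Plane => Real.exp (-b * ‖v‖ ^ 2) := by
    -- A non-integrable function has integral `0` by convention, so the positive value in `h` forces
    -- integrability.
    by_contra hn
    rw [integral_undef hn] at h
    have : 0 < Real.pi / b := by positivity
    linarith
  rw [← h, ofReal_integral_eq_lintegral_ofReal h_int
    (Filter.Eventually.of_forall fun _ => (Real.exp_pos _).le)]

theorem lintegral_exp_neg_mul_rpow {μ a : ℝ} (hμ : 0 < μ) (ha : 0 < a) :
    ∫⁻ t in Ioi (0 : ℝ), ENNReal.ofReal (Real.exp (-μ * t) * t ^ (a - 1)) =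
      ENNReal.ofReal ((1 / μ) ^ a * Real.Gamma a) := by
  have h := Real.integral_rpow_mul_exp_neg_mul_Ioi ha hμ
  have hpos : 0 < (1 / μ) ^ a * Real.Gamma a := by
    have := Real.Gamma_pos_of_pos ha
    positivity
  have h_int : IntegrableOn (fun t : ℝ => t ^ (a - 1) * Real.exp (-(μ * t))) (Ioi 0) := by
    by_contra hn
    rw [integral_undef hn] at h
    linarith
  rw [← h, ofReal_integral_eq_lintegral_ofReal h_int]
  · refine lintegral_congr fun t => ?_
    rw [mul_comm, neg_mul]
  · filter_upwards [ae_restrict_mem measurableSet_Ioi] with t ht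
    exact mul_nonneg (Real.rpow_nonneg (le_of_lt ht) _) (Real.exp_pos _).le

/-- The dominating kernel `∫₀^∞ e ^ (-μ t) t⁻¹ e ^ (-|x|² / (16 t)) dt`. -/
def domKernel (μ : ℝ) (x : Plane) : ℝ≥0∞ :=
  ∫⁻ t in Ioi (0 : ℝ), ENNReal.ofReal (Real.exp (-μ * t) * t⁻¹ * Real.exp (-(16 * t)⁻¹ * ‖x‖ ^ 2))

theorem measurable_domKernel (μ : ℝ) : Measurable (domKernel μ) := by
  unfold domKernel
  refine Measurable.lintegral_prod_right' (f := fun z : Plane × ℝ => ENNReal.ofReal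
    (Real.exp (-μ * z.2) * z.2⁻¹ * Real.exp (-(16 * z.2)⁻¹ * ‖z.1‖ ^ 2))) ?_
  fun_prop

/-- Tonelli reduces every weighted bound on the kernel to a Gaussian integral at a fixed time `t`.
-/
theorem lintegral_mul_domKernel {W : Plane → ℝ≥0∞} (hW : Measurable W) (μ : ℝ) (y : Plane) :
    ∫⁻ x, W x * domKernel μ (x - y) = ∫⁻ t in Ioi (0 : ℝ),
      ENNReal.ofReal (Real.exp (-μ * t) * t⁻¹) *
        ∫⁻ x, W x * ENNReal.ofReal (Real.exp (-(16 * t)⁻¹ * ‖x - y‖ ^ 2)) := by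
  calc ∫⁻ x, W x * domKernel μ (x - y)
      = ∫⁻ x, ∫⁻ t in Ioi (0 : ℝ), W x * ENNReal.ofReal
          (Real.exp (-μ * t) * t⁻¹ * Real.exp (-(16 * t)⁻¹ * ‖x - y‖ ^ 2)) := by
        refine lintegral_congr fun x => ?_
        rw [domKernel, lintegral_const_mul _ (by fun_prop)]
    _ = ∫⁻ t in Ioi (0 : ℝ), ∫⁻ x, W x * ENNReal.ofReal
          (Real.exp (-μ * t) * t⁻¹ * Real.exp (-(16 * t)⁻¹ * ‖x - y‖ ^ 2)) := by
        refine lintegral_lintegral_swap (Measurable.aemeasurable ?_)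
        simp only [Function.uncurry_def]
        fun_prop
    _ = _ := by
        refine setLIntegral_congr_fun measurableSet_Ioi fun t ht => ?_
        have ht : 0 < t := ht
        rw [← lintegral_const_mul _ (by fun_prop)]
        refine lintegral_congr fun x => ?_
        rw [ENNReal.ofReal_mul (by positivity)]
        ring

theorem lintegral_domKernel {μ : ℝ} (hμ : 0 < μ) :
    ∫⁻ x, domKernel μ x = ENNReal.ofReal (16 * Real.pi / μ) := by
  have h := lintegral_mul_domKernel (W := fun _ => 1) measurable_const μ 0
  simp only [one_mul, sub_zero] at h
  rw [h]
  have h1 := lintegral_exp_neg_mul_rpow hμ one_pos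
  simp only [sub_self, Real.rpow_zero, mul_one, Real.rpow_one, Real.Gamma_one] at h1
  calc _ = ∫⁻ t in Ioi (0 : ℝ), ENNReal.ofReal (16 * Real.pi) *
          ENNReal.ofReal (Real.exp (-μ * t)) := by
        refine setLIntegral_congr_fun measurableSet_Ioi fun t ht => ?_
        have ht : 0 < t := ht
        rw [lintegral_gaussian (by positivity), ← ENNReal.ofReal_mul (by positivity),
          ← ENNReal.ofReal_mul (by positivity)]
        congr 1
        field_simp
    _ = _ := by
        rw [lintegral_const_mul _ (by fun_prop), h1, ← ENNReal.ofReal_mul (by positivity)]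
        congr 1
        ring

/-- The kernel has a logarithmic singularity at most, hence is in `L²` of the plane. To see this
without asymptotics, Cauchy–Schwarz in `t` splits `t⁻¹` as `t ^ (-1 / 4)` times `t ^ (-3 / 4)`. The
second factor squared gains one power of `t` from the Gaussian integral over the plane, so both
integrals reduce to `∫ e ^ (-μ t) t ^ (-1 / 2) dt`. -/
theorem lintegral_domKernel_sq_lt_top {μ : ℝ} (hμ : 0 < μ) :
    ∫⁻ x, domKernel μ x ^ 2 < ∞ := by
  set c : ℝ≥0∞ := ∫⁻ t in Ioi (0 : ℝ), ENNReal.ofReal (Real.exp (-μ * t) * t ^ (1 / 2 - 1 : ℝ))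
    with hc
  have hc_top : c < ∞ := by
    rw [hc, lintegral_exp_neg_mul_rpow hμ (by norm_num)]
    exact ENNReal.ofReal_lt_top
  have hpt : ∀ x : Plane, domKernel μ x ^ 2 ≤ c * ∫⁻ t in Ioi (0 : ℝ), ENNReal.ofReal
      (Real.exp (-μ * t) * t ^ (-(3 / 2) : ℝ) * Real.exp (-(8 * t)⁻¹ * ‖x‖ ^ 2)) := by
    intro x
    have h := sq_lintegral_mul_le (μ := volume.restrict (Ioi (0 : ℝ)))
      (f := fun t => ENNReal.ofReal (Real.exp (-μ / 2 * t) * t ^ (-(1 / 4) : ℝ)))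
      (g := fun t => ENNReal.ofReal (Real.exp (-μ / 2 * t) * t ^ (-(3 / 4) : ℝ) *
        Real.exp (-(16 * t)⁻¹ * ‖x‖ ^ 2))) (by fun_prop) (by fun_prop)
    refine le_trans (le_of_eq ?_) (h.trans (le_of_eq ?_))
    · congr 1
      refine setLIntegral_congr_fun measurableSet_Ioi fun t ht => ?_
      have ht : 0 < t := ht
      rw [← ENNReal.ofReal_mul (by positivity)]
      congr 1
      have e1 : Real.exp (-μ * t) = Real.exp (-μ / 2 * t) * Real.exp (-μ / 2 * t) := by
        rw [← Real.exp_add]; ring_nf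
      have e2 : t⁻¹ = t ^ (-(1 / 4) : ℝ) * t ^ (-(3 / 4) : ℝ) := by
        rw [← Real.rpow_add ht, ← Real.rpow_neg_one]; norm_num
      rw [e1, e2]
      ring
    · congr 1
      · refine setLIntegral_congr_fun measurableSet_Ioi fun t ht => ?_
        have ht : 0 < t := ht
        rw [← ENNReal.ofReal_pow (by positivity)]
        congr 1
        have e1 : Real.exp (-μ * t) = Real.exp (-μ / 2 * t) * Real.exp (-μ / 2 * t) := by
          rw [← Real.exp_add]; ring_nf
        have e2 : t ^ (1 / 2 - 1 : ℝ) = t ^ (-(1 / 4) : ℝ) * t ^ (-(1 / 4) : ℝ) := by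
          rw [← Real.rpow_add ht]; norm_num
        rw [e1, e2]
        ring
      · refine setLIntegral_congr_fun measurableSet_Ioi fun t ht => ?_
        have ht : 0 < t := ht
        rw [← ENNReal.ofReal_pow (by positivity)]
        congr 1
        have e1 : Real.exp (-μ * t) = Real.exp (-μ / 2 * t) * Real.exp (-μ / 2 * t) := by
          rw [← Real.exp_add]; ring_nf
        have e2 : t ^ (-(3 / 2) : ℝ) = t ^ (-(3 / 4) : ℝ) * t ^ (-(3 / 4) : ℝ) := by
          rw [← Real.rpow_add ht]; norm_num
        have e3 : Real.exp (-(8 * t)⁻¹ * ‖x‖ ^ 2) =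
            Real.exp (-(16 * t)⁻¹ * ‖x‖ ^ 2) * Real.exp (-(16 * t)⁻¹ * ‖x‖ ^ 2) := by
          rw [← Real.exp_add]
          congr 1
          field_simp
          ring
        rw [e1, e2, e3]
        ring
  calc ∫⁻ x, domKernel μ x ^ 2
      ≤ ∫⁻ x, c * ∫⁻ t in Ioi (0 : ℝ), ENNReal.ofReal
          (Real.exp (-μ * t) * t ^ (-(3 / 2) : ℝ) * Real.exp (-(8 * t)⁻¹ * ‖x‖ ^ 2)) :=
        lintegral_mono hpt
    _ = c * ∫⁻ x : Plane, ∫⁻ t in Ioi (0 : ℝ), ENNReal.ofReal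
          (Real.exp (-μ * t) * t ^ (-(3 / 2) : ℝ) * Real.exp (-(8 * t)⁻¹ * ‖x‖ ^ 2)) := by
        refine lintegral_const_mul _ ?_
        refine Measurable.lintegral_prod_right' (f := fun z : Plane × ℝ => ENNReal.ofReal
          (Real.exp (-μ * z.2) * z.2 ^ (-(3 / 2) : ℝ) * Real.exp (-(8 * z.2)⁻¹ * ‖z.1‖ ^ 2))) ?_
        fun_prop
    _ = c * ∫⁻ t in Ioi (0 : ℝ), ∫⁻ x : Plane, ENNReal.ofReal
          (Real.exp (-μ * t) * t ^ (-(3 / 2) : ℝ) * Real.exp (-(8 * t)⁻¹ * ‖x‖ ^ 2)) := by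
        congr 1
        refine lintegral_lintegral_swap (Measurable.aemeasurable ?_)
        simp only [Function.uncurry_def]
        fun_prop
    _ = c * ∫⁻ t in Ioi (0 : ℝ), ENNReal.ofReal (8 * Real.pi) *
          ENNReal.ofReal (Real.exp (-μ * t) * t ^ (1 / 2 - 1 : ℝ)) := by
        congr 1
        refine setLIntegral_congr_fun measurableSet_Ioi fun t ht => ?_
        have ht : 0 < t := ht
        have e : ∀ x : Plane, ENNReal.ofReal
            (Real.exp (-μ * t) * t ^ (-(3 / 2) : ℝ) * Real.exp (-(8 * t)⁻¹ * ‖x‖ ^ 2)) =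
            ENNReal.ofReal (Real.exp (-μ * t) * t ^ (-(3 / 2) : ℝ)) *
              ENNReal.ofReal (Real.exp (-(8 * t)⁻¹ * ‖x‖ ^ 2)) := fun x =>
          ENNReal.ofReal_mul (by positivity)
        simp only [e]
        rw [lintegral_const_mul _ (by fun_prop), lintegral_gaussian (by positivity),
          ← ENNReal.ofReal_mul (by positivity), ← ENNReal.ofReal_mul (by positivity)]
        congr 1
        have e2 : t ^ (1 / 2 - 1 : ℝ) = t ^ (-(3 / 2) : ℝ) * t := by
          nth_rewrite 3 [← Real.rpow_one t]
          rw [← Real.rpow_add ht]; norm_num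
        rw [e2, div_inv_eq_mul]
        ring
    _ < ∞ := by
        rw [lintegral_const_mul _ (by fun_prop), ← hc]
        exact ENNReal.mul_lt_top hc_top (ENNReal.mul_lt_top ENNReal.ofReal_lt_top hc_top)

/-- `V` times the dominating kernel is small for large `μ`. -/
theorem exists_lintegral_mul_domKernel_le {q : ℝ≥0∞} (hq : 1 < q) {V : Plane → ℝ}
    (hV : Measurable V) (hVq : MemLp V q) : ∃ C a : ℝ, 0 ≤ C ∧ 0 < a ∧ ∀ μ : ℝ, 0 < μ → ∀ y,
      ∫⁻ x, ‖V x‖ₑ * domKernel μ (x - y) ≤ ENNReal.ofReal (C * (1 / μ) ^ a) := by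
  set q' := (1 - q⁻¹)⁻¹ with hq'
  have hconj : ENNReal.HolderConjugate q q' := ENNReal.HolderConjugate.inv_one_sub_inv' hq.le
  have hq'top : q' ≠ ∞ := by
    rw [hq', ne_eq, ENNReal.inv_eq_top, tsub_eq_zero_iff_le, not_le]
    exact ENNReal.inv_lt_one.2 hq
  have hq'0 : q' ≠ 0 := by
    rw [hq', ne_eq, ENNReal.inv_eq_zero]
    exact ne_top_of_le_ne_top ENNReal.one_ne_top tsub_le_self
  set Q := q'.toReal with hQ
  have hQ0 : 0 < Q := ENNReal.toReal_pos hq'0 hq'top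
  set N := (eLpNorm V q volume).toReal with hN
  have hNV : eLpNorm V q volume = ENNReal.ofReal N := (ENNReal.ofReal_toReal hVq.2.ne).symm
  refine ⟨N * (16 * Real.pi / Q) ^ (1 / Q) * Real.Gamma (1 / Q), 1 / Q,
    mul_nonneg (by positivity) (Real.Gamma_pos_of_pos (by positivity)).le, by positivity,
    fun μ hμ y => ?_⟩
  -- Hölder in space: a Gaussian of width `√t` in the plane has `L^{q'}` norm of order `t ^ (1 /
  -- q')`. Against `t⁻¹` this leaves `t ^ (1 / q' - 1)`, integrable at `0` because `q > 1` makes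
  -- `q'` finite.
  have hholder : ∀ t : ℝ, 0 < t →
      ∫⁻ x, ‖V x‖ₑ * ENNReal.ofReal (Real.exp (-(16 * t)⁻¹ * ‖x - y‖ ^ 2)) ≤
        ENNReal.ofReal (N * (16 * Real.pi / Q * t) ^ (1 / Q)) := by
    intro t ht
    set g : Plane → ℝ := fun x => Real.exp (-(16 * t)⁻¹ * ‖x - y‖ ^ 2) with hg
    have hgm : Measurable g := by fun_prop
    have h := eLpNorm_smul_le_mul_eLpNorm (p := q) (q := q') (r := 1) (μ := volume)
      hgm.aestronglyMeasurable hV.aestronglyMeasurable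
    rw [eLpNorm_one_eq_lintegral_enorm] at h
    have hgn : eLpNorm g q' volume = ENNReal.ofReal ((16 * Real.pi / Q * t) ^ (1 / Q)) := by
      rw [eLpNorm_eq_lintegral_rpow_enorm_toReal hq'0 hq'top]
      have : ∀ x, ‖g x‖ₑ ^ q'.toReal =
          ENNReal.ofReal (Real.exp (-(Q * (16 * t)⁻¹) * ‖x - y‖ ^ 2)) := fun x => by
        rw [Real.enorm_of_nonneg (Real.exp_pos _).le,
          ENNReal.ofReal_rpow_of_pos (Real.exp_pos _), ← Real.exp_mul]
        congr 2
        ring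
      simp only [this]
      rw [lintegral_sub_right_eq_self
        (fun x : Plane => ENNReal.ofReal (Real.exp (-(Q * (16 * t)⁻¹) * ‖x‖ ^ 2))) y,
        lintegral_gaussian (by positivity), ENNReal.ofReal_rpow_of_pos (by positivity)]
      congr 2
      field_simp
    rw [hNV, hgn, ← ENNReal.ofReal_mul ENNReal.toReal_nonneg] at h
    refine le_trans (le_of_eq (lintegral_congr fun x => ?_)) h
    rw [Pi.smul_apply', smul_eq_mul, enorm_mul, Real.enorm_of_nonneg (Real.exp_pos _).le]
  rw [lintegral_mul_domKernel hV.enorm]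
  calc _ ≤ ∫⁻ t in Ioi (0 : ℝ), ENNReal.ofReal (N * (16 * Real.pi / Q) ^ (1 / Q)) *
        ENNReal.ofReal (Real.exp (-μ * t) * t ^ (1 / Q - 1)) := by
        refine setLIntegral_mono' measurableSet_Ioi fun t ht => ?_
        have ht : 0 < t := ht
        calc _ ≤ ENNReal.ofReal (Real.exp (-μ * t) * t⁻¹) *
              ENNReal.ofReal (N * (16 * Real.pi / Q * t) ^ (1 / Q)) := by
              gcongr; exact hholder t ht
          _ = _ := by
              rw [← ENNReal.ofReal_mul (by positivity), ← ENNReal.ofReal_mul (by positivity),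
                Real.mul_rpow (by positivity) ht.le, Real.rpow_sub_one ht.ne']
              congr 1
              field_simp
    _ = _ := by
        rw [lintegral_const_mul _ (by fun_prop), lintegral_exp_neg_mul_rpow hμ (by positivity),
          ← ENNReal.ofReal_mul (by positivity)]
        congr 1
        ring

end Kernel

end SchrodingerL1

end

noncomputable section

namespace SchrodingerL1

/-! ### Free resolvents as integrals of the heat kernel over complex times. -/

section ResolventKernel

open FourierTransform

/-- The heat kernel at the complex time `ω t`, times `ω e ^ (-z ω t)`. -/
def heatIntegrand (z ω : ℂ) (t : ℝ) (x : Plane) : ℂ :=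
  Complex.exp (-(z * ω) * t) * ((4 * Real.pi * t)⁻¹ : ℝ) * Complex.exp (-(4 * ω * t)⁻¹ * ‖x‖ ^ 2)

/-- The kernel of `(-Δ + z)⁻¹`, as an integral of the heat kernel over the ray `ω ℝ₊`. -/
def resKernel (z ω : ℂ) (x : Plane) : ℂ := ∫ t in Ioi (0 : ℝ), heatIntegrand z ω t x

theorem measurable_heatIntegrand (z ω : ℂ) :
    Measurable fun p : ℝ × Plane => heatIntegrand z ω p.1 p.2 := by
  unfold heatIntegrand
  fun_prop

theorem measurable_resKernel (z ω : ℂ) : Measurable (resKernel z ω) := by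
  have h : StronglyMeasurable fun p : Plane × ℝ => heatIntegrand z ω p.2 p.1 :=
    ((measurable_heatIntegrand z ω).comp measurable_swap).stronglyMeasurable
  exact (h.integral_prod_right' (ν := volume.restrict (Ioi 0))).measurable

theorem resKernel_neg (z ω : ℂ) (x : Plane) : resKernel z ω (-x) = resKernel z ω x := by
  simp only [resKernel, heatIntegrand, norm_neg]

theorem conj_resKernel_one (l : ℝ) (x : Plane) :
    (starRingEnd ℂ) (resKernel l 1 x) = resKernel l 1 x := by
  rw [resKernel, ← integral_conj]
  refine integral_congr_ae (Filter.Eventually.of_forall fun t => ?_)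
  simp only [heatIntegrand, map_mul, ← Complex.exp_conj, map_neg, map_inv₀, map_pow,
    Complex.conj_ofReal, map_one, map_ofNat]

/-- The modulus of a Gaussian at complex time `ω t` depends on `Re (1 / ω)` only; the lower bound `1
/ 2` accommodates both `ω = 1` and `ω = 1 ± i`. -/
theorem norm_heatIntegrand_le {z ω : ℂ} {μ : ℝ} (hμ : μ ≤ (z * ω).re) (hω : 1 / 2 ≤ (ω⁻¹).re)
    {t : ℝ} (ht : 0 < t) (x : Plane) :
    ‖heatIntegrand z ω t x‖ ≤
      Real.exp (-μ * t) * (4 * Real.pi * t)⁻¹ * Real.exp (-(8 * t)⁻¹ * ‖x‖ ^ 2) := by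
  rw [heatIntegrand, norm_mul, norm_mul, Complex.norm_exp, Complex.norm_exp, Complex.norm_real,
    Real.norm_of_nonneg (by positivity)]
  have h1 : (-(z * ω) * (t : ℂ)).re = -(z * ω).re * t := by
    rw [Complex.re_mul_ofReal, Complex.neg_re]
  have h2 : (-(4 * ω * (t : ℂ))⁻¹ * ((‖x‖ : ℂ) ^ 2)).re = -((4 * t)⁻¹ * (ω⁻¹).re) * ‖x‖ ^ 2 := by
    have e : -(4 * ω * (t : ℂ))⁻¹ * ((‖x‖ : ℂ) ^ 2) =
        ω⁻¹ * ((-((4 * t)⁻¹ * ‖x‖ ^ 2) : ℝ) : ℂ) := by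
      push_cast
      rw [mul_inv, mul_inv, mul_inv]
      ring
    rw [e, Complex.re_mul_ofReal]
    ring
  rw [h1, h2]
  have e3 : (8 * t)⁻¹ = (4 * t)⁻¹ * (1 / 2) := by field_simp; norm_num
  have e4 : (0 : ℝ) ≤ (4 * t)⁻¹ := by positivity
  rw [e3]
  gcongr

/-- Half of the Gaussian exponent pays for the weight: completing the square, `η |x| ≤ |x|² / (16 t)
+ 4 η² t`, so the weight costs only `4 η²` of exponential decay in `t`. -/
theorem weight_mul_norm_heatIntegrand_le {z ω : ℂ} {μ η : ℝ} (hμ : μ ≤ (z * ω).re)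
    (hω : 1 / 2 ≤ (ω⁻¹).re) {t : ℝ} (ht : 0 < t) (x : Plane) :
    Real.exp (η * ‖x‖) * ‖heatIntegrand z ω t x‖ ≤
      Real.exp (-(μ - 4 * η ^ 2) * t) * t⁻¹ * Real.exp (-(16 * t)⁻¹ * ‖x‖ ^ 2) := by
  have h1 := norm_heatIntegrand_le hμ hω ht x
  have h2 : (4 * Real.pi * t)⁻¹ ≤ t⁻¹ := by
    gcongr
    nlinarith [Real.pi_gt_three]
  have h3 : Real.exp (η * ‖x‖) * Real.exp (-(8 * t)⁻¹ * ‖x‖ ^ 2) ≤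
      Real.exp (4 * η ^ 2 * t) * Real.exp (-(16 * t)⁻¹ * ‖x‖ ^ 2) := by
    rw [← Real.exp_add, ← Real.exp_add]
    refine Real.exp_le_exp.2 ?_
    have h : 0 ≤ (16 * t)⁻¹ * (‖x‖ - 8 * η * t) ^ 2 := by positivity
    have e : (16 * t)⁻¹ * (‖x‖ - 8 * η * t) ^ 2 =
        (8 * t)⁻¹ * ‖x‖ ^ 2 - (16 * t)⁻¹ * ‖x‖ ^ 2 - η * ‖x‖ + 4 * η ^ 2 * t := by
      field_simp
      ring
    linarith
  calc _ ≤ Real.exp (η * ‖x‖) *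
        (Real.exp (-μ * t) * t⁻¹ * Real.exp (-(8 * t)⁻¹ * ‖x‖ ^ 2)) := by
        gcongr
        exact h1.trans (by gcongr)
    _ = Real.exp (-μ * t) * t⁻¹ * (Real.exp (η * ‖x‖) * Real.exp (-(8 * t)⁻¹ * ‖x‖ ^ 2)) := by ring
    _ ≤ Real.exp (-μ * t) * t⁻¹ *
        (Real.exp (4 * η ^ 2 * t) * Real.exp (-(16 * t)⁻¹ * ‖x‖ ^ 2)) := by gcongr
    _ = _ := by
        have : Real.exp (-(μ - 4 * η ^ 2) * t) = Real.exp (-μ * t) * Real.exp (4 * η ^ 2 * t) := by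
          rw [← Real.exp_add]; ring_nf
        rw [this]
        ring

theorem weight_mul_enorm_resKernel_le {z ω : ℂ} {μ : ℝ} (η : ℝ) (hμ : μ ≤ (z * ω).re)
    (hω : 1 / 2 ≤ (ω⁻¹).re) (x : Plane) :
    ENNReal.ofReal (Real.exp (η * ‖x‖)) * ‖resKernel z ω x‖ₑ ≤ domKernel (μ - 4 * η ^ 2) x := by
  calc _ ≤ ENNReal.ofReal (Real.exp (η * ‖x‖)) *
        ∫⁻ t in Ioi (0 : ℝ), ‖heatIntegrand z ω t x‖ₑ := by
        gcongr
        exact enorm_integral_le_lintegral_enorm _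
    _ = ∫⁻ t in Ioi (0 : ℝ), ENNReal.ofReal (Real.exp (η * ‖x‖)) * ‖heatIntegrand z ω t x‖ₑ := by
        rw [lintegral_const_mul]
        exact ((measurable_heatIntegrand z ω).comp measurable_prodMk_right).enorm
    _ ≤ _ := by
        refine setLIntegral_mono' measurableSet_Ioi fun t ht => ?_
        rw [← ofReal_norm, ← ENNReal.ofReal_mul (Real.exp_pos _).le]
        exact ENNReal.ofReal_le_ofReal (weight_mul_norm_heatIntegrand_le hμ hω ht x)

theorem enorm_resKernel_le {z ω : ℂ} {μ : ℝ} (hμ : μ ≤ (z * ω).re)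
    (hω : 1 / 2 ≤ (ω⁻¹).re) (x : Plane) : ‖resKernel z ω x‖ₑ ≤ domKernel μ x := by
  simpa using weight_mul_enorm_resKernel_le 0 hμ hω x

theorem integrable_heatIntegrand {z ω : ℂ} (hμ : 0 < (z * ω).re) (hω : 1 / 2 ≤ (ω⁻¹).re) :
    Integrable (fun p : ℝ × Plane => heatIntegrand z ω p.1 p.2)
      ((volume.restrict (Ioi 0)).prod volume) := by
  refine ⟨(measurable_heatIntegrand z ω).aestronglyMeasurable, ?_⟩
  rw [hasFiniteIntegral_iff_enorm, lintegral_prod_symm _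
    (measurable_heatIntegrand z ω).enorm.aemeasurable]
  refine lt_of_le_of_lt (lintegral_mono fun x => ?_)
    ((lintegral_domKernel hμ).trans_lt ENNReal.ofReal_lt_top)
  refine setLIntegral_mono' measurableSet_Ioi fun t ht => ?_
  rw [← ofReal_norm]
  have := weight_mul_norm_heatIntegrand_le (η := 0) le_rfl hω ht x (z := z)
  simp only [zero_mul, Real.exp_zero, one_mul, ne_eq, OfNat.ofNat_ne_zero, not_false_eq_true,
    zero_pow, mul_zero, sub_zero] at this
  exact ENNReal.ofReal_le_ofReal this

theorem integrable_resKernel {z ω : ℂ} (hμ : 0 < (z * ω).re) (hω : 1 / 2 ≤ (ω⁻¹).re) :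
    Integrable (resKernel z ω) :=
  (integrable_heatIntegrand hμ hω).integral_prod_right

theorem fourier_heatIntegrand {z ω : ℂ} (hω : 1 / 2 ≤ (ω⁻¹).re) {t : ℝ} (ht : 0 < t)
    (ξ : Plane) : 𝓕 (heatIntegrand z ω t) ξ =
      ω * Complex.exp (-((z + laplaceSymbol ξ) * ω) * t) := by
  have hω0 : ω ≠ 0 := by
    rintro rfl
    norm_num at hω
  have ht' : (t : ℂ) ≠ 0 := Complex.ofReal_ne_zero.2 ht.ne'
  have hb : 0 < ((4 * ω * (t : ℂ))⁻¹).re := by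
    have e : (4 * ω * (t : ℂ))⁻¹ = ω⁻¹ * (((4 * t)⁻¹ : ℝ) : ℂ) := by
      push_cast
      rw [mul_inv, mul_inv, mul_inv]
      ring
    rw [e, Complex.re_mul_ofReal]
    have : 0 < (4 * t)⁻¹ := by positivity
    have : 0 < (ω⁻¹).re := by linarith
    positivity
  have hg := fourier_gaussian_innerProductSpace (V := Plane) hb ξ
  have hmul : 𝓕 (heatIntegrand z ω t) ξ =
      (Complex.exp (-(z * ω) * t) * ((4 * Real.pi * t)⁻¹ : ℝ)) *
        𝓕 (fun v : Plane => Complex.exp (-(4 * ω * (t : ℂ))⁻¹ * ‖v‖ ^ 2)) ξ := by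
    rw [Real.fourier_eq, Real.fourier_eq, ← integral_const_mul]
    refine integral_congr_ae (Filter.Eventually.of_forall fun x => ?_)
    simp only [heatIntegrand, Circle.smul_def, smul_eq_mul]
    ring
  rw [hmul, hg]
  have e1 : ((Module.finrank ℝ Plane : ℂ) / 2) = 1 := by simp
  rw [e1, Complex.cpow_one]
  have e2 : Complex.exp (-((z + laplaceSymbol ξ) * ω) * t) = Complex.exp (-(z * ω) * t) *
      Complex.exp (-(Real.pi : ℂ) ^ 2 * ‖ξ‖ ^ 2 / (4 * ω * t)⁻¹) := by
    rw [← Complex.exp_add]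
    congr 1
    rw [laplaceSymbol, div_inv_eq_mul]
    push_cast
    ring
  rw [e2]
  push_cast
  have hpi : (Real.pi : ℂ) ≠ 0 := Complex.ofReal_ne_zero.2 Real.pi_ne_zero
  field_simp

/-- By Fubini the transform is `ω ∫ exp (-(z + λ) ω t) dt` with `λ = |2 π ξ|²`. It converges, and `z
+ λ` is nonzero, because `Re ω ≥ 0` gives `Re ((z + λ) ω) ≥ Re (z ω) > 0`. -/
theorem fourier_resKernel {z ω : ℂ} (hμ : 0 < (z * ω).re) (hω : 1 / 2 ≤ (ω⁻¹).re)
    (ξ : Plane) : 𝓕 (resKernel z ω) ξ = (z + laplaceSymbol ξ)⁻¹ ∧ z + laplaceSymbol ξ ≠ 0 := by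
  have hω0 : ω ≠ 0 := by
    rintro rfl
    norm_num at hω
  have hωre : 0 ≤ ω.re := by
    rw [Complex.inv_re] at hω
    by_contra h
    have : ω.re / Complex.normSq ω ≤ 0 :=
      div_nonpos_of_nonpos_of_nonneg (not_le.1 h).le (Complex.normSq_nonneg _)
    linarith
  have hre : 0 < ((z + laplaceSymbol ξ) * ω).re := by
    rw [add_mul, Complex.add_re, Complex.re_ofReal_mul]
    have := mul_nonneg (laplaceSymbol_nonneg ξ) hωre
    linarith
  have hne : z + laplaceSymbol ξ ≠ 0 := by
    intro h
    rw [h] at hre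
    simp at hre
  refine ⟨?_, hne⟩
  calc 𝓕 (resKernel z ω) ξ
      = ∫ x, ∫ t in Ioi (0 : ℝ), Real.fourierChar (-inner ℝ x ξ) • heatIntegrand z ω t x := by
        rw [Real.fourier_eq]
        refine integral_congr_ae (Filter.Eventually.of_forall fun x => ?_)
        simp only [resKernel, Circle.smul_def]
        rw [integral_smul]
    _ = ∫ t in Ioi (0 : ℝ), ∫ x, Real.fourierChar (-inner ℝ x ξ) • heatIntegrand z ω t x := by
        refine (integral_integral_swap ?_).symm
        have h := integrable_heatIntegrand hμ hω
        refine h.mono ?_ (Filter.Eventually.of_forall fun p => ?_)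
        · refine AEStronglyMeasurable.smul ?_ h.aestronglyMeasurable
          have hc : Continuous fun p : ℝ × Plane => -inner ℝ p.2 ξ := by fun_prop
          exact (continuous_subtype_val.comp
            (Real.continuous_fourierChar.comp hc)).aestronglyMeasurable
        · simp only [Function.uncurry_def, Circle.norm_smul, le_refl]
    _ = ∫ t in Ioi (0 : ℝ), ω * Complex.exp (-((z + laplaceSymbol ξ) * ω) * t) := by
        refine setIntegral_congr_fun measurableSet_Ioi fun t ht => ?_
        exact fourier_heatIntegrand hω ht ξ
    _ = _ := by
        rw [integral_const_mul, integral_exp_mul_complex_Ioi (by rw [Complex.neg_re]; linarith)]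
        simp only [Complex.ofReal_zero, mul_zero, Complex.exp_zero]
        field_simp

/-- The resolvent `(-Δ + z)⁻¹` on `L¹`. -/
def freeRes (z ω : ℂ) (hμ : 0 < (z * ω).re) (hω : 1 / 2 ≤ (ω⁻¹).re) : L1 →L[ℂ] L1 :=
  convL1 (resKernel z ω) (integrable_resKernel hμ hω) (measurable_resKernel z ω)

theorem fourierAt_freeRes {z ω : ℂ} (hμ : 0 < (z * ω).re) (hω : 1 / 2 ≤ (ω⁻¹).re) (f : L1)
    (ξ : Plane) : fourierAt ξ (freeRes z ω hμ hω f) = (z + laplaceSymbol ξ)⁻¹ * fourierAt ξ f := by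
  rw [freeRes, fourierAt_convL1, (fourier_resKernel hμ hω ξ).1]

theorem isBoundedInverse_freeRes {z ω : ℂ} (hμ : 0 < (z * ω).re) (hω : 1 / 2 ≤ (ω⁻¹).re) :
    IsBoundedInverse (shift z (-laplacianL1)) (freeRes z ω hμ hω) :=
  isBoundedInverse_laplacianL1 (fun ξ => (fourier_resKernel hμ hω ξ).2) (fourierAt_freeRes hμ hω)

theorem norm_freeRes_le {z ω : ℂ} (hμ : 0 < (z * ω).re) (hω : 1 / 2 ≤ (ω⁻¹).re) :
    ‖freeRes z ω hμ hω‖ ≤ 16 * Real.pi / (z * ω).re := by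
  refine norm_convL1_le _ _ (by positivity) ?_
  rw [← lintegral_domKernel hμ]
  exact lintegral_mono fun x => enorm_resKernel_le le_rfl hω x

end ResolventKernel

end SchrodingerL1

end

noncomputable section

namespace SchrodingerL1

/-! ### Resolvents of the Schrödinger operator far from the spectrum -/

section Perturbation

variable {V : Plane → ℝ} {C a : ℝ}

/-- `V (-Δ + z)⁻¹` is a bounded operator on `L¹`. -/
theorem exists_mul_freeRes (hV : Measurable V) (hC : 0 ≤ C)
    (hVk : ∀ μ : ℝ, 0 < μ → ∀ y,
      ∫⁻ x, ‖V x‖ₑ * domKernel μ (x - y) ≤ ENNReal.ofReal (C * (1 / μ) ^ a))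
    {z ω : ℂ} (hμ : 0 < (z * ω).re) (hω : 1 / 2 ≤ (ω⁻¹).re) :
    ∃ K : L1 →L[ℂ] L1, (∀ f, (freeRes z ω hμ hω f, K f) ∈ (mulL1 V).graph) ∧
      ‖K‖ ≤ C * (1 / (z * ω).re) ^ a := by
  refine exists_mul_comp hV _ (by positivity) fun f => ?_
  refine lintegral_mul_convL1_le _ _ hV (fun y => ?_) f
  refine le_trans (lintegral_mono fun x => ?_) (hVk _ hμ y)
  gcongr
  exact enorm_resKernel_le le_rfl hω _

theorem exists_forall_mul_rpow_le (C : ℝ) (ha : 0 < a) {δ : ℝ} (hδ : 0 < δ) :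
    ∃ μ₀ : ℝ, 1 ≤ μ₀ ∧ ∀ μ, μ₀ ≤ μ → C * (1 / μ) ^ a ≤ δ := by
  have h : Filter.Tendsto (fun μ : ℝ => C * (1 / μ) ^ a) Filter.atTop (nhds (C * 0)) := by
    refine (Filter.Tendsto.congr' ?_ (tendsto_rpow_neg_atTop ha)).const_mul C
    filter_upwards [Filter.eventually_gt_atTop 0] with μ hμ
    rw [one_div, Real.inv_rpow hμ.le, Real.rpow_neg hμ.le]
  rw [mul_zero] at h
  obtain ⟨m, hm⟩ := Filter.eventually_atTop.1 (h.eventually (eventually_le_nhds hδ))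
  exact ⟨max 1 m, le_max_left _ _, fun μ hμ => hm μ ((le_max_right _ _).trans hμ)⟩

/-- The resolvent of the Schrödinger operator through the free resolvent. -/
theorem exists_resolvent_of_small (hV : Measurable V) (hC : 0 ≤ C)
    (hVk : ∀ μ : ℝ, 0 < μ → ∀ y,
      ∫⁻ x, ‖V x‖ₑ * domKernel μ (x - y) ≤ ENNReal.ofReal (C * (1 / μ) ^ a))
    {z ω : ℂ} (hμ : 0 < (z * ω).re) (hω : 1 / 2 ≤ (ω⁻¹).re)
    (hsmall : C * (1 / (z * ω).re) ^ a ≤ 1 / 2) :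
    ∃ R : L1 →L[ℂ] L1, IsBoundedInverse (shift z (schrodinger V)) R ∧
      ‖R‖ ≤ 32 * Real.pi / (z * ω).re ∧
      ∀ f, ∃ h : L1, R f = freeRes z ω hμ hω h ∧ ‖h‖ ≤ 2 * ‖f‖ := by
  obtain ⟨K, hK, hKn⟩ := exists_mul_freeRes hV hC hVk hμ hω
  obtain ⟨U, hU, hUn⟩ := exists_unit_one_add (hKn.trans hsmall)
  refine ⟨_, (isBoundedInverse_freeRes hμ hω).add hK hU, ?_, fun f => ⟨_, rfl, ?_⟩⟩
  · refine (norm_mul_le _ _).trans ?_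
    calc _ ≤ 16 * Real.pi / (z * ω).re * 2 :=
          mul_le_mul (norm_freeRes_le hμ hω) hUn (norm_nonneg _) (by positivity)
      _ = _ := by ring
  · exact (ContinuousLinearMap.le_opNorm _ _).trans (by gcongr)

theorem one_half_le_inv_one : (1 : ℝ) / 2 ≤ ((1 : ℂ)⁻¹).re := by norm_num

theorem one_half_le_inv_one_sub_I {σ : ℝ} (hσ : σ ^ 2 = 1) :
    1 / 2 ≤ ((1 - σ * Complex.I)⁻¹).re := by
  rw [Complex.inv_re, Complex.normSq_apply]
  simp only [Complex.sub_re, Complex.one_re, Complex.mul_re, Complex.ofReal_re, Complex.I_re,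
    mul_zero, Complex.ofReal_im, Complex.I_im, mul_one, sub_self, sub_zero, Complex.sub_im,
    Complex.one_im, Complex.mul_im, add_zero, zero_sub]
  have : σ * σ = 1 := by nlinarith
  norm_num [this]

theorem mul_one_sub_I_re {σ : ℝ} (hσ : σ ^ 2 = 1) (s : ℝ) :
    ((σ * Complex.I * s) * (1 - σ * Complex.I)).re = s := by
  simp only [Complex.mul_re, Complex.ofReal_re, Complex.I_re, mul_zero, Complex.ofReal_im,
    Complex.I_im, mul_one, sub_self, zero_mul, Complex.mul_im, zero_add, add_zero,
    Complex.sub_re, Complex.one_re, sub_zero, Complex.sub_im, Complex.one_im, zero_sub]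
  linear_combination s * hσ

/-- The resolvent of the Schrödinger operator at `∓ i s` for large `s`. -/
theorem exists_resolvent_large (hV : Measurable V) (hC : 0 ≤ C) (ha : 0 < a)
    (hVk : ∀ μ : ℝ, 0 < μ → ∀ y,
      ∫⁻ x, ‖V x‖ₑ * domKernel μ (x - y) ≤ ENNReal.ofReal (C * (1 / μ) ^ a)) :
    ∃ S : ℝ, 1 ≤ S ∧ ∀ s, S ≤ s → ∀ σ : ℝ, σ ^ 2 = 1 → ∃ R : L1 →L[ℂ] L1,
      IsBoundedInverse (shift (σ * Complex.I * s) (schrodinger V)) R ∧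
        ‖R‖ ≤ 32 * Real.pi / s := by
  obtain ⟨S, hS, hsmall⟩ := exists_forall_mul_rpow_le C ha one_half_pos
  refine ⟨S, hS, fun s hs σ hσ => ?_⟩
  have hre := mul_one_sub_I_re hσ s
  -- The direction `ω = 1 - i σ` turns the purely imaginary `z = i σ s` into `z ω` with real part
  -- `s`, while `Re (1 / ω)` is exactly `1 / 2`.
  obtain ⟨R, hR, hRn, -⟩ := exists_resolvent_of_small hV hC hVk
    (z := σ * Complex.I * s) (ω := 1 - σ * Complex.I) (by rw [hre]; linarith)
    (one_half_le_inv_one_sub_I hσ) (by rw [hre]; exact hsmall s hs)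
  rw [hre] at hRn
  exact ⟨R, hR, hRn⟩

end Perturbation

end SchrodingerL1

end

noncomputable section

namespace SchrodingerL1

/-! ### Weighted estimates for convolutions -/

section Weighted

/-- Convolution with a nonnegative kernel. -/
def posConv (D f : Plane → ℝ≥0∞) (x : Plane) : ℝ≥0∞ := ∫⁻ z, D (x - z) * f z

/-- The exponential weight centred at `y`. -/
def expWeight (ε : ℝ) (y x : Plane) : ℝ≥0∞ := ENNReal.ofReal (Real.exp (-ε * ‖x - y‖))

/-- A convolution kernel `k` which is real, even, dominated by `D` with an exponential weight,
and small relative to the potential `V`. -/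
structure IsGoodKernel (V : Plane → ℝ) (k : Plane → ℂ) (D : Plane → ℝ≥0∞) : Prop where
  measurable : Measurable k
  measurable_dom : Measurable D
  integrable : Integrable k
  even : ∀ x, k (-x) = k x
  even_dom : ∀ x, D (-x) = D x
  real : ∀ x, (starRingEnd ℂ) (k x) = k x
  weight_le : ∀ x, ENNReal.ofReal (Real.exp (2 * ‖x‖)) * ‖k x‖ₑ ≤ D x
  lintegral_ne_top : ∫⁻ x, D x ≠ ∞
  lintegral_sq_ne_top : ∫⁻ x, D x ^ 2 ≠ ∞
  small : ∀ y, ∫⁻ x, ‖V x‖ₑ * D (x - y) ≤ 1 / 2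

theorem measurable_expWeight (ε : ℝ) (y : Plane) : Measurable (expWeight ε y) := by
  unfold expWeight
  fun_prop

theorem expWeight_le_one {ε : ℝ} (hε : 0 ≤ ε) (y x : Plane) : expWeight ε y x ≤ 1 := by
  rw [expWeight, ENNReal.ofReal_le_one, Real.exp_le_one_iff, neg_mul, neg_nonpos]
  positivity

/-- Triangle inequality. The factor `e ^ (2 |x - z|)` is larger than needed here, but it is the one
carried by `IsGoodKernel.weight_le` and required by the commutator estimate. -/
theorem expWeight_le {ε : ℝ} (hε : 0 ≤ ε) (hε1 : ε ≤ 1) (y x z : Plane) :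
    expWeight ε y x ≤ ENNReal.ofReal (Real.exp (2 * ‖x - z‖)) * expWeight ε y z := by
  rw [expWeight, expWeight, ← ENNReal.ofReal_mul (Real.exp_pos _).le, ← Real.exp_add]
  refine ENNReal.ofReal_le_ofReal (Real.exp_le_exp.2 ?_)
  have h1 : ‖z - y‖ ≤ ‖z - x‖ + ‖x - y‖ := norm_sub_le_norm_sub_add_norm_sub z x y
  rw [norm_sub_rev z x] at h1
  nlinarith [norm_nonneg (x - z), norm_nonneg (x - y), norm_nonneg (z - y)]

theorem lintegral_comp_sub_left (D : Plane → ℝ≥0∞) (hD : ∀ x, D (-x) = D x) (x : Plane) :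
    ∫⁻ z, D (x - z) = ∫⁻ z, D z := by
  have : ∀ z, D (x - z) = D (z - x) := fun z => by rw [← hD, neg_sub]
  simp only [this]
  exact lintegral_sub_right_eq_self D x

variable {V : Plane → ℝ} {k : Plane → ℂ} {D : Plane → ℝ≥0∞}

theorem measurable_posConv (hD : Measurable D) {f : Plane → ℝ≥0∞} (hf : Measurable f) :
    Measurable (posConv D f) := by
  unfold posConv
  refine Measurable.lintegral_prod_right' (f := fun z : Plane × Plane => D (z.1 - z.2) * f z.2) ?_
  fun_prop

theorem IsGoodKernel.dom_sub_comm (hk : IsGoodKernel V k D) (x z : Plane) :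
    D (x - z) = D (z - x) := by rw [← hk.even_dom, neg_sub]

theorem IsGoodKernel.posConv_sq_le (hk : IsGoodKernel V k D) {f : Plane → ℝ≥0∞}
    (hf : Measurable f) (x : Plane) :
    posConv D f x ^ 2 ≤ (∫⁻ z, D z ^ 2) * ∫⁻ z, f z ^ 2 := by
  have hD := hk.measurable_dom
  refine (sq_lintegral_mul_le (by fun_prop) hf.aemeasurable).trans_eq ?_
  rw [lintegral_comp_sub_left (fun z => D z ^ 2) (fun z => by rw [hk.even_dom]) x]

theorem lintegral_posConv_le (hD : Measurable D) {f : Plane → ℝ≥0∞} (hf : Measurable f) :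
    ∫⁻ x, posConv D f x ≤ (∫⁻ z, D z) * ∫⁻ z, f z := by
  have h := lintegral_mul_lintegral_sub_le (W := fun _ => 1) (k := D) (F := f)
    (c := ∫⁻ x, D x) measurable_const hD hf
    (fun y => by simp [lintegral_sub_right_eq_self D y])
  simp only [one_mul] at h
  exact h

/-- Young's inequality `L¹ * L² ⊂ L²`: Cauchy–Schwarz with `D` split into two square roots. -/
theorem IsGoodKernel.lintegral_posConv_sq_le (hk : IsGoodKernel V k D) {f : Plane → ℝ≥0∞}
    (hf : Measurable f) :
    ∫⁻ x, posConv D f x ^ 2 ≤ (∫⁻ z, D z) ^ 2 * ∫⁻ z, f z ^ 2 := by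
  have hD := hk.measurable_dom
  have hsq : ∀ a : ℝ≥0∞, (a ^ (1 / 2 : ℝ)) ^ 2 = a := fun a => by
    rw [← ENNReal.rpow_two, ← ENNReal.rpow_mul]
    norm_num
  have hpt : ∀ x, posConv D f x ^ 2 ≤ (∫⁻ z, D z) * posConv D (fun z => f z ^ 2) x := fun x => by
    have h := sq_lintegral_mul_le (μ := volume) (f := fun z => D (x - z) ^ (1 / 2 : ℝ))
      (g := fun z => D (x - z) ^ (1 / 2 : ℝ) * f z) (by fun_prop) (by fun_prop)
    simp only [← mul_assoc, ← pow_two, mul_pow, hsq] at h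
    rw [lintegral_comp_sub_left D hk.even_dom x] at h
    exact h
  calc ∫⁻ x, posConv D f x ^ 2 ≤ ∫⁻ x, (∫⁻ z, D z) * posConv D (fun z => f z ^ 2) x :=
        lintegral_mono hpt
    _ = (∫⁻ z, D z) * ∫⁻ x, posConv D (fun z => f z ^ 2) x :=
        lintegral_const_mul _ (measurable_posConv hD (hf.pow_const 2))
    _ ≤ (∫⁻ z, D z) * ((∫⁻ z, D z) * ∫⁻ z, f z ^ 2) := by
        gcongr
        exact lintegral_posConv_le hD (hf.pow_const 2)
    _ = _ := by ring

/-- Young's inequality `L² * L¹ ⊂ L²`, now splitting `f`; this is how `L¹` data enter the `L²`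
theory. -/
theorem lintegral_posConv_sq_le_sq_lintegral (hD : Measurable D) {f : Plane → ℝ≥0∞}
    (hf : Measurable f) :
    ∫⁻ x, posConv D f x ^ 2 ≤ (∫⁻ z, D z ^ 2) * (∫⁻ z, f z) ^ 2 := by
  have hsq : ∀ a : ℝ≥0∞, (a ^ (1 / 2 : ℝ)) ^ 2 = a := fun a => by
    rw [← ENNReal.rpow_two, ← ENNReal.rpow_mul]
    norm_num
  have hpt : ∀ x, posConv D f x ^ 2 ≤ (∫⁻ z, f z) * posConv (fun z => D z ^ 2) f x := fun x => by
    have h := sq_lintegral_mul_le (μ := volume) (f := fun z => f z ^ (1 / 2 : ℝ))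
      (g := fun z => D (x - z) * f z ^ (1 / 2 : ℝ)) (by fun_prop) (by fun_prop)
    simp only [mul_pow, hsq] at h
    refine le_trans (le_of_eq ?_) h
    rw [posConv]
    congr 1
    refine lintegral_congr fun z => ?_
    rw [mul_left_comm, ← pow_two, hsq]
  calc ∫⁻ x, posConv D f x ^ 2 ≤ ∫⁻ x, (∫⁻ z, f z) * posConv (fun z => D z ^ 2) f x :=
        lintegral_mono hpt
    _ = (∫⁻ z, f z) * ∫⁻ x, posConv (fun z => D z ^ 2) f x :=
        lintegral_const_mul _ (measurable_posConv (hD.pow_const 2) hf)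
    _ ≤ (∫⁻ z, f z) * ((∫⁻ z, D z ^ 2) * ∫⁻ z, f z) := by
        gcongr
        exact lintegral_posConv_le (hD.pow_const 2) hf
    _ = _ := by ring

/-- Moving the weight from `x` to `z` costs `e ^ (2 |x - z|)`, which the dominating kernel absorbs.
Every weighted estimate thus becomes an unweighted one for `D`, uniformly in the centre `y` and in
`ε ≤ 1`. -/
theorem IsGoodKernel.weight_mul_enorm_convL1_le (hk : IsGoodKernel V k D) {ε : ℝ} (hε : 0 ≤ ε)
    (hε1 : ε ≤ 1) (y : Plane) (f : L1) :
    ∀ᵐ x, expWeight ε y x * ‖convL1 k hk.integrable hk.measurable f x‖ₑ ≤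
      posConv D (fun z => expWeight ε y z * ‖f z‖ₑ) x := by
  have hkm := hk.measurable
  have hfm := measurable_L1 f
  filter_upwards [convL1_enorm_ae_le hk.integrable hk.measurable f] with x hx
  calc _ ≤ expWeight ε y x * ∫⁻ z, ‖k (x - z)‖ₑ * ‖f z‖ₑ := by gcongr
    _ = ∫⁻ z, expWeight ε y x * (‖k (x - z)‖ₑ * ‖f z‖ₑ) := by
        rw [lintegral_const_mul]
        exact (hkm.comp (by fun_prop : Measurable fun z => x - z)).enorm.mul hfm.enorm
    _ ≤ ∫⁻ z, D (x - z) * (expWeight ε y z * ‖f z‖ₑ) := by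
        refine lintegral_mono fun z => ?_
        calc _ ≤ (ENNReal.ofReal (Real.exp (2 * ‖x - z‖)) * expWeight ε y z) *
              (‖k (x - z)‖ₑ * ‖f z‖ₑ) := by gcongr; exact expWeight_le hε hε1 y x z
          _ = (ENNReal.ofReal (Real.exp (2 * ‖x - z‖)) * ‖k (x - z)‖ₑ) *
              (expWeight ε y z * ‖f z‖ₑ) := by ring
          _ ≤ _ := by gcongr; exact hk.weight_le _

/-- A function dominated by a constant plus its image under the contraction
`f ↦ D * (|V| f)` is bounded. -/
theorem IsGoodKernel.ae_le_of_le_add (hk : IsGoodKernel V k D) (hV : Measurable V)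
    {U : Plane → ℝ≥0∞} (hU : Measurable U) (hVU : ∫⁻ x, ‖V x‖ₑ * U x ≠ ∞) {m : ℝ≥0∞}
    (h : ∀ᵐ x, U x ≤ m + posConv D (fun z => ‖V z‖ₑ * U z) x) : ∀ᵐ x, U x ≤ 2 * m := by
  have hD := hk.measurable_dom
  rcases eq_or_ne m ∞ with rfl | hm
  · exact Filter.Eventually.of_forall fun x => by simp
  -- The excess over `2 m`. As `D * |V| ≤ 1 / 2`, the constant part `2 m` contributes at most `m` to
  -- the convolution, so the excess satisfies the homogeneous inequality `E ≤ D * (|V| E)`.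
  set E : Plane → ℝ≥0∞ := fun x => U x - 2 * m with hE
  have hEm : Measurable E := hU.sub_const _
  have hVE : ∫⁻ x, ‖V x‖ₑ * E x ≠ ∞ :=
    ne_top_of_le_ne_top hVU (lintegral_mono fun x => by gcongr; exact tsub_le_self)
  have hsmall : ∀ x, posConv D (fun z => ‖V z‖ₑ) x ≤ 1 / 2 := fun x => by
    refine le_trans (le_of_eq (lintegral_congr fun z => ?_)) (hk.small x)
    rw [hk.dom_sub_comm, mul_comm]
  have hEle : ∀ᵐ x, E x ≤ posConv D (fun z => ‖V z‖ₑ * E z) x := by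
    filter_upwards [h] with x hx
    rw [hE, tsub_le_iff_left]
    refine hx.trans ?_
    have h1 : posConv D (fun z => ‖V z‖ₑ * U z) x ≤
        posConv D (fun z => ‖V z‖ₑ) x * (2 * m) + posConv D (fun z => ‖V z‖ₑ * E z) x := by
      unfold posConv
      rw [← lintegral_mul_const _ (by fun_prop), ← lintegral_add_left (by fun_prop)]
      refine lintegral_mono fun z => ?_
      calc D (x - z) * (‖V z‖ₑ * U z) ≤ D (x - z) * (‖V z‖ₑ * (2 * m + E z)) := by
            gcongr; exact le_add_tsub
        _ = _ := by ring
    have h2 : posConv D (fun z => ‖V z‖ₑ) x * (2 * m) ≤ m := by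
      calc _ ≤ (1 / 2 : ℝ≥0∞) * (2 * m) := by gcongr; exact hsmall x
        _ = m := by
          rw [← mul_assoc, one_div, ENNReal.inv_mul_cancel two_ne_zero ENNReal.ofNat_ne_top,
            one_mul]
    calc m + posConv D (fun z => ‖V z‖ₑ * U z) x
        ≤ m + (m + posConv D (fun z => ‖V z‖ₑ * E z) x) := by
          gcongr; exact h1.trans (by gcongr)
      _ = _ := by ring
  -- Integrating against `|V|` is a contraction by `1 / 2`; being finite, the integral vanishes, and
  -- then so does `E` almost everywhere.
  have hhalf : ∫⁻ x, ‖V x‖ₑ * E x ≤ 1 / 2 * ∫⁻ x, ‖V x‖ₑ * E x := by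
    refine le_trans (lintegral_mono_ae ?_) (lintegral_mul_lintegral_sub_le
      (W := fun x => ‖V x‖ₑ) (k := D) (F := fun x => ‖V x‖ₑ * E x) hV.enorm hD
      (hV.enorm.mul hEm) hk.small)
    filter_upwards [hEle] with x hx
    gcongr
    exact hx
  have hzero : ∫⁻ x, ‖V x‖ₑ * E x = 0 := by
    by_contra h0
    have : (1 / 2 : ℝ≥0∞) * ∫⁻ x, ‖V x‖ₑ * E x < ∫⁻ x, ‖V x‖ₑ * E x := by
      rw [one_div, mul_comm, ← div_eq_mul_inv]
      exact ENNReal.half_lt_self h0 hVE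
    exact absurd hhalf (not_le.2 this)
  rw [lintegral_eq_zero_iff (by fun_prop)] at hzero
  filter_upwards [hEle] with x hx
  have h0 : posConv D (fun z => ‖V z‖ₑ * E z) x = 0 := by
    rw [posConv, lintegral_eq_zero_iff (by fun_prop)]
    filter_upwards [hzero] with z hz
    simp only [Pi.zero_apply] at hz ⊢
    rw [hz, mul_zero]
  rw [h0, nonpos_iff_eq_zero, hE] at hx
  exact tsub_eq_zero_iff_le.1 hx

end Weighted

end SchrodingerL1

end

noncomputable section

namespace SchrodingerL1

/-! ### The weighted `L²` estimate -/

section WeightedL2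

/-- The square of the weighted `L²` norm with the exponential weight centred at `y`. -/
def wSq (ε : ℝ) (y : Plane) (f : L1) : ℝ≥0∞ := ∫⁻ x, (expWeight ε y x * ‖f x‖ₑ) ^ 2

/-- The weighted `L²` norm with the additional weight `|ζ - V|`. -/
def wForm (V : Plane → ℝ) (ζ : ℂ) (ε : ℝ) (y : Plane) (f : L1) : ℝ≥0∞ :=
  ∫⁻ x, ‖ζ - V x‖ₑ * (expWeight ε y x * ‖f x‖ₑ) ^ 2

theorem measurable_weight_mul (ε : ℝ) (y : Plane) (f : L1) :
    Measurable fun x => expWeight ε y x * ‖f x‖ₑ :=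
  (measurable_expWeight ε y).mul (measurable_L1 f).enorm

theorem measurable_enorm_sub {V : Plane → ℝ} (hV : Measurable V) (ζ : ℂ) :
    Measurable fun x => ‖ζ - V x‖ₑ :=
  (measurable_const.sub (Complex.measurable_ofReal.comp hV)).enorm

theorem le_rpow_half_of_sq_le {a b : ℝ≥0∞} (h : a ^ 2 ≤ b) : a ≤ b ^ (1 / 2 : ℝ) := by
  rw [one_div, ENNReal.le_rpow_inv_iff two_pos, ENNReal.rpow_two]
  exact h

theorem rpow_half_sq (a : ℝ≥0∞) : (a ^ (1 / 2 : ℝ)) ^ 2 = a := by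
  rw [← ENNReal.rpow_two, ← ENNReal.rpow_mul]
  norm_num

theorem ennreal_two_mul_le_add_sq (a b : ℝ≥0∞) : 2 * a * b ≤ a ^ 2 + b ^ 2 := by
  wlog h : a ≤ b generalizing a b
  · have := this b a (le_of_not_ge h)
    rw [add_comm]
    refine le_trans (le_of_eq ?_) this
    ring
  obtain ⟨c, rfl⟩ := exists_add_of_le h
  calc 2 * a * (a + c) ≤ 2 * a * (a + c) + c ^ 2 := le_self_add
    _ = _ := by ring

theorem add_sq_le_two_mul (a b : ℝ≥0∞) : (a + b) ^ 2 ≤ 2 * (a ^ 2 + b ^ 2) := by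
  have := ennreal_two_mul_le_add_sq a b
  calc (a + b) ^ 2 = a ^ 2 + b ^ 2 + 2 * a * b := by ring
    _ ≤ a ^ 2 + b ^ 2 + (a ^ 2 + b ^ 2) := by gcongr
    _ = _ := by ring

/-- Young's inequality with a crude constant: according to which of `b` and `e a` is larger, one of
the two terms suffices. -/
theorem mul_le_mul_sq_add {e : ℝ≥0∞} (he : e ≠ 0) (he' : e ≠ ∞) (a b : ℝ≥0∞) :
    a * b ≤ e * a ^ 2 + e⁻¹ * b ^ 2 := by
  rcases le_total b (e * a) with h | h
  · refine le_trans ?_ le_self_add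
    calc a * b ≤ a * (e * a) := by gcongr
      _ = _ := by ring
  · refine le_trans ?_ le_add_self
    have h' : a ≤ e⁻¹ * b := by
      rw [mul_comm, ← div_eq_mul_inv, ENNReal.le_div_iff_mul_le (Or.inl he) (Or.inl he'), mul_comm]
      exact h
    calc a * b ≤ (e⁻¹ * b) * b := by gcongr
      _ = _ := by ring

/-- The absorption step of the energy estimate; it requires `X` to be known finite beforehand. -/
theorem le_two_mul_of_le_half_add {X Y : ℝ≥0∞} (hX : X ≠ ∞) (h : X ≤ 1 / 2 * X + Y) :
    X ≤ 2 * Y := by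
  have h1 : X / 2 ≤ Y := by
    have h2 : X / 2 + X / 2 ≤ X / 2 + Y := by
      rw [ENNReal.add_halves]
      refine h.trans_eq ?_
      rw [one_div, mul_comm, ← div_eq_mul_inv]
    exact (ENNReal.add_le_add_iff_left (ENNReal.div_ne_top hX two_ne_zero)).1 h2
  rw [ENNReal.div_le_iff two_ne_zero ENNReal.ofNat_ne_top] at h1
  rwa [mul_comm]

variable {V : Plane → ℝ} {k : Plane → ℂ} {D : Plane → ℝ≥0∞}

theorem IsGoodKernel.wSq_convL1_le (hk : IsGoodKernel V k D) {ε : ℝ} (hε : 0 ≤ ε) (hε1 : ε ≤ 1)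
    (y : Plane) (f : L1) :
    wSq ε y (convL1 k hk.integrable hk.measurable f) ≤ (∫⁻ z, D z) ^ 2 * wSq ε y f := by
  refine le_trans (lintegral_mono_ae ?_)
    (hk.lintegral_posConv_sq_le (measurable_weight_mul ε y f))
  filter_upwards [hk.weight_mul_enorm_convL1_le hε hε1 y f] with x hx
  gcongr

theorem IsGoodKernel.wSq_convL1_le_sq_lintegral (hk : IsGoodKernel V k D) {ε : ℝ} (hε : 0 ≤ ε)
    (hε1 : ε ≤ 1) (y : Plane) (f : L1) :
    wSq ε y (convL1 k hk.integrable hk.measurable f) ≤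
      (∫⁻ z, D z ^ 2) * (∫⁻ z, expWeight ε y z * ‖f z‖ₑ) ^ 2 := by
  refine le_trans (lintegral_mono_ae ?_)
    (lintegral_posConv_sq_le_sq_lintegral hk.measurable_dom (measurable_weight_mul ε y f))
  filter_upwards [hk.weight_mul_enorm_convL1_le hε hε1 y f] with x hx
  gcongr

/-- Every image of an `L¹` function under the convolution has finite weighted `L²` norm, since the
dominating kernel is square integrable. This supplies the finiteness needed for absorption. -/
theorem IsGoodKernel.wSq_convL1_ne_top (hk : IsGoodKernel V k D) {ε : ℝ} (hε : 0 ≤ ε)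
    (hε1 : ε ≤ 1) (y : Plane) (f : L1) :
    wSq ε y (convL1 k hk.integrable hk.measurable f) ≠ ∞ := by
  have h1 := hk.wSq_convL1_le_sq_lintegral hε hε1 y f
  have h2 : ∫⁻ z, expWeight ε y z * ‖f z‖ₑ ≤ ‖f‖ₑ := by
    rw [enorm_L1_eq]
    refine lintegral_mono fun z => ?_
    calc _ ≤ 1 * ‖f z‖ₑ := by gcongr; exact expWeight_le_one hε y z
      _ = _ := one_mul _
  refine ne_top_of_le_ne_top ?_ h1
  exact ENNReal.mul_ne_top hk.lintegral_sq_ne_top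
    (ENNReal.pow_ne_top (ne_top_of_le_ne_top enorm_ne_top h2))

theorem wSq_add_le (ε : ℝ) (y : Plane) (f g : L1) :
    wSq ε y (f + g) ≤ 2 * (wSq ε y f + wSq ε y g) := by
  have hf := measurable_weight_mul ε y f
  have hg := measurable_weight_mul ε y g
  unfold wSq
  rw [← lintegral_add_left (by fun_prop), ← lintegral_const_mul _ (by fun_prop)]
  refine lintegral_mono_ae ?_
  filter_upwards [Lp.coeFn_add f g] with x hx
  refine le_trans ?_ (add_sq_le_two_mul _ _)
  rw [hx, ← mul_add]
  gcongr
  exact enorm_add_le _ _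

theorem IsGoodKernel.weight_mul_convL1_le_sup (hk : IsGoodKernel V k D) {ε : ℝ} (hε : 0 ≤ ε)
    (hε1 : ε ≤ 1) (y : Plane) (f : L1) :
    ∀ᵐ x, expWeight ε y x * ‖convL1 k hk.integrable hk.measurable f x‖ₑ ≤
      ((∫⁻ z, D z ^ 2) * wSq ε y f) ^ (1 / 2 : ℝ) := by
  filter_upwards [hk.weight_mul_enorm_convL1_le hε hε1 y f] with x hx
  exact hx.trans (le_rpow_half_of_sq_le (hk.posConv_sq_le (measurable_weight_mul ε y f) x))

section Equation

variable {ζ : ℂ} {u g v : L1}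

theorem enorm_v_le (hv : ∀ᵐ x, v x = (ζ - V x) * u x) :
    ∀ᵐ x, ‖v x‖ₑ ≤ ‖ζ‖ₑ * ‖u x‖ₑ + ‖V x‖ₑ * ‖u x‖ₑ := by
  filter_upwards [hv] with x hx
  rw [hx, enorm_mul, ← add_mul]
  gcongr
  refine (enorm_sub_le).trans_eq ?_
  rw [complex_enorm_ofReal]

theorem lintegral_potential_mul_ne_top (hv : ∀ᵐ x, v x = (ζ - V x) * u x) :
    ∫⁻ x, ‖V x‖ₑ * ‖u x‖ₑ ≠ ∞ := by
  have h : ∫⁻ x, ‖V x‖ₑ * ‖u x‖ₑ ≤ ‖ζ‖ₑ * ‖u‖ₑ + ‖v‖ₑ := by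
    rw [enorm_L1_eq, enorm_L1_eq, ← lintegral_const_mul _ (measurable_L1 u).enorm,
      ← lintegral_add_left ((measurable_L1 u).enorm.const_mul _)]
    refine lintegral_mono_ae ?_
    filter_upwards [hv] with x hx
    have e : (V x : ℂ) * u x = ζ * u x - v x := by rw [hx]; ring
    rw [← complex_enorm_ofReal, ← enorm_mul, e, ← enorm_mul]
    exact enorm_sub_le
  exact ne_top_of_le_ne_top (by simp [ENNReal.mul_eq_top]) h

/-- The weighted sup bound for solutions of the resolvent equation. -/
theorem IsGoodKernel.weight_mul_le_sup (hk : IsGoodKernel V k D) (hV : Measurable V) {ε : ℝ}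
    (hε : 0 ≤ ε) (hε1 : ε ≤ 1) (y : Plane) (hv : ∀ᵐ x, v x = (ζ - V x) * u x)
    (hu : u = convL1 k hk.integrable hk.measurable g + convL1 k hk.integrable hk.measurable v) :
    ∀ᵐ x, expWeight ε y x * ‖u x‖ₑ ≤ 2 * (((∫⁻ z, D z ^ 2) * wSq ε y g) ^ (1 / 2 : ℝ) +
      ‖ζ‖ₑ * ((∫⁻ z, D z ^ 2) * wSq ε y u) ^ (1 / 2 : ℝ)) := by
  have hD := hk.measurable_dom
  have hum := measurable_weight_mul ε y u
  refine hk.ae_le_of_le_add hV hum ?_ ?_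
  · refine ne_top_of_le_ne_top (lintegral_potential_mul_ne_top hv) (lintegral_mono fun x => ?_)
    calc ‖V x‖ₑ * (expWeight ε y x * ‖u x‖ₑ) ≤ ‖V x‖ₑ * (1 * ‖u x‖ₑ) := by
          gcongr; exact expWeight_le_one hε y x
      _ = _ := by rw [one_mul]
  · have hsum := Lp.coeFn_add (convL1 k hk.integrable hk.measurable g)
      (convL1 k hk.integrable hk.measurable v)
    rw [← hu] at hsum
    filter_upwards [hsum, hk.weight_mul_convL1_le_sup hε hε1 y g,
      hk.weight_mul_enorm_convL1_le hε hε1 y v] with x h1 h2 h3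
    -- In `|v| ≤ |ζ| |u| + |V| |u|` the first term is controlled by the weighted `L²` norm; the
    -- second is the contraction handled by `IsGoodKernel.ae_le_of_le_add`.
    have h4 : posConv D (fun z => expWeight ε y z * ‖v z‖ₑ) x ≤
        ‖ζ‖ₑ * posConv D (fun z => expWeight ε y z * ‖u z‖ₑ) x +
          posConv D (fun z => ‖V z‖ₑ * (expWeight ε y z * ‖u z‖ₑ)) x := by
      unfold posConv
      rw [← lintegral_const_mul _ (by fun_prop), ← lintegral_add_left (by fun_prop)]
      refine lintegral_mono_ae ?_
      filter_upwards [enorm_v_le hv] with z hz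
      calc _ ≤ D (x - z) * (expWeight ε y z * (‖ζ‖ₑ * ‖u z‖ₑ + ‖V z‖ₑ * ‖u z‖ₑ)) := by gcongr
        _ = _ := by ring
    have h5 : posConv D (fun z => expWeight ε y z * ‖u z‖ₑ) x ≤
        ((∫⁻ z, D z ^ 2) * wSq ε y u) ^ (1 / 2 : ℝ) :=
      le_rpow_half_of_sq_le (hk.posConv_sq_le hum x)
    calc expWeight ε y x * ‖u x‖ₑ
        ≤ expWeight ε y x * ‖convL1 k hk.integrable hk.measurable g x‖ₑ +
          expWeight ε y x * ‖convL1 k hk.integrable hk.measurable v x‖ₑ := by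
          rw [← mul_add, h1]
          gcongr
          exact enorm_add_le _ _
      _ ≤ ((∫⁻ z, D z ^ 2) * wSq ε y g) ^ (1 / 2 : ℝ) +
          (‖ζ‖ₑ * ((∫⁻ z, D z ^ 2) * wSq ε y u) ^ (1 / 2 : ℝ) +
            posConv D (fun z => ‖V z‖ₑ * (expWeight ε y z * ‖u z‖ₑ)) x) := by
          gcongr
          exact h3.trans (h4.trans (by gcongr))
      _ = _ := by rw [add_assoc]

end Equation

/-- A bound on the form `∫ |ζ - V| w² |f|²` for bounded `w f`. -/
theorem wForm_le {Vs : Plane → ℝ≥0∞} {L : ℝ≥0∞} (hVs : Measurable Vs)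
    (hVV : ∀ x, ‖V x‖ₑ ≤ L + Vs x)
    (ζ : ℂ) (ε : ℝ) (y : Plane) (f : L1) {m : ℝ≥0∞}
    (hm : ∀ᵐ x, expWeight ε y x * ‖f x‖ₑ ≤ m) :
    wForm V ζ ε y f ≤ (‖ζ‖ₑ + L) * wSq ε y f + (∫⁻ x, Vs x) * m ^ 2 := by
  have hfm := measurable_weight_mul ε y f
  unfold wForm wSq
  rw [← lintegral_const_mul _ (hfm.pow_const 2), ← lintegral_mul_const _ hVs,
    ← lintegral_add_left ((hfm.pow_const 2).const_mul _)]
  refine lintegral_mono_ae ?_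
  filter_upwards [hm] with x hx
  have h1 : ‖ζ - V x‖ₑ ≤ ‖ζ‖ₑ + L + Vs x := by
    refine (enorm_sub_le).trans ?_
    rw [complex_enorm_ofReal, add_assoc]
    gcongr
    exact hVV x
  calc _ ≤ (‖ζ‖ₑ + L + Vs x) * (expWeight ε y x * ‖f x‖ₑ) ^ 2 := by gcongr
    _ = (‖ζ‖ₑ + L) * (expWeight ε y x * ‖f x‖ₑ) ^ 2 + Vs x * (expWeight ε y x * ‖f x‖ₑ) ^ 2 := by
        ring
    _ ≤ _ := by gcongr

/-- The double integral in the commutator term is controlled by the form. -/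
theorem IsGoodKernel.lintegral_lintegral_le (hk : IsGoodKernel V k D) (hV : Measurable V)
    (ζ : ℂ) (ε : ℝ) (y : Plane) (u : L1) :
    ∫⁻ x, ∫⁻ z, D (x - z) * ((‖ζ - V x‖ₑ * (expWeight ε y x * ‖u x‖ₑ)) *
      (‖ζ - V z‖ₑ * (expWeight ε y z * ‖u z‖ₑ))) ≤
      (‖ζ‖ₑ * (∫⁻ z, D z) + 1 / 2) * wForm V ζ ε y u := by
  have hD := hk.measurable_dom
  have hU := measurable_weight_mul ε y u
  have hM := measurable_enorm_sub hV ζ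
  set U : Plane → ℝ≥0∞ := fun x => expWeight ε y x * ‖u x‖ₑ with hUdef
  set M : Plane → ℝ≥0∞ := fun x => ‖ζ - V x‖ₑ with hMdef
  have hsup : ∀ x, ∫⁻ z, D (x - z) * M z ≤ ‖ζ‖ₑ * (∫⁻ z, D z) + 1 / 2 := fun x => by
    have h1 := hk.small x
    have h2 := lintegral_comp_sub_left D hk.even_dom x
    calc ∫⁻ z, D (x - z) * M z ≤ ∫⁻ z, (‖ζ‖ₑ * D (x - z) + ‖V z‖ₑ * D (z - x)) := by
          refine lintegral_mono fun z => ?_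
          rw [hk.dom_sub_comm z x, ← add_mul, mul_comm]
          gcongr
          refine (enorm_sub_le).trans_eq ?_
          rw [complex_enorm_ofReal]
      _ = ‖ζ‖ₑ * (∫⁻ z, D z) + ∫⁻ z, ‖V z‖ₑ * D (z - x) := by
          rw [lintegral_add_left (by fun_prop), lintegral_const_mul _ (by fun_prop), h2]
      _ ≤ _ := by gcongr
  -- Schur test with respect to the measure `|ζ - V| dx`: the product `U x U z` is replaced by
  -- squares, which give equal integrals since `D` is even, and `hsup` bounds the remaining inner
  -- integral.
  set T := ∫⁻ x, ∫⁻ z, D (x - z) * (M x * M z * U x ^ 2) with hT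
  have hTle : T ≤ (‖ζ‖ₑ * (∫⁻ z, D z) + 1 / 2) * wForm V ζ ε y u := by
    calc T = ∫⁻ x, (M x * U x ^ 2) * ∫⁻ z, D (x - z) * M z := by
          refine lintegral_congr fun x => ?_
          rw [← lintegral_const_mul _ (by fun_prop)]
          exact lintegral_congr fun z => by ring
      _ ≤ ∫⁻ x, (M x * U x ^ 2) * (‖ζ‖ₑ * (∫⁻ z, D z) + 1 / 2) := by
          gcongr with x; exact hsup x
      _ = _ := by
          rw [lintegral_mul_const _ (by fun_prop), mul_comm]
          rfl
  have hT' : ∫⁻ x, ∫⁻ z, D (x - z) * (M x * M z * U z ^ 2) = T := by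
    rw [lintegral_lintegral_swap (Measurable.aemeasurable (by
      simp only [Function.uncurry_def]; fun_prop)), hT]
    refine lintegral_congr fun z => lintegral_congr fun x => ?_
    rw [hk.dom_sub_comm]
    ring
  have h2 : 2 * ∫⁻ x, ∫⁻ z, D (x - z) * ((M x * U x) * (M z * U z)) ≤ 2 * T := by
    have hmeas : Measurable fun p : Plane × Plane =>
        D (p.1 - p.2) * (M p.1 * M p.2 * U p.1 ^ 2) := by fun_prop
    have hmeas2 : Measurable fun p : Plane × Plane =>
        D (p.1 - p.2) * ((M p.1 * U p.1) * (M p.2 * U p.2)) := by fun_prop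
    calc 2 * ∫⁻ x, ∫⁻ z, D (x - z) * ((M x * U x) * (M z * U z))
        = ∫⁻ x, ∫⁻ z, 2 * (D (x - z) * ((M x * U x) * (M z * U z))) := by
          rw [← lintegral_const_mul _ hmeas2.lintegral_prod_right']
          refine lintegral_congr fun x => ?_
          rw [lintegral_const_mul _ (by fun_prop)]
      _ ≤ ∫⁻ x, ∫⁻ z, (D (x - z) * (M x * M z * U x ^ 2) +
            D (x - z) * (M x * M z * U z ^ 2)) := by
          gcongr with x z
          calc 2 * (D (x - z) * ((M x * U x) * (M z * U z)))
              = D (x - z) * (M x * M z) * (2 * U x * U z) := by ring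
            _ ≤ D (x - z) * (M x * M z) * (U x ^ 2 + U z ^ 2) := by
                gcongr; exact ennreal_two_mul_le_add_sq _ _
            _ = _ := by ring
      _ = T + T := by
          have : ∀ x, ∫⁻ z, (D (x - z) * (M x * M z * U x ^ 2) +
              D (x - z) * (M x * M z * U z ^ 2)) =
              (∫⁻ z, D (x - z) * (M x * M z * U x ^ 2)) +
              ∫⁻ z, D (x - z) * (M x * M z * U z ^ 2) := fun x =>
            lintegral_add_left (by fun_prop) _
          simp only [this]
          rw [lintegral_add_left hmeas.lintegral_prod_right', hT']
      _ = 2 * T := by ring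
  exact ((ENNReal.mul_le_mul_iff_right two_ne_zero ENNReal.ofNat_ne_top).1 h2).trans hTle

end WeightedL2

end SchrodingerL1

end

noncomputable section

namespace SchrodingerL1

/-! ### The energy identity and its commutator term. -/

section Energy

theorem exp_sub_exp_neg_le {d : ℝ} : Real.exp d - Real.exp (-d) ≤ 2 * d * Real.exp d := by
  have h1 : Real.exp (-d) = Real.exp d * Real.exp (-(2 * d)) := by
    rw [← Real.exp_add]; ring_nf
  have h2 : 1 - 2 * d ≤ Real.exp (-(2 * d)) := by
    have := Real.add_one_le_exp (-(2 * d))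
    linarith
  rw [h1]
  nlinarith [Real.exp_pos d]

/-- With `d = ε (|z - y| - |x - y|)` the difference of squares equals `2 sinh d` times the product
of the weights. After ordering the points, `0 ≤ d ≤ ε |x - z|`, which produces the small factor `ε`.
-/
theorem abs_exp_sq_sub_le {ε : ℝ} (hε : 0 ≤ ε) (hε1 : ε ≤ 1) (y x z : Plane) :
    |Real.exp (-ε * ‖x - y‖) ^ 2 - Real.exp (-ε * ‖z - y‖) ^ 2| ≤
      2 * ε * Real.exp (2 * ‖x - z‖) *
        (Real.exp (-ε * ‖x - y‖) * Real.exp (-ε * ‖z - y‖)) := by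
  wlog hxz : ‖x - y‖ ≤ ‖z - y‖ generalizing x z
  · have h := this z x (le_of_not_ge hxz)
    rw [abs_sub_comm, norm_sub_rev z x, mul_comm (Real.exp (-ε * ‖z - y‖))] at h
    exact h
  set a := ‖x - y‖
  set b := ‖z - y‖
  set r := ‖x - z‖
  have hr : 0 ≤ r := norm_nonneg _
  have hba : b ≤ r + a := by
    have h1 : ‖z - y‖ ≤ ‖z - x‖ + ‖x - y‖ := norm_sub_le_norm_sub_add_norm_sub z x y
    rwa [norm_sub_rev z x] at h1
  set d := ε * (b - a) with hd
  have hd0 : 0 ≤ d := mul_nonneg hε (by linarith)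
  have hdr : d ≤ ε * r := by
    rw [hd]
    exact mul_le_mul_of_nonneg_left (by linarith) hε
  have e : Real.exp (-ε * a) ^ 2 - Real.exp (-ε * b) ^ 2 =
      (Real.exp d - Real.exp (-d)) * (Real.exp (-ε * a) * Real.exp (-ε * b)) := by
    rw [sub_mul, ← Real.exp_add, ← Real.exp_add, ← Real.exp_add, ← Real.exp_nat_mul,
      ← Real.exp_nat_mul]
    congr 2 <;> push_cast <;> rw [hd] <;> ring
  have hpos : 0 ≤ Real.exp d - Real.exp (-d) := by
    rw [sub_nonneg, Real.exp_le_exp]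
    linarith
  rw [e, abs_of_nonneg (by positivity)]
  gcongr
  calc Real.exp d - Real.exp (-d) ≤ 2 * d * Real.exp d := exp_sub_exp_neg_le
    _ ≤ 2 * (ε * r) * Real.exp r := by
        gcongr
        nlinarith
    _ ≤ 2 * (ε * Real.exp r) * Real.exp r := by
        gcongr
        linarith [Real.add_one_le_exp r]
    _ = 2 * ε * Real.exp (2 * r) := by
        rw [two_mul r, Real.exp_add]
        ring

variable {V : Plane → ℝ} {k : Plane → ℂ} {D : Plane → ℝ≥0∞} {ζ : ℂ} {u g v : L1}

/-- The integrand of the quadratic form of the convolution with `k`. -/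
def pairIntegrand (k : Plane → ℂ) (ε : ℝ) (y : Plane) (v : L1) (p : Plane × Plane) : ℂ :=
  ((Real.exp (-ε * ‖p.1 - y‖) ^ 2 : ℝ) : ℂ) * (starRingEnd ℂ) (v p.1) * (k (p.1 - p.2) * v p.2)

theorem IsGoodKernel.integrable_pairIntegrand (hk : IsGoodKernel V k D) {ε : ℝ} (hε : 0 ≤ ε)
    (hε1 : ε ≤ 1) (y : Plane)
    (hfin : ∫⁻ x, ∫⁻ z, D (x - z) * ((expWeight ε y x * ‖v x‖ₑ) * (expWeight ε y z * ‖v z‖ₑ)) ≠ ∞) :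
    Integrable (pairIntegrand k ε y v) (volume.prod volume) := by
  have hkm := hk.measurable
  have hvm := measurable_L1 v
  have hmeas : Measurable (pairIntegrand k ε y v) := by
    unfold pairIntegrand
    have hconj : Measurable fun p : Plane × Plane => (starRingEnd ℂ) (v p.1) :=
      Complex.continuous_conj.measurable.comp (hvm.comp measurable_fst)
    fun_prop
  refine ⟨hmeas.aestronglyMeasurable, ?_⟩
  rw [hasFiniteIntegral_iff_enorm, lintegral_prod _ hmeas.enorm.aemeasurable]
  refine lt_of_le_of_lt (lintegral_mono fun x => lintegral_mono fun z => ?_) (lt_top_iff_ne_top.2 hfin)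
  have h1 : ‖pairIntegrand k ε y v (x, z)‖ₑ =
      expWeight ε y x * expWeight ε y x * ‖v x‖ₑ * (‖k (x - z)‖ₑ * ‖v z‖ₑ) := by
    rw [pairIntegrand, enorm_mul, enorm_mul, enorm_mul, complex_enorm_ofReal, pow_two, enorm_mul,
      Real.enorm_of_nonneg (Real.exp_pos _).le, RCLike.enorm_conj, expWeight]
  rw [h1]
  calc _ ≤ expWeight ε y x * (ENNReal.ofReal (Real.exp (2 * ‖x - z‖)) * expWeight ε y z) *
        ‖v x‖ₑ * (‖k (x - z)‖ₑ * ‖v z‖ₑ) := by gcongr; exact expWeight_le hε hε1 y x z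
    _ = (ENNReal.ofReal (Real.exp (2 * ‖x - z‖)) * ‖k (x - z)‖ₑ) *
        ((expWeight ε y x * ‖v x‖ₑ) * (expWeight ε y z * ‖v z‖ₑ)) := by ring
    _ ≤ _ := by gcongr; exact hk.weight_le _

/-- The imaginary part of the weighted quadratic form of a real even kernel is a commutator. -/
theorem IsGoodKernel.enorm_im_integral_le (hk : IsGoodKernel V k D) {ε : ℝ} (hε : 0 ≤ ε)
    (hε1 : ε ≤ 1) (y : Plane)
    (hfin : ∫⁻ x, ∫⁻ z, D (x - z) * ((expWeight ε y x * ‖v x‖ₑ) * (expWeight ε y z * ‖v z‖ₑ)) ≠ ∞) :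
    ‖(∫ p, pairIntegrand k ε y v p ∂(volume.prod volume)).im‖ₑ ≤ ENNReal.ofReal ε *
      ∫⁻ x, ∫⁻ z, D (x - z) * ((expWeight ε y x * ‖v x‖ₑ) * (expWeight ε y z * ‖v z‖ₑ)) := by
  have hkm := hk.measurable
  have hvm := measurable_L1 v
  have hDm := hk.measurable_dom
  have hwm := measurable_weight_mul ε y v
  have h_int := hk.integrable_pairIntegrand hε hε1 y hfin
  set J := ∫ p, pairIntegrand k ε y v p ∂(volume.prod volume) with hJ
  -- Conjugating and exchanging the variables leaves the real even kernel unchanged and only moves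
  -- `w²` from one point to the other, so `J - conj J` contains `w(x)² - w(z)²`.
  have hconj : (starRingEnd ℂ) J =
      ∫ p, (starRingEnd ℂ) (pairIntegrand k ε y v p.swap) ∂(volume.prod volume) := by
    rw [hJ, ← integral_conj, ← integral_prod_swap]
  have h_int' : Integrable (fun p => (starRingEnd ℂ) (pairIntegrand k ε y v p.swap))
      (volume.prod volume) :=
    RCLike.conjCLE.toContinuousLinearMap.integrable_comp h_int.swap
  have hdiff : J - (starRingEnd ℂ) J = ∫ p : Plane × Plane,
      (((Real.exp (-ε * ‖p.1 - y‖) ^ 2 - Real.exp (-ε * ‖p.2 - y‖) ^ 2 : ℝ) : ℂ) *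
        (starRingEnd ℂ) (v p.1) * (k (p.1 - p.2) * v p.2)) ∂(volume.prod volume) := by
    rw [hconj, hJ, ← integral_sub h_int h_int']
    refine integral_congr_ae (Filter.Eventually.of_forall fun p => ?_)
    have hkk : k (p.2 - p.1) = k (p.1 - p.2) := by rw [← hk.even, neg_sub]
    simp only [pairIntegrand, Prod.fst_swap, Prod.snd_swap, map_mul, Complex.conj_ofReal,
      Complex.conj_conj, hk.real, hkk]
    push_cast
    ring
  have hle : ‖J - (starRingEnd ℂ) J‖ₑ ≤ 2 * (ENNReal.ofReal ε *
      ∫⁻ x, ∫⁻ z, D (x - z) * ((expWeight ε y x * ‖v x‖ₑ) * (expWeight ε y z * ‖v z‖ₑ))) := by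
    have hm : Measurable fun p : Plane × Plane => D (p.1 - p.2) *
        ((expWeight ε y p.1 * ‖v p.1‖ₑ) * (expWeight ε y p.2 * ‖v p.2‖ₑ)) :=
      (hDm.comp (measurable_fst.sub measurable_snd)).mul
        ((hwm.comp measurable_fst).mul (hwm.comp measurable_snd))
    rw [hdiff, ← lintegral_prod (fun p : Plane × Plane => D (p.1 - p.2) *
        ((expWeight ε y p.1 * ‖v p.1‖ₑ) * (expWeight ε y p.2 * ‖v p.2‖ₑ))) hm.aemeasurable,
      ← mul_assoc, ← lintegral_const_mul _ hm]
    refine (enorm_integral_le_lintegral_enorm _).trans (lintegral_mono fun p => ?_)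
    rw [enorm_mul, enorm_mul, enorm_mul, complex_enorm_ofReal, RCLike.enorm_conj]
    have h1 : ‖Real.exp (-ε * ‖p.1 - y‖) ^ 2 - Real.exp (-ε * ‖p.2 - y‖) ^ 2‖ₑ ≤
        2 * ENNReal.ofReal ε * ENNReal.ofReal (Real.exp (2 * ‖p.1 - p.2‖)) *
          (expWeight ε y p.1 * expWeight ε y p.2) := by
      rw [Real.enorm_eq_ofReal_abs]
      refine (ENNReal.ofReal_le_ofReal (abs_exp_sq_sub_le hε hε1 y p.1 p.2)).trans_eq ?_
      rw [expWeight, expWeight, ENNReal.ofReal_mul (by positivity),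
        ENNReal.ofReal_mul (by positivity), ENNReal.ofReal_mul (by positivity),
        ENNReal.ofReal_mul (by positivity), ENNReal.ofReal_ofNat]
    calc _ ≤ 2 * ENNReal.ofReal ε * ENNReal.ofReal (Real.exp (2 * ‖p.1 - p.2‖)) *
          (expWeight ε y p.1 * expWeight ε y p.2) * ‖v p.1‖ₑ *
            (‖k (p.1 - p.2)‖ₑ * ‖v p.2‖ₑ) := by gcongr
      _ = 2 * ENNReal.ofReal ε * ((ENNReal.ofReal (Real.exp (2 * ‖p.1 - p.2‖)) *
          ‖k (p.1 - p.2)‖ₑ) * ((expWeight ε y p.1 * ‖v p.1‖ₑ) *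
            (expWeight ε y p.2 * ‖v p.2‖ₑ))) := by ring
      _ ≤ _ := by gcongr; exact hk.weight_le _
  have him : ‖J - (starRingEnd ℂ) J‖ₑ = 2 * ‖J.im‖ₑ := by
    rw [Complex.sub_conj, enorm_mul, complex_enorm_ofReal, enorm_mul]
    have h2 : ‖(2 : ℝ)‖ₑ = 2 := by
      rw [Real.enorm_of_nonneg (by norm_num)]; simp
    have hI : ‖Complex.I‖ₑ = 1 := by rw [← ofReal_norm, Complex.norm_I]; simp
    rw [h2, hI, mul_one]
  rw [him] at hle
  exact (ENNReal.mul_le_mul_iff_right two_ne_zero ENNReal.ofNat_ne_top).1 hle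

/-- The energy estimate obtained from the imaginary part of `∫ w² (conj v) u`. -/
theorem IsGoodKernel.abs_im_mul_wSq_le (hk : IsGoodKernel V k D) (hV : Measurable V) {ε : ℝ}
    (hε : 0 ≤ ε) (hε1 : ε ≤ 1) (y : Plane) (hv : ∀ᵐ x, v x = (ζ - V x) * u x)
    (hu : u = convL1 k hk.integrable hk.measurable g + convL1 k hk.integrable hk.measurable v)
    (hX : wSq ε y u ≠ ∞) (hQ : wForm V ζ ε y u ≠ ∞)
    (hQF : wForm V ζ ε y (convL1 k hk.integrable hk.measurable g) ≠ ∞) :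
    ENNReal.ofReal |ζ.im| * wSq ε y u ≤
      (∫⁻ x, ‖ζ - V x‖ₑ * ((expWeight ε y x * ‖u x‖ₑ) *
        (expWeight ε y x * ‖convL1 k hk.integrable hk.measurable g x‖ₑ))) +
      ENNReal.ofReal ε * ((‖ζ‖ₑ * (∫⁻ z, D z) + 1 / 2) * wForm V ζ ε y u) := by
  set F := convL1 k hk.integrable hk.measurable g with hF
  set W := convL1 k hk.integrable hk.measurable v with hW
  have hum := measurable_L1 u
  have hvm := measurable_L1 v
  have hFm := measurable_L1 F
  have hwu := measurable_weight_mul ε y u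
  have hwF := measurable_weight_mul ε y F
  have hM := measurable_enorm_sub hV ζ
  set w : Plane → ℝ := fun x => Real.exp (-ε * ‖x - y‖) with hw
  have hwm : Measurable w := by fun_prop
  have hconjm : Measurable fun x => (starRingEnd ℂ) (v x) :=
    Complex.continuous_conj.measurable.comp hvm
  have hvU : ∀ᵐ x, expWeight ε y x * ‖v x‖ₑ = ‖ζ - V x‖ₑ * (expWeight ε y x * ‖u x‖ₑ) := by
    filter_upwards [hv] with x hx
    rw [hx, enorm_mul]
    ring
  have hKeq : ∫⁻ x, ∫⁻ z, D (x - z) *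
      ((expWeight ε y x * ‖v x‖ₑ) * (expWeight ε y z * ‖v z‖ₑ)) =
      ∫⁻ x, ∫⁻ z, D (x - z) * ((‖ζ - V x‖ₑ * (expWeight ε y x * ‖u x‖ₑ)) *
        (‖ζ - V z‖ₑ * (expWeight ε y z * ‖u z‖ₑ))) := by
    refine lintegral_congr_ae ?_
    filter_upwards [hvU] with x hx
    refine lintegral_congr_ae ?_
    filter_upwards [hvU] with z hz
    rw [hx, hz]
  have hKle := hk.lintegral_lintegral_le hV ζ ε y u
  rw [← hKeq] at hKle
  have hKfin : ∫⁻ x, ∫⁻ z, D (x - z) *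
      ((expWeight ε y x * ‖v x‖ₑ) * (expWeight ε y z * ‖v z‖ₑ)) ≠ ∞ := by
    refine ne_top_of_le_ne_top (ENNReal.mul_ne_top (ENNReal.add_ne_top.2
      ⟨ENNReal.mul_ne_top enorm_ne_top hk.lintegral_ne_top, by simp⟩) hQ) hKle
  have hen : ∀ f : Plane → ℂ, ∀ x, ‖((w x ^ 2 : ℝ) : ℂ) * (starRingEnd ℂ) (v x) * f x‖ₑ =
      (expWeight ε y x * ‖v x‖ₑ) * (expWeight ε y x * ‖f x‖ₑ) := fun f x => by
    rw [enorm_mul, enorm_mul, complex_enorm_ofReal, pow_two, enorm_mul,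
      Real.enorm_of_nonneg (Real.exp_pos _).le, RCLike.enorm_conj, expWeight]
    ring
  have hi1 : Integrable fun x => ((w x ^ 2 : ℝ) : ℂ) * (starRingEnd ℂ) (v x) * u x := by
    refine ⟨(((Complex.measurable_ofReal.comp (hwm.pow_const 2)).mul hconjm).mul
      hum).aestronglyMeasurable, ?_⟩
    rw [hasFiniteIntegral_iff_enorm]
    refine lt_of_le_of_lt (lintegral_mono_ae ?_) (lt_top_iff_ne_top.2 hQ)
    filter_upwards [hvU] with x hx
    rw [hen, hx]
    exact le_of_eq (by ring)
  have hcross : ∫⁻ x, ‖((w x ^ 2 : ℝ) : ℂ) * (starRingEnd ℂ) (v x) * F x‖ₑ =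
      ∫⁻ x, ‖ζ - V x‖ₑ * ((expWeight ε y x * ‖u x‖ₑ) * (expWeight ε y x * ‖F x‖ₑ)) := by
    refine lintegral_congr_ae ?_
    filter_upwards [hvU] with x hx
    rw [hen, hx]
    ring
  have hiF : Integrable fun x => ((w x ^ 2 : ℝ) : ℂ) * (starRingEnd ℂ) (v x) * F x := by
    refine ⟨(((Complex.measurable_ofReal.comp (hwm.pow_const 2)).mul hconjm).mul
      hFm).aestronglyMeasurable, ?_⟩
    rw [hasFiniteIntegral_iff_enorm, hcross]
    refine lt_of_le_of_lt (b := wForm V ζ ε y u + wForm V ζ ε y F) ?_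
      (ENNReal.add_lt_top.2 ⟨lt_top_iff_ne_top.2 hQ, lt_top_iff_ne_top.2 hQF⟩)
    unfold wForm
    rw [← lintegral_add_left (by fun_prop)]
    refine lintegral_mono fun x => ?_
    rw [← mul_add]
    gcongr
    have := mul_le_mul_sq_add one_ne_zero ENNReal.one_ne_top (expWeight ε y x * ‖u x‖ₑ)
      (expWeight ε y x * ‖F x‖ₑ)
    simpa using this
  have hsum : ∀ᵐ x, u x = F x + W x := by
    have h := Lp.coeFn_add F W
    rw [← hu] at h
    exact h
  have hJ : ∫ x, ((w x ^ 2 : ℝ) : ℂ) * (starRingEnd ℂ) (v x) * W x =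
      ∫ p, pairIntegrand k ε y v p ∂(volume.prod volume) := by
    rw [integral_prod _ (hk.integrable_pairIntegrand hε hε1 y hKfin)]
    refine integral_congr_ae ?_
    filter_upwards [convL1_ae hk.integrable hk.measurable v] with x hx
    rw [hW, hx]
    simp only [pairIntegrand]
    rw [← integral_const_mul]
  have hsplit : ∫ x, ((w x ^ 2 : ℝ) : ℂ) * (starRingEnd ℂ) (v x) * u x =
      (∫ x, ((w x ^ 2 : ℝ) : ℂ) * (starRingEnd ℂ) (v x) * F x) +
        ∫ p, pairIntegrand k ε y v p ∂(volume.prod volume) := by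
    rw [← hJ, ← sub_eq_iff_eq_add', ← integral_sub hi1 hiF]
    refine integral_congr_ae ?_
    filter_upwards [hsum] with x hx
    rw [hx]
    ring
  have hXint : Integrable fun x => (w x * ‖u x‖) ^ 2 := by
    refine ⟨((hwm.mul hum.norm).pow_const 2).aestronglyMeasurable, ?_⟩
    rw [hasFiniteIntegral_iff_enorm]
    refine lt_of_le_of_lt (le_of_eq (lintegral_congr fun x => ?_)) (lt_top_iff_ne_top.2 hX)
    rw [enorm_pow, enorm_mul, Real.enorm_of_nonneg (Real.exp_pos _).le, enorm_norm, expWeight]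
  have hXeq : ENNReal.ofReal (∫ x, (w x * ‖u x‖) ^ 2) = wSq ε y u := by
    rw [ofReal_integral_eq_lintegral_ofReal hXint (Filter.Eventually.of_forall fun x =>
      sq_nonneg _)]
    refine lintegral_congr fun x => ?_
    rw [ENNReal.ofReal_pow (by positivity), ENNReal.ofReal_mul (Real.exp_pos _).le, ofReal_norm,
      expWeight]
  -- Pointwise `(conj v) u = (conj ζ - V) |u|²`; because `V` is real it drops out of the imaginary
  -- part, however singular it is.
  have him : (∫ x, ((w x ^ 2 : ℝ) : ℂ) * (starRingEnd ℂ) (v x) * u x).im =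
      -ζ.im * ∫ x, (w x * ‖u x‖) ^ 2 := by
    have h := integral_im hi1
    simp only [RCLike.im_to_complex] at h
    rw [← h, ← integral_const_mul]
    refine integral_congr_ae ?_
    filter_upwards [hv] with x hx
    have e : ((w x ^ 2 : ℝ) : ℂ) * (starRingEnd ℂ) (v x) * u x =
        (((w x * ‖u x‖) ^ 2 : ℝ) : ℂ) * ((starRingEnd ℂ) ζ - V x) := by
      rw [hx, map_mul, map_sub, Complex.conj_ofReal]
      have : (starRingEnd ℂ) (u x) * u x = ((‖u x‖ ^ 2 : ℝ) : ℂ) := by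
        rw [mul_comm, Complex.mul_conj, Complex.normSq_eq_norm_sq]
      rw [mul_pow, Complex.ofReal_mul, ← this]
      ring
    rw [e, Complex.im_ofReal_mul]
    simp
    ring
  have hfinal : ENNReal.ofReal |ζ.im| * wSq ε y u =
      ‖(∫ x, ((w x ^ 2 : ℝ) : ℂ) * (starRingEnd ℂ) (v x) * u x).im‖ₑ := by
    rw [him, ← hXeq, enorm_mul, enorm_neg, Real.enorm_eq_ofReal_abs ζ.im,
      Real.enorm_of_nonneg (integral_nonneg fun x => sq_nonneg _)]
  rw [hfinal, hsplit, Complex.add_im]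
  refine (enorm_add_le _ _).trans ?_
  gcongr ?_ + ?_
  · rw [← hcross]
    refine le_trans ?_ (enorm_integral_le_lintegral_enorm _)
    rw [← ofReal_norm, ← ofReal_norm]
    exact ENNReal.ofReal_le_ofReal (Complex.abs_im_le_norm _)
  · exact (hk.enorm_im_integral_le hε hε1 y hKfin).trans (by gcongr)

end Energy

end SchrodingerL1

end

noncomputable section

namespace SchrodingerL1

/-! ### From weighted `L²` bounds to the a priori `L¹` bound. -/

section WeightedResolvent

/-- A potential in `L^q`, `q > 1`, is the sum of a bounded and an integrable function. -/
theorem exists_enorm_le_add {q : ℝ≥0∞} (hq : 1 < q) {V : Plane → ℝ} (hV : Measurable V)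
    (hVq : MemLp V q) : ∃ (L : ℝ≥0∞) (Vs : Plane → ℝ≥0∞), L ≠ ∞ ∧ Measurable Vs ∧
      (∀ x, ‖V x‖ₑ ≤ L + Vs x) ∧ ∫⁻ x, Vs x ≠ ∞ := by
  rcases eq_or_ne q ∞ with rfl | hq'
  · refine ⟨eLpNorm V ∞ volume, fun x => ‖V x‖ₑ - eLpNorm V ∞ volume, hVq.2.ne,
      hV.enorm.sub_const _, fun x => le_add_tsub, ?_⟩
    have h0 : ∫⁻ x, (‖V x‖ₑ - eLpNorm V ∞ volume) = 0 := by
      rw [lintegral_eq_zero_iff (hV.enorm.sub_const _)]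
      filter_upwards [ae_le_eLpNormEssSup (f := V) (μ := volume)] with x hx
      rw [eLpNorm_exponent_top]
      exact tsub_eq_zero_of_le hx
    rw [h0]
    exact ENNReal.zero_ne_top
  · refine ⟨1, fun x => ‖V x‖ₑ - 1, ENNReal.one_ne_top, hV.enorm.sub_const _,
      fun x => le_add_tsub, ?_⟩
    have hfin := lintegral_rpow_enorm_lt_top_of_eLpNorm_lt_top (zero_lt_one.trans hq).ne' hq' hVq.2
    -- Where `|V| > 1` one has `|V| ≤ |V| ^ q`, so the part above height `1` is integrable.
    refine ne_top_of_le_ne_top hfin.ne (lintegral_mono fun x => ?_)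
    rcases le_total ‖V x‖ₑ 1 with h | h
    · rw [tsub_eq_zero_of_le h]
      exact zero_le
    · refine tsub_le_self.trans ?_
      have hq1 : 1 ≤ q.toReal := by
        rw [← ENNReal.toReal_one]
        exact ENNReal.toReal_mono hq' hq.le
      calc ‖V x‖ₑ = ‖V x‖ₑ ^ (1 : ℝ) := (ENNReal.rpow_one _).symm
        _ ≤ _ := ENNReal.rpow_le_rpow_of_exponent_le h hq1

theorem exists_ofReal_mul_le_half {K : ℝ≥0∞} (hK : K ≠ ∞) :
    ∃ ε : ℝ, 0 < ε ∧ ε ≤ 1 ∧ ENNReal.ofReal ε * K ≤ 1 / 2 := by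
  have hK0 : 0 ≤ K.toReal := ENNReal.toReal_nonneg
  refine ⟨1 / (2 * (K.toReal + 1)), by positivity, ?_, ?_⟩
  · rw [div_le_one (by positivity)]
    linarith
  · rw [← ENNReal.ofReal_toReal hK, ← ENNReal.ofReal_mul (by positivity)]
    have h2 : (1 / 2 : ℝ≥0∞) = ENNReal.ofReal (1 / 2) := by
      rw [ENNReal.ofReal_div_of_pos two_pos]; simp
    rw [h2]
    refine ENNReal.ofReal_le_ofReal ?_
    rw [ENNReal.toReal_ofReal hK0, div_mul_eq_mul_div, one_mul,
      div_le_div_iff₀ (by positivity) two_pos]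
    linarith

variable {V : Plane → ℝ} {k : Plane → ℂ} {D : Plane → ℝ≥0∞}

/-- The weighted `L²` estimate for the resolvent equation off the real axis, with weights
`exp (-ε |x - y|)`, uniformly in `y`. -/
theorem IsGoodKernel.exists_wSq_le (hk : IsGoodKernel V k D) (hV : Measurable V)
    {L : ℝ≥0∞} {Vs : Plane → ℝ≥0∞} (hL : L ≠ ∞) (hVs : Measurable Vs)
    (hVV : ∀ x, ‖V x‖ₑ ≤ L + Vs x) (hVsi : ∫⁻ x, Vs x ≠ ∞) {Z : ℝ≥0∞} (hZ : Z ≠ ∞) :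
    ∃ ε : ℝ, 0 < ε ∧ ε ≤ 1 ∧ ∃ B : ℝ≥0∞, B ≠ ∞ ∧ ∀ (ζ : ℂ) (u g v : L1), ‖ζ‖ₑ ≤ Z →
      1 ≤ |ζ.im| → (∀ᵐ x, v x = (ζ - V x) * u x) →
      u = convL1 k hk.integrable hk.measurable g + convL1 k hk.integrable hk.measurable v →
      ∀ y, wSq ε y g ≠ ∞ → wSq ε y u ≤ B * wSq ε y g := by
  have hD1 := hk.lintegral_ne_top
  have hD2 := hk.lintegral_sq_ne_top
  set D1 := ∫⁻ z, D z
  set D2 := ∫⁻ z, D z ^ 2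
  set v1 := ∫⁻ x, Vs x
  have h8 : (8 : ℝ≥0∞) ≠ ∞ := ENNReal.ofNat_ne_top
  have hhalf : (1 / 2 : ℝ≥0∞) ≠ ∞ := by simp
  set B1 : ℝ≥0∞ := (Z + L) + 8 * v1 * D2 * Z ^ 2 with hB1
  set B2 : ℝ≥0∞ := 8 * v1 * D2 with hB2
  set B3 : ℝ≥0∞ := (Z + L) * D1 ^ 2 + v1 * D2 with hB3
  set C1 : ℝ≥0∞ := Z * D1 + 1 / 2 with hC1
  have hB2' : B2 ≠ ∞ := by finiteness
  have hB1' : B1 ≠ ∞ := by finiteness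
  have hB3' : B3 ≠ ∞ := by finiteness
  have hC1' : C1 ≠ ∞ := by finiteness
  -- The constants `B1` and `C1` do not involve `ε`, so it can be chosen last to make the total
  -- coefficient of `X` at most `1 / 2`.
  obtain ⟨ε, hε0, hε1, hεK⟩ := exists_ofReal_mul_le_half (K := (1 + C1) * B1) (by finiteness)
  set e := ENNReal.ofReal ε with he
  have he0 : e ≠ 0 := (ENNReal.ofReal_pos.2 hε0).ne'
  have het : e ≠ ∞ := ENNReal.ofReal_ne_top
  refine ⟨ε, hε0, hε1, 2 * (e * (1 + C1) * B2 + e⁻¹ * B3), ?_, ?_⟩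
  · have : e⁻¹ ≠ ∞ := ENNReal.inv_ne_top.2 he0
    finiteness
  intro ζ u g v hζ him hv hu y hG
  set F := convL1 k hk.integrable hk.measurable g with hF
  set X := wSq ε y u with hXdef
  set G := wSq ε y g with hGdef
  have hX : X ≠ ∞ := by
    refine ne_top_of_le_ne_top ?_ (hXdef.le.trans ((congrArg (wSq ε y) hu).le.trans
      (wSq_add_le ε y _ _)))
    have h1 := hk.wSq_convL1_ne_top hε0.le hε1 y g
    have h2 := hk.wSq_convL1_ne_top hε0.le hε1 y v
    finiteness
  -- The form is controlled by splitting `V`: the bounded part uses the weighted `L²` norm, the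
  -- integrable part the weighted sup bound, itself of order `√G + |ζ| √X`.
  have hQ : wForm V ζ ε y u ≤ B1 * X + B2 * G := by
    refine (wForm_le hVs hVV ζ ε y u (hk.weight_mul_le_sup hV hε0.le hε1 y hv hu)).trans ?_
    have hm : (2 * ((D2 * G) ^ (1 / 2 : ℝ) + ‖ζ‖ₑ * (D2 * X) ^ (1 / 2 : ℝ))) ^ 2 ≤
        8 * (D2 * G + Z ^ 2 * (D2 * X)) := by
      calc _ = 4 * ((D2 * G) ^ (1 / 2 : ℝ) + ‖ζ‖ₑ * (D2 * X) ^ (1 / 2 : ℝ)) ^ 2 := by ring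
        _ ≤ 4 * (2 * (((D2 * G) ^ (1 / 2 : ℝ)) ^ 2 + (‖ζ‖ₑ * (D2 * X) ^ (1 / 2 : ℝ)) ^ 2)) := by
            gcongr; exact add_sq_le_two_mul _ _
        _ = 8 * (D2 * G + ‖ζ‖ₑ ^ 2 * (D2 * X)) := by
            rw [mul_pow, rpow_half_sq, rpow_half_sq]; ring
        _ ≤ _ := by gcongr
    calc _ ≤ (Z + L) * X + v1 * (8 * (D2 * G + Z ^ 2 * (D2 * X))) := by gcongr
      _ = _ := by rw [hB1, hB2]; ring
  have hQF : wForm V ζ ε y F ≤ B3 * G := by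
    refine (wForm_le hVs hVV ζ ε y F (hk.weight_mul_convL1_le_sup hε0.le hε1 y g)).trans ?_
    rw [rpow_half_sq]
    calc _ ≤ (Z + L) * (D1 ^ 2 * G) + v1 * (D2 * G) := by
          gcongr; exact hk.wSq_convL1_le hε0.le hε1 y g
      _ = _ := by rw [hB3]; ring
  have hen := hk.abs_im_mul_wSq_le hV hε0.le hε1 y hv hu hX
    (ne_top_of_le_ne_top (by finiteness) hQ) (ne_top_of_le_ne_top (by finiteness) hQF)
  have hcross : ∫⁻ x, ‖ζ - V x‖ₑ * ((expWeight ε y x * ‖u x‖ₑ) * (expWeight ε y x * ‖F x‖ₑ)) ≤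
      e * wForm V ζ ε y u + e⁻¹ * wForm V ζ ε y F := by
    have hM := measurable_enorm_sub hV ζ
    have hwu := measurable_weight_mul ε y u
    have hwF := measurable_weight_mul ε y F
    unfold wForm
    rw [← lintegral_const_mul _ (by fun_prop), ← lintegral_const_mul _ (by fun_prop),
      ← lintegral_add_left (by fun_prop)]
    refine lintegral_mono fun x => ?_
    calc _ ≤ ‖ζ - V x‖ₑ * (e * (expWeight ε y x * ‖u x‖ₑ) ^ 2 +
          e⁻¹ * (expWeight ε y x * ‖F x‖ₑ) ^ 2) := by
          gcongr; exact mul_le_mul_sq_add he0 het _ _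
      _ = _ := by ring
  rw [mul_assoc]
  refine le_two_mul_of_le_half_add hX ?_
  calc X = 1 * X := (one_mul X).symm
    _ ≤ ENNReal.ofReal |ζ.im| * X := by
        gcongr
        rwa [ENNReal.one_le_ofReal]
    _ ≤ _ := hen
    _ ≤ (e * wForm V ζ ε y u + e⁻¹ * wForm V ζ ε y F) + e * (C1 * wForm V ζ ε y u) := by
        rw [hC1]
        gcongr
    _ ≤ (e * (B1 * X + B2 * G) + e⁻¹ * (B3 * G)) + e * (C1 * (B1 * X + B2 * G)) := by gcongr
    _ = e * ((1 + C1) * B1) * X + (e * (1 + C1) * B2 + e⁻¹ * B3) * G := by ring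
    _ ≤ _ := by gcongr

/-- The exponential is compared with `(1 + |x|) ^ (-3)`, integrable in the plane. The range up to
`2` lets the same lemma serve the squared weight, whose rate is `2 ε`. -/
theorem lintegral_expWeight_ne_top {ε : ℝ} (hε : 0 < ε) (hε2 : ε ≤ 2) :
    ∫⁻ x, expWeight ε 0 x ≠ ∞ := by
  have hfin : ∫⁻ x : Plane, ENNReal.ofReal ((1 + ‖x‖) ^ (-3 : ℝ)) < ∞ :=
    finite_integral_one_add_norm (by simp; norm_num)
  have hle : ∀ x : Plane, expWeight ε 0 x ≤
      ENNReal.ofReal ((3 / ε) ^ 3) * ENNReal.ofReal ((1 + ‖x‖) ^ (-3 : ℝ)) := fun x => by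
    rw [expWeight, sub_zero, ← ENNReal.ofReal_mul (by positivity)]
    refine ENNReal.ofReal_le_ofReal ?_
    have hr := norm_nonneg x
    rw [Real.rpow_neg (by positivity), ← div_eq_mul_inv, le_div_iff₀ (by positivity), neg_mul,
      Real.exp_neg, inv_mul_le_iff₀ (Real.exp_pos _)]
    have h1 : 1 + ‖x‖ ≤ Real.exp (ε * ‖x‖ / 3) * (3 / ε) := by
      have h2 := Real.add_one_le_exp (ε * ‖x‖ / 3)
      rw [mul_div_assoc', le_div_iff₀ hε]
      nlinarith
    have h3 : (1 + ‖x‖) ^ (3 : ℝ) = (1 + ‖x‖) ^ 3 := by norm_cast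
    rw [h3]
    calc (1 + ‖x‖) ^ 3 ≤ (Real.exp (ε * ‖x‖ / 3) * (3 / ε)) ^ 3 := by gcongr
      _ = _ := by
        rw [mul_pow, ← Real.exp_nat_mul]
        congr 2
        push_cast
        ring
  refine ne_top_of_le_ne_top ?_ (lintegral_mono hle)
  rw [lintegral_const_mul' _ _ ENNReal.ofReal_ne_top]
  exact ENNReal.mul_ne_top ENNReal.ofReal_ne_top hfin.ne

theorem lintegral_expWeight_ne_zero (ε : ℝ) : ∫⁻ x, expWeight ε 0 x ≠ 0 := by
  rw [Ne, lintegral_eq_zero_iff (measurable_expWeight ε 0)]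
  intro h
  obtain ⟨x, hx⟩ := h.exists
  exact (ENNReal.ofReal_pos.2 (Real.exp_pos _)).ne' hx

/-- The `L¹` norm is controlled by the mean over `y` of the weighted `L²` norms. -/
theorem mul_enorm_le_lintegral_wSq (ε : ℝ) (hε : ∫⁻ x, expWeight (2 * ε) 0 x ≠ ∞) (f : L1) :
    (∫⁻ x, expWeight (2 * ε) 0 x) * ‖f‖ₑ ≤
      (∫⁻ x, expWeight (2 * ε) 0 x) ^ (1 / 2 : ℝ) * ∫⁻ y, wSq ε y f ^ (1 / 2 : ℝ) := by
  have hfm := measurable_L1 f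
  have hsymm : ∀ x y, expWeight (2 * ε) y x = expWeight (2 * ε) 0 (y - x) := fun x y => by
    rw [expWeight, expWeight, sub_zero, norm_sub_rev]
  have heven : ∀ x, expWeight (2 * ε) 0 (-x) = expWeight (2 * ε) 0 x := fun x => by
    rw [expWeight, expWeight, sub_zero, sub_zero, norm_neg]
  have hsq : ∀ x y, expWeight (2 * ε) y x = expWeight ε y x * expWeight ε y x := fun x y => by
    rw [expWeight, expWeight, ← ENNReal.ofReal_mul (Real.exp_pos _).le, ← Real.exp_add]
    ring_nf
  have hm0 : Measurable (expWeight (2 * ε) 0) := measurable_expWeight _ _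
  calc (∫⁻ x, expWeight (2 * ε) 0 x) * ‖f‖ₑ
      = ∫⁻ x, (∫⁻ y, expWeight (2 * ε) 0 (y - x)) * ‖f x‖ₑ := by
        rw [enorm_L1_eq, ← lintegral_const_mul _ hfm.enorm]
        refine lintegral_congr fun x => ?_
        rw [lintegral_sub_right_eq_self (expWeight (2 * ε) 0) x]
    _ = ∫⁻ x, ∫⁻ y, expWeight (2 * ε) 0 (y - x) * ‖f x‖ₑ := by
        refine lintegral_congr fun x => ?_
        rw [lintegral_mul_const _ (by fun_prop)]
    _ = ∫⁻ y, ∫⁻ x, expWeight (2 * ε) 0 (y - x) * ‖f x‖ₑ :=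
        lintegral_lintegral_swap (Measurable.aemeasurable (by
          simp only [Function.uncurry_def]; fun_prop))
    _ ≤ ∫⁻ y, (∫⁻ x, expWeight (2 * ε) 0 x) ^ (1 / 2 : ℝ) * wSq ε y f ^ (1 / 2 : ℝ) := by
        refine lintegral_mono fun y => ?_
        rw [← ENNReal.mul_rpow_of_nonneg _ _ (by norm_num)]
        refine le_rpow_half_of_sq_le ?_
        -- Cauchy–Schwarz with one factor of `w` on each side, writing the weight of rate `2 ε` as
        -- `w · w`.
        have h := sq_lintegral_mul_le (μ := volume) (f := expWeight ε y)
          (g := fun x => expWeight ε y x * ‖f x‖ₑ) (measurable_expWeight ε y).aemeasurable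
          (measurable_weight_mul ε y f).aemeasurable
        calc _ = (∫⁻ x, expWeight ε y x * (expWeight ε y x * ‖f x‖ₑ)) ^ 2 := by
              congr 1
              refine lintegral_congr fun x => ?_
              rw [← hsymm, hsq, mul_assoc]
          _ ≤ _ := h
          _ = _ := by
              rw [← lintegral_comp_sub_left (expWeight (2 * ε) 0) heven y, wSq]
              congr 1
              refine lintegral_congr fun x => ?_
              rw [← hsymm, hsq, pow_two]
    _ = _ := lintegral_const_mul' _ _ (ENNReal.rpow_ne_top_of_nonneg (by norm_num) hε)

/-- The mean over `y` of the weighted `L²` norms of a convolution is controlled by the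
`L¹` norm. -/
theorem IsGoodKernel.lintegral_wSq_convL1_le (hk : IsGoodKernel V k D) {ε : ℝ} (hε : 0 ≤ ε)
    (hε1 : ε ≤ 1) (f : L1) :
    ∫⁻ y, wSq ε y (convL1 k hk.integrable hk.measurable f) ^ (1 / 2 : ℝ) ≤
      (∫⁻ z, D z ^ 2) ^ (1 / 2 : ℝ) * ((∫⁻ x, expWeight ε 0 x) * ‖f‖ₑ) := by
  have hfm := measurable_L1 f
  have hm0 := measurable_expWeight ε 0
  have hsymm : ∀ z y, expWeight ε y z = expWeight ε 0 (y - z) := fun z y => by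
    rw [expWeight, expWeight, sub_zero, norm_sub_rev]
  calc _ ≤ ∫⁻ y, (∫⁻ z, D z ^ 2) ^ (1 / 2 : ℝ) * posConv (expWeight ε 0) (fun z => ‖f z‖ₑ) y := by
        refine lintegral_mono fun y => ?_
        have h := hk.wSq_convL1_le_sq_lintegral hε hε1 y f
        refine (ENNReal.rpow_le_rpow h (by norm_num)).trans_eq ?_
        rw [ENNReal.mul_rpow_of_nonneg _ _ (by norm_num), ← ENNReal.rpow_two, ← ENNReal.rpow_mul]
        norm_num
        congr 1
        refine lintegral_congr fun z => ?_
        rw [hsymm]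
    _ = (∫⁻ z, D z ^ 2) ^ (1 / 2 : ℝ) * ∫⁻ y, posConv (expWeight ε 0) (fun z => ‖f z‖ₑ) y :=
        lintegral_const_mul _ (measurable_posConv hm0 hfm.enorm)
    _ ≤ _ := by
        gcongr
        rw [enorm_L1_eq]
        exact lintegral_posConv_le hm0 hfm.enorm

/-- The a priori `L¹` bound for the resolvent equation off the real axis. -/
theorem IsGoodKernel.exists_enorm_le (hk : IsGoodKernel V k D) (hV : Measurable V)
    {L : ℝ≥0∞} {Vs : Plane → ℝ≥0∞} (hL : L ≠ ∞) (hVs : Measurable Vs)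
    (hVV : ∀ x, ‖V x‖ₑ ≤ L + Vs x) (hVsi : ∫⁻ x, Vs x ≠ ∞) {Z : ℝ≥0∞} (hZ : Z ≠ ∞) :
    ∃ B : ℝ≥0∞, B ≠ ∞ ∧ ∀ (ζ : ℂ) (u g h v : L1), ‖ζ‖ₑ ≤ Z → 1 ≤ |ζ.im| →
      (∀ᵐ x, v x = (ζ - V x) * u x) → g = convL1 k hk.integrable hk.measurable h →
      u = convL1 k hk.integrable hk.measurable g + convL1 k hk.integrable hk.measurable v →
      ‖u‖ₑ ≤ B * ‖h‖ₑ := by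
  obtain ⟨ε, hε0, hε1, B, hB, hest⟩ := hk.exists_wSq_le hV hL hVs hVV hVsi hZ
  have hD2 := hk.lintegral_sq_ne_top
  set c := ∫⁻ x, expWeight (2 * ε) 0 x with hc
  set c' := ∫⁻ x, expWeight ε 0 x with hc'
  set D2 := ∫⁻ z, D z ^ 2
  have hct : c ≠ ∞ := lintegral_expWeight_ne_top (by linarith) (by linarith)
  have hct' : c' ≠ ∞ := lintegral_expWeight_ne_top hε0 (by linarith)
  have hc0 : c ≠ 0 := lintegral_expWeight_ne_zero _
  have hhalf : ∀ a : ℝ≥0∞, a ≠ ∞ → a ^ (1 / 2 : ℝ) ≠ ∞ := fun a ha =>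
    ENNReal.rpow_ne_top_of_nonneg (by norm_num) ha
  refine ⟨c⁻¹ * (c ^ (1 / 2 : ℝ) * (B ^ (1 / 2 : ℝ) * (D2 ^ (1 / 2 : ℝ) * c'))), ?_, ?_⟩
  · have h1 := hhalf c hct
    have h2 := hhalf B hB
    have h3 := hhalf D2 hD2
    have h4 : c⁻¹ ≠ ∞ := ENNReal.inv_ne_top.2 hc0
    finiteness
  intro ζ u g h v hζ him hv hg hu
  -- The weighted bound is uniform in `y`, so its square root can be integrated over all centres; `g
  -- = G h` then returns this mean to the `L¹` norm of `h`.
  have key : ∫⁻ y, wSq ε y u ^ (1 / 2 : ℝ) ≤ B ^ (1 / 2 : ℝ) * (D2 ^ (1 / 2 : ℝ) * (c' * ‖h‖ₑ)) := by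
    calc ∫⁻ y, wSq ε y u ^ (1 / 2 : ℝ)
        ≤ ∫⁻ y, B ^ (1 / 2 : ℝ) * wSq ε y g ^ (1 / 2 : ℝ) := by
          refine lintegral_mono fun y => ?_
          rw [← ENNReal.mul_rpow_of_nonneg _ _ (by norm_num)]
          refine ENNReal.rpow_le_rpow (hest ζ u g v hζ him hv hu y ?_) (by norm_num)
          rw [hg]
          exact hk.wSq_convL1_ne_top hε0.le hε1 y h
      _ = B ^ (1 / 2 : ℝ) * ∫⁻ y, wSq ε y g ^ (1 / 2 : ℝ) := lintegral_const_mul' _ _ (hhalf B hB)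
      _ ≤ _ := by
          gcongr
          rw [hg]
          exact hk.lintegral_wSq_convL1_le hε0.le hε1 h
  have h2 := (mul_enorm_le_lintegral_wSq ε hct u).trans (mul_le_mul_right key _)
  calc ‖u‖ₑ = c⁻¹ * (c * ‖u‖ₑ) := by rw [← mul_assoc, ENNReal.inv_mul_cancel hc0 hct, one_mul]
    _ ≤ c⁻¹ * (c ^ (1 / 2 : ℝ) * (B ^ (1 / 2 : ℝ) * (D2 ^ (1 / 2 : ℝ) * (c' * ‖h‖ₑ)))) := by
        gcongr
    _ = _ := by ring

end WeightedResolvent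

end SchrodingerL1

end

noncomputable section

namespace SchrodingerL1

/-! ### The Schrödinger operator on the imaginary axis -/

section Positivity

variable {V : Plane → ℝ}

/-- The shift `16 = 4 · 2²` is the price of the weight `e ^ (2 |x|)` in
`weight_mul_enorm_resKernel_le`. -/
theorem isGoodKernel_resKernel {C a l : ℝ}
    (hVk : ∀ μ : ℝ, 0 < μ → ∀ y,
      ∫⁻ x, ‖V x‖ₑ * domKernel μ (x - y) ≤ ENNReal.ofReal (C * (1 / μ) ^ a))
    (hl : 16 < l) (hsmall : C * (1 / (l - 16)) ^ a ≤ 1 / 2) :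
    IsGoodKernel V (resKernel l 1) (domKernel (l - 16)) where
  measurable := measurable_resKernel _ _
  measurable_dom := measurable_domKernel _
  integrable := integrable_resKernel (by simp; linarith) one_half_le_inv_one
  even := resKernel_neg _ _
  even_dom x := by simp only [domKernel, norm_neg]
  real := conj_resKernel_one l
  weight_le x := by
    have h := weight_mul_enorm_resKernel_le (z := l) (ω := 1) (μ := l) 2 (by simp)
      one_half_le_inv_one x
    norm_num at h
    exact h
  lintegral_ne_top := by
    rw [lintegral_domKernel (by linarith)]
    exact ENNReal.ofReal_ne_top
  lintegral_sq_ne_top := (lintegral_domKernel_sq_lt_top (by linarith)).ne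
  small y := by
    refine (hVk _ (by linarith) y).trans ((ENNReal.ofReal_le_ofReal hsmall).trans_eq ?_)
    rw [ENNReal.ofReal_div_of_pos two_pos]
    simp

/-- The a priori bound for `H + σ i s`, `1 ≤ s ≤ S`. -/
theorem exists_norm_le_of_mem_graph {q : ℝ≥0∞} (hq : 1 < q) (hV : Measurable V)
    (hVq : MemLp V q) (S : ℝ) : ∃ B : ℝ, 0 ≤ B ∧ ∀ s : ℝ, 1 ≤ s → s ≤ S → ∀ σ : ℝ, σ ^ 2 = 1 →
      ∀ u f, (u, f) ∈ (shift (σ * Complex.I * s) (schrodinger V)).graph → ‖u‖ ≤ B * ‖f‖ := by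
  obtain ⟨C, a, hC, ha, hVk⟩ := exists_lintegral_mul_domKernel_le hq hV hVq
  obtain ⟨L, Vs, hL, hVs, hVV, hVsi⟩ := exists_enorm_le_add hq hV hVq
  obtain ⟨μ₀, hμ₀, hsm⟩ := exists_forall_mul_rpow_le C ha one_half_pos
  set l : ℝ := μ₀ + 16 with hl
  have hre : ((l : ℂ) * 1).re = l := by simp
  have hl0 : 0 < l := by linarith
  have hμ : 0 < ((l : ℂ) * 1).re := by rwa [hre]
  have hk := isGoodKernel_resKernel (l := l) hVk (by linarith)
    (by rw [hl, add_sub_cancel_right]; exact hsm μ₀ le_rfl)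
  obtain ⟨A, hA, -, hAfree⟩ := exists_resolvent_of_small hV hC hVk hμ one_half_le_inv_one
    (by rw [hre]; exact hsm l (by linarith))
  obtain ⟨B, hB, hest⟩ := hk.exists_enorm_le hV hL hVs hVV hVsi
    (Z := ENNReal.ofReal (l + |S|)) ENNReal.ofReal_ne_top
  refine ⟨‖A‖ + (l + |S|) * (B.toReal * 2), by positivity, ?_⟩
  intro s hs1 hsS σ hσ u f huf
  have hσ1 : |σ| = 1 := by
    rw [← sq_eq_sq₀ (abs_nonneg _) zero_le_one, sq_abs, hσ, one_pow]
  set c : ℂ := σ * Complex.I * s with hc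
  set ζ : ℂ := l - c with hζ
  have hζn : ‖ζ‖ ≤ l + |S| := by
    refine (norm_sub_le _ _).trans ?_
    rw [hc, norm_mul, norm_mul, Complex.norm_I, Complex.norm_real, Complex.norm_real,
      Complex.norm_real, Real.norm_of_nonneg hl0.le, Real.norm_eq_abs σ, hσ1, Real.norm_eq_abs,
      one_mul, one_mul]
    gcongr
  have hζe : ‖ζ‖ₑ ≤ ENNReal.ofReal (l + |S|) := by
    rw [← ofReal_norm]
    exact ENNReal.ofReal_le_ofReal hζn
  have hζim : 1 ≤ |ζ.im| := by
    have : ζ.im = -(σ * s) := by simp [hζ, hc]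
    rw [this, abs_neg, abs_mul, hσ1, one_mul]
    exact hs1.trans (le_abs_self s)
  obtain ⟨y, hy, hyf⟩ := mem_shift_graph.1 huf
  have hAu : A (f + ζ • u) = u := by
    refine (hA _ _).1 (mem_shift_graph.2 ⟨y, hy, ?_⟩)
    rw [← hyf, hζ]
    module
  obtain ⟨h, hg, hh⟩ := hAfree f
  set g := A f with hgdef
  set u' := A u with hu'
  -- With `A = (H + l)⁻¹` the equation becomes `u = A f + ζ A u`. It is enough to bound `u' = A u`,
  -- which solves `(-Δ + l) u' = g + (ζ - V) u'`; unlike `f`, the source `g = A f` is the image of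
  -- an `L¹` function `h` under the free resolvent, so the weighted `L²` theory applies.
  have hu : u = g + ζ • u' := by
    nth_rewrite 1 [← hAu]
    rw [map_add, map_smul]
  obtain ⟨y', hy', hyu⟩ := mem_shift_graph.1 ((hA u' u).2 rfl)
  obtain ⟨p, w, hp, hw, rfl⟩ := mem_add_graph.1 hy'
  have hG := (isBoundedInverse_freeRes hμ one_half_le_inv_one _ _).1
    (mem_shift_graph.2 ⟨p, hp, rfl⟩)
  have hsum : (l : ℂ) • u' + p = g + (ζ • u' - w) := by
    have h1 : (l : ℂ) • u' + p = u - w := by rw [← hyu]; abel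
    rw [h1]
    nth_rewrite 1 [hu]
    abel
  rw [hsum, map_add] at hG
  have hv : ∀ᵐ x, (ζ • u' - w : L1) x = (ζ - V x) * u' x := by
    filter_upwards [Lp.coeFn_sub (ζ • u') w, Lp.coeFn_smul ζ u',
      (mem_mulL1_graph _ _ _).1 hw] with x h1 h2 h3
    rw [h1, Pi.sub_apply, h2, h3, Pi.smul_apply, smul_eq_mul]
    ring
  have hu'h : ‖u'‖ ≤ B.toReal * ‖h‖ := by
    refine norm_le_mul_norm_of_enorm ENNReal.toReal_nonneg ?_
    rw [ENNReal.ofReal_toReal hB]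
    exact hest ζ u' g h (ζ • u' - w) hζe hζim hv hg hG.symm
  calc ‖u‖ ≤ ‖g‖ + ‖ζ • u'‖ := by nth_rewrite 1 [hu]; exact norm_add_le _ _
    _ ≤ ‖A‖ * ‖f‖ + (l + |S|) * (B.toReal * (2 * ‖f‖)) := by
        rw [norm_smul]
        gcongr
        · exact A.le_opNorm f
        · exact hu'h.trans (by gcongr)
    _ = _ := by ring

/-- The resolvent of the Schrödinger operator on the imaginary axis outside `(-i, i)`. -/
theorem exists_resolvent_imaginary {q : ℝ≥0∞} (hq : 1 < q) (hV : Measurable V)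
    (hVq : MemLp V q) : ∃ B : ℝ, 0 ≤ B ∧ ∀ s : ℝ, 1 ≤ s → ∀ σ : ℝ, σ ^ 2 = 1 →
      ∃ R : L1 →L[ℂ] L1, IsBoundedInverse (shift (σ * Complex.I * s) (schrodinger V)) R ∧
        ‖R‖ ≤ B / s := by
  obtain ⟨C, a, hC, ha, hVk⟩ := exists_lintegral_mul_domKernel_le hq hV hVq
  obtain ⟨S, hS, hlarge⟩ := exists_resolvent_large hV hC ha hVk
  obtain ⟨B, hB, hap⟩ := exists_norm_le_of_mem_graph hq hV hVq S
  have hbound : ∀ s : ℝ, 1 ≤ s → s ≤ S → ∀ σ : ℝ, σ ^ 2 = 1 → ∀ R : L1 →L[ℂ] L1,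
      IsBoundedInverse (shift (σ * Complex.I * s) (schrodinger V)) R → ‖R‖ ≤ B :=
    fun s hs hsS σ hσ R hR => R.opNorm_le_bound hB fun f =>
      hap s hs hsS σ hσ (R f) f ((hR _ _).2 rfl)
  set δ : ℝ := 1 / (2 * (B + 1)) with hδ
  have hδ0 : 0 < δ := by positivity
  have hδB : δ * B ≤ 1 / 2 := by
    rw [hδ, div_mul_eq_mul_div, one_mul, div_le_div_iff₀ (by positivity) two_pos]
    linarith
  -- Continuation downwards from `S`: the a priori bound is the same at every `s`, so each step may
  -- have the fixed length `δ`.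
  have hex : ∀ n : ℕ, ∀ s : ℝ, 1 ≤ s → s ≤ S → S - n * δ ≤ s → ∀ σ : ℝ, σ ^ 2 = 1 →
      ∃ R : L1 →L[ℂ] L1, IsBoundedInverse (shift (σ * Complex.I * s) (schrodinger V)) R := by
    intro n
    induction n with
    | zero =>
      intro s _ _ hs σ hσ
      obtain ⟨R, hR, -⟩ := hlarge s (by simpa using hs) σ hσ
      exact ⟨R, hR⟩
    | succ n ih =>
      intro s hs1 hsS hs σ hσ
      push_cast at hs
      set s' := min S (s + δ) with hs'
      have h1 : s ≤ s' := le_min hsS (by linarith)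
      have h2 : s' ≤ s + δ := min_le_right _ _
      have h3 : S - n * δ ≤ s' := by
        refine le_min ?_ (by linarith)
        have : 0 ≤ n * δ := by positivity
        linarith
      obtain ⟨R, hR⟩ := ih s' (hs1.trans h1) (min_le_left _ _) h3 σ hσ
      refine hR.exists_shift_near (d := σ * Complex.I * s) ?_
      have hσ1 : |σ| = 1 := by
        rw [← sq_eq_sq₀ (abs_nonneg _) zero_le_one, sq_abs, hσ, one_pow]
      have hn : ‖(σ * Complex.I * s - σ * Complex.I * s' : ℂ)‖ ≤ δ := by
        rw [← mul_sub, ← Complex.ofReal_sub, norm_mul, norm_mul, Complex.norm_I,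
          Complex.norm_real, Complex.norm_real, Real.norm_eq_abs, hσ1, one_mul, one_mul,
          Real.norm_eq_abs, abs_le]
        constructor <;> linarith
      calc _ ≤ δ * B := by
            gcongr
            exact hbound s' (hs1.trans h1) (min_le_left _ _) σ hσ R hR
        _ ≤ 1 / 2 := hδB
  refine ⟨32 * Real.pi + B * S, by positivity, fun s hs σ hσ => ?_⟩
  have hs0 : 0 < s := by linarith
  rcases le_total S s with h | h
  · obtain ⟨R, hR, hRn⟩ := hlarge s h σ hσ
    refine ⟨R, hR, hRn.trans ?_⟩
    gcongr
    have : 0 ≤ B * S := by positivity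
    linarith
  · obtain ⟨n, hn⟩ := exists_nat_ge (S / δ)
    rw [div_le_iff₀ hδ0] at hn
    obtain ⟨R, hR⟩ := hex n s hs h (by linarith) σ hσ
    refine ⟨R, hR, (hbound s hs h σ hσ R hR).trans ?_⟩
    rw [le_div_iff₀ hs0]
    have h1 : B * s ≤ B * S := by gcongr
    have h2 : 0 ≤ 32 * Real.pi := by positivity
    linarith

/-- The two resolvents of `H` at `∓ i √(1 + t)` give the resolvent of `1 + H²` at `-t`. -/
theorem isBoundedInverse_oneAddSq {s t : ℝ} (hst : s ^ 2 = 1 + t) {R S : L1 →L[ℂ] L1}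
    (hR : IsBoundedInverse (shift ((1 : ℝ) * Complex.I * s) (schrodinger V)) R)
    (hS : IsBoundedInverse (shift ((-1 : ℝ) * Complex.I * s) (schrodinger V)) S) :
    IsBoundedInverse (shift (t : ℂ) (oneAddSq V)) (S * R) := by
  refine hR.shift_one_add_sq (by convert hS using 2; push_cast; ring) ?_
  have h : ((s : ℂ)) ^ 2 = 1 + t := by exact_mod_cast congrArg Complex.ofReal hst
  push_cast
  linear_combination h + (-(s : ℂ) ^ 2) * Complex.I_sq

theorem isPositiveOperator_oneAddSq {q : ℝ≥0∞} (hq : 1 < q) (hV : Measurable V)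
    (hVq : MemLp V q) : IsPositiveOperator (oneAddSq V) := by
  obtain ⟨B, hB, hres⟩ := exists_resolvent_imaginary hq hV hVq
  refine ⟨B ^ 2, fun t ht => ?_⟩
  have hs : 1 ≤ √(1 + t) := by
    rw [Real.one_le_sqrt]
    linarith
  have hs2 : √(1 + t) ^ 2 = 1 + t := Real.sq_sqrt (by linarith)
  obtain ⟨R, hR, hRn⟩ := hres _ hs 1 (by norm_num)
  obtain ⟨S, hS, hSn⟩ := hres _ hs (-1) (by norm_num)
  refine ⟨S * R, isBoundedInverse_oneAddSq hs2 hR hS, (norm_mul_le _ _).trans ?_⟩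
  calc ‖S‖ * ‖R‖ ≤ (B / √(1 + t)) * (B / √(1 + t)) := by gcongr
    _ = B ^ 2 / (1 + t) := by rw [div_mul_div_comm, ← pow_two, ← pow_two, hs2]

end Positivity

end SchrodingerL1

end

noncomputable section

namespace SchrodingerL1

/-! ### Bessel potentials as integrals of free resolvents -/

section Bessel

theorem IsBoundedInverse.shift_shift {X : Type*} [NormedAddCommGroup X] [NormedSpace ℂ X]
    {A : X →ₗ.[ℂ] X} {c d : ℂ} {R : X →L[ℂ] X} (hR : IsBoundedInverse (shift (d + c) A) R) :
    IsBoundedInverse (shift c (shift d A)) R := by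
  intro u x
  rw [← hR u x]
  simp only [mem_shift_graph]
  constructor
  · rintro ⟨_, ⟨y, hy, rfl⟩, rfl⟩
    exact ⟨y, hy, by module⟩
  · rintro ⟨y, hy, rfl⟩
    exact ⟨_, ⟨y, hy, rfl⟩, by module⟩

theorem one_add_mul_one_re (t : ℝ) : ((1 + t : ℂ) * 1).re = 1 + t := by simp

theorem one_add_mul_one_re_pos {t : ℝ} (ht : 0 ≤ t) : 0 < ((1 + t : ℂ) * 1).re := by
  rw [one_add_mul_one_re]
  linarith

theorem isBoundedInverse_one_sub_laplacianL1 {t : ℝ} (ht : 0 ≤ t) :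
    IsBoundedInverse (shift (t : ℂ) (shift 1 (-laplacianL1)))
      (freeRes (1 + t) 1 (one_add_mul_one_re_pos ht) one_half_le_inv_one) :=
  (isBoundedInverse_freeRes _ _).shift_shift

/-- `1 - Δ` is a positive operator in `L¹`. -/
theorem isPositiveOperator_one_sub_laplacianL1 :
    IsPositiveOperator (shift 1 (-laplacianL1)) := by
  refine ⟨16 * Real.pi, fun t ht => ⟨_, isBoundedInverse_one_sub_laplacianL1 ht, ?_⟩⟩
  have h := norm_freeRes_le (one_add_mul_one_re_pos ht) one_half_le_inv_one
  rwa [one_add_mul_one_re] at h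

/-- `(1 - Δ + τ)⁻¹` on `L¹`. -/
def besselRes (τ : ℝ) : L1 →L[ℂ] L1 := boundedInverse (shift (τ : ℂ) (shift 1 (-laplacianL1)))

theorem besselRes_eq {τ : ℝ} (hτ : 0 ≤ τ) :
    besselRes τ = freeRes (1 + τ) 1 (one_add_mul_one_re_pos hτ) one_half_le_inv_one :=
  (isBoundedInverse_one_sub_laplacianL1 hτ).boundedInverse_eq

theorem norm_besselRes_le {τ : ℝ} (hτ : 0 ≤ τ) : ‖besselRes τ‖ ≤ 16 * Real.pi / (1 + τ) := by
  have h := norm_freeRes_le (one_add_mul_one_re_pos hτ) one_half_le_inv_one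
  rwa [one_add_mul_one_re, ← besselRes_eq hτ] at h

theorem fourierAt_besselRes {τ : ℝ} (hτ : 0 ≤ τ) (f : L1) (ξ : Plane) :
    fourierAt ξ (besselRes τ f) =
      (((1 + laplaceSymbol ξ + τ)⁻¹ : ℝ) : ℂ) * fourierAt ξ f := by
  rw [besselRes_eq hτ, fourierAt_freeRes]
  push_cast
  ring

theorem integrableOn_rpow_smul_besselRes {β : ℝ} (hβ : 0 < β) (hβ1 : β < 1) :
    IntegrableOn (fun τ : ℝ => τ ^ (-β) • besselRes τ) (Ioi 0) := by
  obtain ⟨M, hM⟩ := isPositiveOperator_one_sub_laplacianL1.isResolventFamily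
  exact hM.integrableOn_rpow_smul hβ hβ1

/-- The constant `π / sin (π β)`, as an integral. -/
def besselConst (β : ℝ) : ℝ := ∫ τ in Ioi (0 : ℝ), τ ^ (-β) * (1 + τ)⁻¹

theorem besselConst_pos {β : ℝ} (hβ : 0 < β) (hβ1 : β < 1) : 0 < besselConst β := by
  have h_int : IntegrableOn (fun τ : ℝ => τ ^ (-β) * (1 + τ)⁻¹) (Ioi 0) := by
    have h := integrableOn_rpow_mul_one_add_rpow (a := -β) (b := -1) (by linarith) (by norm_num)
      (by linarith)
    simpa only [Real.rpow_neg_one] using h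
  have hpos : ∀ τ : ℝ, 0 < τ → 0 < τ ^ (-β) * (1 + τ)⁻¹ := fun τ hτ => by positivity
  rw [besselConst, setIntegral_pos_iff_support_of_nonneg_ae _ h_int]
  · have : Function.support (fun τ : ℝ => τ ^ (-β) * (1 + τ)⁻¹) ∩ Ioi 0 = Ioi 0 :=
      inter_eq_right.2 fun τ hτ => (hpos τ hτ).ne'
    rw [this]
    simp
  · filter_upwards [ae_restrict_mem measurableSet_Ioi] with τ hτ
    exact (hpos τ hτ).le

theorem integral_rpow_mul_add_inv (β : ℝ) {b : ℝ} (hb : 0 < b) :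
    ∫ τ in Ioi (0 : ℝ), τ ^ (-β) * (b + τ)⁻¹ = b ^ (-β) * besselConst β := by
  have h := integral_comp_mul_left_Ioi (fun τ : ℝ => τ ^ (-β) * (b + τ)⁻¹) 0 hb
  rw [mul_zero, smul_eq_mul] at h
  have h2 : ∫ τ in Ioi (0 : ℝ), (b * τ) ^ (-β) * (b + b * τ)⁻¹ =
      b⁻¹ * (b ^ (-β) * besselConst β) := by
    rw [besselConst, ← integral_const_mul, ← integral_const_mul]
    refine setIntegral_congr_fun measurableSet_Ioi fun τ hτ => ?_
    have hτ : 0 < τ := hτ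
    have e : b + b * τ = b * (1 + τ) := by ring
    rw [Real.mul_rpow hb.le hτ.le, e, mul_inv]
    ring
  rw [h2] at h
  exact (mul_left_cancel₀ (inv_ne_zero hb.ne') h).symm

/-- The operator `(1 - Δ) ^ (-β)` on `L¹`. -/
def besselOp (β : ℝ) : L1 →L[ℂ] L1 :=
  (besselConst β)⁻¹ • ∫ τ in Ioi (0 : ℝ), τ ^ (-β) • besselRes τ

theorem isBesselPotential_besselOp {β : ℝ} (hβ : 0 < β) (hβ1 : β < 1) (f : L1) :
    IsBesselPotential β f (besselOp β f) := by
  rw [isBesselPotential_iff_fourierAt]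
  intro ξ
  have hb : 0 < 1 + laplaceSymbol ξ := by
    have := laplaceSymbol_nonneg ξ
    linarith
  have hc := besselConst_pos hβ hβ1
  have h1 := ((fourierAt ξ).comp (ContinuousLinearMap.apply ℂ L1 f)).integral_comp_comm
    (integrableOn_rpow_smul_besselRes hβ hβ1)
  have h2 : ∫ τ in Ioi (0 : ℝ), ((fourierAt ξ).comp (ContinuousLinearMap.apply ℂ L1 f))
      (τ ^ (-β) • besselRes τ) =
      (((1 + laplaceSymbol ξ) ^ (-β) * besselConst β : ℝ) : ℂ) * fourierAt ξ f := by
    rw [← integral_rpow_mul_add_inv β hb, ← integral_complex_ofReal, ← integral_mul_const]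
    refine setIntegral_congr_fun measurableSet_Ioi fun τ hτ => ?_
    have hτ : 0 < τ := hτ
    change fourierAt ξ ((τ ^ (-β) • besselRes τ) f) = _
    rw [_root_.smul_apply, (fourierAt ξ).map_smul_of_tower, fourierAt_besselRes hτ.le,
      Complex.real_smul]
    push_cast
    ring
  rw [h2] at h1
  change fourierAt ξ ((besselConst β)⁻¹ • (∫ τ in Ioi (0 : ℝ), τ ^ (-β) • besselRes τ) f) = _
  rw [(fourierAt ξ).map_smul_of_tower]
  change (besselConst β)⁻¹ • ((fourierAt ξ).comp (ContinuousLinearMap.apply ℂ L1 f))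
    (∫ τ in Ioi (0 : ℝ), τ ^ (-β) • besselRes τ) = _
  rw [← h1, Complex.real_smul]
  have hc' : (besselConst β : ℂ) ≠ 0 := Complex.ofReal_ne_zero.2 hc.ne'
  push_cast
  field_simp

end Bessel

/-! ### The mapping property of `⟨H⟩ ^ α` -/

section Mapping

variable {V : Plane → ℝ}

/-- The algebraic identity behind the decay of `(1 + H²) (1 + H² + t)⁻¹` on the domain of `H`. -/
theorem sub_smul_resolvent_apply {A : L1 →ₗ.[ℂ] L1} {s t : ℝ} (hst : s ^ 2 = 1 + t)
    {R S : L1 →L[ℂ] L1} (hR : IsBoundedInverse (shift ((1 : ℝ) * Complex.I * s) A) R)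
    (hS : IsBoundedInverse (shift ((-1 : ℝ) * Complex.I * s) A) S) {v w : L1}
    (hv : (v, w) ∈ A.graph) :
    v - t • (S * R) v = R (w + Complex.I • v) +
      (Complex.I * (s - 1)) • S (R (w + Complex.I • v)) := by
  have h1 : R (((1 : ℝ) * Complex.I * s) • v + w) = v := (hR _ _).1 (mem_shift_graph.2 ⟨w, hv, rfl⟩)
  -- From `(H + i s) v = (H + i) v + i (s - 1) v`, after applying `R`.
  have h2 : R (w + Complex.I • v) = v - (Complex.I * (s - 1)) • R v := by
    rw [eq_sub_iff_add_eq, ← map_smul, ← map_add]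
    nth_rewrite 3 [← h1]
    congr 1
    push_cast
    module
  -- The resolvent identity between the points `i s` and `-i s`.
  have h3 : S v - R v = (2 * Complex.I * s) • S (R v) := by
    have h := congrArg (fun T : L1 →L[ℂ] L1 => T v) (hS.sub_eq hR)
    change S v - R v = (_ : ℂ) • S (R v) at h
    rw [h]
    congr 1
    push_cast
    ring
  have h4 : S v = R v + (2 * Complex.I * s) • S (R v) := by rw [← h3]; abel
  have ht : (t : ℂ) = s ^ 2 - 1 := by
    have : t = s ^ 2 - 1 := by linarith
    rw [this]
    push_cast
    rfl
  have hreal : t • S (R v) = (t : ℂ) • S (R v) := (Complex.coe_smul t (S (R v))).symm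
  rw [h2, map_sub, map_smul, h4, mul_apply_eq_comp, hreal, ht, smul_sub, smul_add,
    smul_smul, smul_smul]
  have e : Complex.I * (s - 1) * (2 * Complex.I * s) = -(2 * s * (s - 1)) := by
    linear_combination 2 * s * (s - 1) * Complex.I_sq
  have e' : Complex.I * (s - 1) * (Complex.I * (s - 1)) = -(s - 1 : ℂ) ^ 2 := by
    linear_combination (s - 1 : ℂ) ^ 2 * Complex.I_sq
  rw [e, e']
  module

/-- Geometric interpolation: `X` is the product of its powers `1 - θ` and `θ`, each estimated by one
of the bounds. -/
theorem le_rpow_mul_rpow {X K a b θ : ℝ} (hX : 0 ≤ X) (hK : 0 ≤ K) (ha : 0 < a) (hb : 0 < b)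
    (hθ : 0 ≤ θ) (hθ1 : θ ≤ 1) (h1 : X ≤ K / a) (h2 : X ≤ K / b) :
    X ≤ K * (a ^ (-(1 - θ)) * b ^ (-θ)) := by
  calc X = X ^ (1 - θ) * X ^ θ := by
        rw [← Real.rpow_add' hX (by norm_num)]
        norm_num
    _ ≤ (K / a) ^ (1 - θ) * (K / b) ^ θ := by
        have : 0 ≤ 1 - θ := by linarith
        gcongr
    _ = (K ^ (1 - θ) * K ^ θ) * (a ^ (-(1 - θ)) * b ^ (-θ)) := by
        rw [Real.div_rpow hK ha.le, Real.div_rpow hK hb.le, Real.rpow_neg ha.le,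
          Real.rpow_neg hb.le]
        ring
    _ = _ := by
        rw [← Real.rpow_add' hK (by norm_num)]
        norm_num

/-- Decay of `(1 + H²) (1 + H² + t)⁻¹ (1 - Δ + τ)⁻¹` in both parameters. -/
theorem exists_norm_besselRes_sub_le {q : ℝ≥0∞} (hq : 1 < q) (hV : Measurable V)
    (hVq : MemLp V q) : ∃ K : ℝ, 0 ≤ K ∧ ∀ τ t : ℝ, 0 ≤ τ → 0 ≤ t → ∀ f : L1,
      ‖besselRes τ f - t • boundedInverse (shift (t : ℂ) (oneAddSq V)) (besselRes τ f)‖ ≤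
        K * ‖f‖ / (1 + τ) ∧
      ‖besselRes τ f - t • boundedInverse (shift (t : ℂ) (oneAddSq V)) (besselRes τ f)‖ ≤
        K * ‖f‖ / √(1 + t) := by
  obtain ⟨B, hB, hres⟩ := exists_resolvent_imaginary hq hV hVq
  obtain ⟨C, a, hC, ha, hVk⟩ := exists_lintegral_mul_domKernel_le hq hV hVq
  set P := 16 * Real.pi with hP
  have hP0 : 0 ≤ P := by positivity
  refine ⟨(1 + B ^ 2) * P + (B + B ^ 2) * (1 + 2 * P + C), by positivity, fun τ t hτ ht f => ?_⟩
  have hs : 1 ≤ √(1 + t) := by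
    rw [Real.one_le_sqrt]
    linarith
  have hs2 : √(1 + t) ^ 2 = 1 + t := Real.sq_sqrt (by linarith)
  set s := √(1 + t) with hsdef
  have hs0 : 0 < s := by linarith
  obtain ⟨R, hR, hRn⟩ := hres _ hs 1 (by norm_num)
  obtain ⟨S, hS, hSn⟩ := hres _ hs (-1) (by norm_num)
  rw [(isBoundedInverse_oneAddSq hs2 hR hS).boundedInverse_eq]
  set v := besselRes τ f with hv
  have hvn : ‖v‖ ≤ P / (1 + τ) * ‖f‖ :=
    (ContinuousLinearMap.le_opNorm _ _).trans (by gcongr; exact norm_besselRes_le hτ)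
  constructor
  -- Decay in `τ`: `A (A + t)⁻¹` is bounded uniformly in `t`, and `v` itself is `O(1 / (1 + τ))`.
  · have h1 : ‖t • (S * R) v‖ ≤ B ^ 2 * ‖v‖ := by
      have h2 : ‖S * R‖ ≤ B ^ 2 / (1 + t) := by
        refine (norm_mul_le _ _).trans ?_
        calc ‖S‖ * ‖R‖ ≤ (B / s) * (B / s) := by gcongr
          _ = B ^ 2 / (1 + t) := by rw [div_mul_div_comm, ← pow_two, ← pow_two, hs2]
      rw [norm_smul, Real.norm_of_nonneg ht]
      calc t * ‖(S * R) v‖ ≤ t * (B ^ 2 / (1 + t) * ‖v‖) := by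
            gcongr
            exact (ContinuousLinearMap.le_opNorm _ _).trans (by gcongr)
        _ = t / (1 + t) * (B ^ 2 * ‖v‖) := by ring
        _ ≤ 1 * (B ^ 2 * ‖v‖) := by
            gcongr
            rw [div_le_one (by linarith)]
            linarith
        _ = _ := one_mul _
    calc _ ≤ ‖v‖ + B ^ 2 * ‖v‖ := (norm_sub_le _ _).trans (by gcongr)
      _ = (1 + B ^ 2) * ‖v‖ := by ring
      _ ≤ (1 + B ^ 2) * (P / (1 + τ) * ‖f‖) := by gcongr
      _ = ((1 + B ^ 2) * P) * ‖f‖ / (1 + τ) := by ring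
      _ ≤ _ := by
          gcongr
          have : 0 ≤ (B + B ^ 2) * (1 + 2 * P + C) := by positivity
          linarith
  -- Decay in `t`: `-Δ v = f - (1 + τ) v` and `V v` are bounded uniformly in `τ`, so `(H + i) v` is
  -- too. In `sub_smul_resolvent_apply` the factor `s - 1` is offset by one of the two resolvents,
  -- each `O(1 / s)`.
  · obtain ⟨T, hT, hTn⟩ := exists_mul_freeRes hV hC hVk (one_add_mul_one_re_pos hτ)
      one_half_le_inv_one
    have hTf : (v, T f) ∈ (mulL1 V).graph := by
      rw [hv, besselRes_eq hτ]
      exact hT f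
    have hTn' : ‖T f‖ ≤ C * ‖f‖ := by
      refine (T.le_opNorm f).trans ?_
      gcongr
      refine hTn.trans (mul_le_of_le_one_right hC ?_)
      rw [one_add_mul_one_re]
      refine Real.rpow_le_one (by positivity) ?_ ha.le
      rw [div_le_one (by linarith)]
      linarith
    have hfree : (v, f) ∈ (shift (1 + τ : ℂ) (-laplacianL1)).graph := by
      rw [isBoundedInverse_freeRes (one_add_mul_one_re_pos hτ) one_half_le_inv_one, hv,
        besselRes_eq hτ]
    obtain ⟨y, hy, hyf⟩ := mem_shift_graph.1 hfree
    have hgraph : (v, y + T f) ∈ (schrodinger V).graph :=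
      mem_add_graph.2 ⟨y, T f, hy, hTf, rfl⟩
    rw [sub_smul_resolvent_apply hs2 hR hS hgraph]
    set k := y + T f + Complex.I • v with hk
    have hvn1 : ‖v‖ ≤ P * ‖f‖ := by
      refine hvn.trans ?_
      gcongr
      exact div_le_self hP0 (by linarith)
    have hyn : ‖y‖ ≤ ‖f‖ + P * ‖f‖ := by
      have hy' : y = f - (1 + τ : ℂ) • v := by rw [← hyf]; abel
      rw [hy']
      refine (norm_sub_le _ _).trans ?_
      have e : (1 + τ : ℂ) = ((1 + τ : ℝ) : ℂ) := by push_cast; rfl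
      rw [norm_smul, e, Complex.norm_real, Real.norm_of_nonneg (by linarith)]
      gcongr ‖f‖ + ?_
      calc (1 + τ) * ‖v‖ ≤ (1 + τ) * (P / (1 + τ) * ‖f‖) := by gcongr
        _ = P * ‖f‖ := by field_simp
    have hkn : ‖k‖ ≤ (1 + 2 * P + C) * ‖f‖ := by
      calc ‖k‖ ≤ ‖y‖ + ‖T f‖ + ‖Complex.I • v‖ := norm_add₃_le
        _ ≤ (‖f‖ + P * ‖f‖) + C * ‖f‖ + P * ‖f‖ := by
            rw [norm_smul, Complex.norm_I, one_mul]
            gcongr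
        _ = _ := by ring
    have hRk : ‖R k‖ ≤ B / s * ‖k‖ := (R.le_opNorm k).trans (by gcongr)
    have hSRk : ‖S (R k)‖ ≤ B / s * (B / s * ‖k‖) := (S.le_opNorm _).trans (by gcongr)
    have hcoef : ‖(Complex.I * (s - 1) : ℂ)‖ ≤ s := by
      have e : (s - 1 : ℂ) = ((s - 1 : ℝ) : ℂ) := by push_cast; rfl
      rw [norm_mul, Complex.norm_I, one_mul, e, Complex.norm_real,
        Real.norm_of_nonneg (by linarith)]
      linarith
    calc _ ≤ ‖R k‖ + ‖(Complex.I * (s - 1)) • S (R k)‖ := norm_add_le _ _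
      _ ≤ B / s * ‖k‖ + s * (B / s * (B / s * ‖k‖)) := by
          rw [norm_smul]
          gcongr
      _ = (B + B ^ 2) * ‖k‖ / s := by field_simp
      _ ≤ (B + B ^ 2) * ((1 + 2 * P + C) * ‖f‖) / s := by gcongr
      _ = (B + B ^ 2) * (1 + 2 * P + C) * ‖f‖ / s := by ring
      _ ≤ _ := by
          gcongr
          have : 0 ≤ (1 + B ^ 2) * P := by positivity
          linarith

/-- Interpolation of the two decays under the integral: `τ ^ (-β) (1 + τ) ^ (-(1 - θ))` is
integrable at infinity exactly because `θ < β`, and at `0` because `β < 1`. -/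
theorem exists_norm_besselOp_sub_le {q : ℝ≥0∞} (hq : 1 < q) (hV : Measurable V)
    (hVq : MemLp V q) {β θ : ℝ} (hθ : 0 < θ) (hθβ : θ < β) (hβ1 : β < 1) :
    ∃ K : ℝ, 0 ≤ K ∧ ∀ t : ℝ, 0 ≤ t → ∀ f : L1,
      ‖besselOp β f - t • boundedInverse (shift (t : ℂ) (oneAddSq V)) (besselOp β f)‖ ≤
        K * ‖f‖ * (1 + t) ^ (-(θ / 2)) := by
  obtain ⟨K, hK, hdec⟩ := exists_norm_besselRes_sub_le hq hV hVq
  have hβ : 0 < β := hθ.trans hθβ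
  have hc := besselConst_pos hβ hβ1
  have hI := integrableOn_rpow_mul_one_add_rpow (a := -β) (b := -(1 - θ)) (by linarith)
    (by linarith) (by linarith)
  set J := ∫ τ in Ioi (0 : ℝ), τ ^ (-β) * (1 + τ) ^ (-(1 - θ)) with hJ
  have hJ0 : 0 ≤ J := setIntegral_nonneg measurableSet_Ioi fun τ hτ => by
    have hτ : 0 < τ := hτ
    positivity
  refine ⟨(besselConst β)⁻¹ * (K * J), by positivity, fun t ht f => ?_⟩
  set T : L1 →L[ℂ] L1 := 1 - t • boundedInverse (shift (t : ℂ) (oneAddSq V)) with hT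
  have hs : √(1 + t) ^ (-θ) = (1 + t) ^ (-(θ / 2)) := by
    rw [Real.sqrt_eq_rpow, ← Real.rpow_mul (by linarith)]
    ring_nf
  have hs0 : 0 < √(1 + t) := Real.sqrt_pos.2 (by linarith)
  have h1 := (T.comp (ContinuousLinearMap.apply ℂ L1 f)).integral_comp_comm
    (integrableOn_rpow_smul_besselRes hβ hβ1)
  change _ = T ((∫ τ in Ioi (0 : ℝ), τ ^ (-β) • besselRes τ) f) at h1
  change ‖T ((besselConst β)⁻¹ • (∫ τ in Ioi (0 : ℝ), τ ^ (-β) • besselRes τ) f)‖ ≤ _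
  rw [T.map_smul_of_tower, ← h1, norm_smul, Real.norm_of_nonneg (by positivity), mul_assoc,
    mul_assoc]
  gcongr
  calc _ ≤ ∫ τ in Ioi (0 : ℝ), K * ‖f‖ * (1 + t) ^ (-(θ / 2)) *
        (τ ^ (-β) * (1 + τ) ^ (-(1 - θ))) := by
        refine norm_integral_le_of_norm_le (hI.const_mul _) ?_
        filter_upwards [ae_restrict_mem measurableSet_Ioi] with τ hτ
        have hτ : 0 < τ := hτ
        change ‖T ((τ ^ (-β) • besselRes τ) f)‖ ≤ _
        rw [_root_.smul_apply, T.map_smul_of_tower, norm_smul,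
          Real.norm_of_nonneg (by positivity)]
        obtain ⟨ha, hb⟩ := hdec τ t hτ.le ht f
        have hX := le_rpow_mul_rpow (norm_nonneg _) (by positivity) (by linarith) hs0 hθ.le
          (by linarith) ha hb
        rw [hs] at hX
        calc τ ^ (-β) * ‖T (besselRes τ f)‖
            ≤ τ ^ (-β) * (K * ‖f‖ * ((1 + τ) ^ (-(1 - θ)) * (1 + t) ^ (-(θ / 2)))) := by
              gcongr
              exact hX
          _ = _ := by ring
    _ = _ := by
        rw [integral_const_mul]
        ring

/-- Multiplication sees only the class of `V` modulo null sets, so a Borel representative may be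
used in all kernel estimates. -/
theorem mulL1_congr {V W : Plane → ℝ} (h : V =ᵐ[volume] W) : mulL1 V = mulL1 W := by
  have : mulGraph V = mulGraph W := by
    ext p
    change (⇑p.2 =ᵐ[volume] fun x => (V x : ℂ) * p.1 x) ↔
      ⇑p.2 =ᵐ[volume] fun x => (W x : ℂ) * p.1 x
    have hVW : (fun x => (V x : ℂ) * p.1 x) =ᵐ[volume] fun x => (W x : ℂ) * p.1 x := by
      filter_upwards [h] with x hx
      rw [hx]
    exact ⟨fun h' => h'.trans hVW, fun h' => h'.trans hVW.symm⟩
  rw [mulL1, mulL1, this]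

theorem oneAddSq_congr {V W : Plane → ℝ} (h : V =ᵐ[volume] W) : oneAddSq V = oneAddSq W := by
  rw [oneAddSq, oneAddSq, schrodinger, schrodinger, mulL1_congr h]

end Mapping

end SchrodingerL1

end

/-! ### The theorem: choice of the exponents. -/

theorem lemmaC1 (q : ENNReal) (hq : 1 < q) (V : SchrodingerL1.Plane → ℝ)
    (hV : MeasureTheory.MemLp V q MeasureTheory.volume)
    (α β : ℝ) (hα : 0 < α) (hαβ : α < β) (hβ : β < 1) :
    SchrodingerL1.IsPositiveOperator (SchrodingerL1.oneAddSq V) ∧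
    Function.Injective (SchrodingerL1.negPow (SchrodingerL1.oneAddSq V) (α / 2)) ∧
    ∃ C : ℝ, ∀ f : SchrodingerL1.L1, ∃ u : (SchrodingerL1.japanesePow V α).domain,
      SchrodingerL1.IsBesselPotential β f u ∧
      ‖SchrodingerL1.japanesePow V α u‖ ≤ C * ‖f‖ := by
  obtain ⟨W, hW, hVW⟩ : ∃ W : SchrodingerL1.Plane → ℝ, Measurable W ∧ V =ᵐ[volume] W :=
    ⟨hV.1.mk V, hV.1.stronglyMeasurable_mk.measurable, hV.1.ae_eq_mk⟩
  have hWq : MemLp W q := (memLp_congr_ae hVW).1 hV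
  have hpos : SchrodingerL1.IsPositiveOperator (SchrodingerL1.oneAddSq V) := by
    rw [SchrodingerL1.oneAddSq_congr hVW]
    exact SchrodingerL1.isPositiveOperator_oneAddSq hq hW hWq
  have hp : 0 < α / 2 := by linarith
  have hp1 : α / 2 < 1 := by linarith
  refine ⟨hpos, hpos.negPow_injective hp hp1, ?_⟩
  -- The midpoint `θ = (α + β) / 2` leaves room on both sides: `θ < β` for the `τ` integral and `θ >
  -- α` for the fractional power.
  obtain ⟨K, hK, hdec⟩ := SchrodingerL1.exists_norm_besselOp_sub_le hq hW hWq (β := β)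
    (θ := (α + β) / 2) (by linarith) (by linarith) hβ
  -- `δ` is the surplus decay: `α / 2 + (β - α) / 4 = θ / 2`.
  obtain ⟨M, hM⟩ := hpos.exists_fracPow hp hp1 (δ := (β - α) / 4) (by linarith)
  refine ⟨M * K, fun f => ?_⟩
  obtain ⟨u, hu, hun⟩ := hM (K * ‖f‖) (SchrodingerL1.besselOp β f) (by positivity) fun t ht => by
    have h := hdec t ht.le f
    rw [← SchrodingerL1.oneAddSq_congr hVW] at h
    refine h.trans_eq ?_
    congr 2
    ring
  refine ⟨u, ?_, ?_⟩
  · rw [hu]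
    exact SchrodingerL1.isBesselPotential_besselOp (by linarith) hβ f
  · rw [mul_assoc]
    exact hun
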